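/- Fix $h\neq 0$ and let $\bar u=\bar u(n,\bar x)$, $n\in\mathbb Z$, $\bar x\in\mathbb R$, be a rapidly decreasing field. Put $Ef(n)=f(n+1)$, $\Delta=E-1$, and let $\Delta^{-1}$ be the inverse of $\Delta$ on such functions. Let $\bar{\mathcal F}$ be the algebra of functions $f(\bar u)$ built from $\bar u$ by linear combinations, products, multiplication by $\bar x$ and $n$, and the operators $E^{\pm1},\Delta^{-1},\partial_{\bar x}$ (so $f(0)=0$); let $f'[g]=\frac{d}{d\varepsilon}f(\bar u+\varepsilon g)|_{\varepsilon=0}$ and $(f,g)=\frac{h^2}{2}\sum_n\int f(\bar u)g(\bar u)\,d\bar x$, where $\sum_n\int\,d\bar x$ is understood in the sense of the formal calculus of variations: a functional is the class of its density (a linear combination of products $fg$, $f,g\in\bar{\mathcal F}$) modulo the total differences $\Delta\rho$ and total derivatives $\partial_{\bar x}\rho$ of such densities $\rho$. A function $f\in\bar{\mathcal F}$ is a gradient of a functional $H$, written $f=\mathrm{grad}\,H=\frac{\delta H}{\delta\bar u}$, if $H'[g]=(f,g)$ for all $g\in\bar{\mathcal F}$. A linear operator $\theta$ on $\bar{\mathcal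 F}$ is implectic if it is skew-symmetric and $(f,\theta'[\theta g]k)+(k,\theta'[\theta f]g)+(g,\theta'[\theta k]f)=0$ for all $f,g,k$. Pseudo-difference operators multiply by $\Delta^s f=\sum_{i\ge0}\binom si(\Delta^iE^{s-i}f)\Delta^{s-i}$, $s\in\mathbb Z$. Let $\bar A_1=h^{-1}\Delta+\bar u$ and let $\bar L=h^{-1}\Delta+\bar u+h\bar u_1\Delta^{-1}+h^2\bar u_2\Delta^{-2}+\cdots$, $\bar u_j\in\bar{\mathcal F}$, be the solution of $\bar L_{\bar x}=[\bar A_1,\bar L]$. Put $\bar A_s=(\bar L^s)_+$ (non-negative powers of $\Delta$), $\bar K_s=\bar A_{s,\bar x}-[\bar A_1,\bar A_s]$ and $\bar\gamma_s=\partial_{\bar x}^{-1}\bar K_s\in\bar{\mathcal F}$. For $s\ge1$ let $\bar B_s=\sum_{j=0}^{s}h^{-(s-j)}\bar b_j\Delta^{s-j}$ (each $\bar b_j$ being its value at $\bar u=0$ plus an element of $\bar{\mathcal F}$) and $\bar\sigma_s\in\bar{\mathcal F}$ be determined by $\bar L'[\bar\sigma_s]=[\bar B_s,\bar L]+h\bar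 L^s+\bar L^{s-1}$, $\bar\sigma_s=\bar B_{s,\bar x}-[\bar A_1,\bar B_s]$ and $\bar B_s|_{\bar u=0}=h^{-(s-1)}\bar x\Delta^s+h^{-(s-1)}(\bar x+hn)\Delta^{s-1}$. Theorem. $\bar L$, $\bar\gamma_1,\bar\gamma_2,\bar\gamma_3$, $\bar B_s$, $\bar\sigma_s$ and $\bar\omega_s=\partial_{\bar x}^{-1}\bar\sigma_s\in\bar{\mathcal F}$ ($s\ge1$) exist and are unique. Each equation $\bar u_{\bar t_s}=\bar\sigma_s$, $s\ge1$, of the non-isospectral D$\Delta$KP hierarchy is Hamiltonian: $\partial_{\bar x}$ is implectic, and $$\bar u_{\bar t_s}=\bar\sigma_s=\partial_{\bar x}\frac{\delta\bar J_s}{\delta\bar u},\qquad \frac{\delta\bar J_s}{\delta\bar u}=\bar\omega_s=\partial_{\bar x}^{-1}\bar\sigma_s .$$ Here $$\bar\omega_1=h\bar x\bar u,\qquad \bar\omega_2=h\bar x\bar\gamma_2+(\bar x+hn)\bar\gamma_1+h\Delta^{-1}\bar u,$$ $$\bar\omega_3=h\bar x\bar\gamma_3+(\bar x+hn)\bar\gamma_2+2h\Delta^{-2}\bar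 u_{\bar x}+h\Delta^{-1}\bar u^2+h\bar u\Delta^{-1}\bar u-2\Delta^{-1}\bar u,$$ $$\bar\omega_s=\frac1h\Bigl(\frac1{s-3}\,\mathrm{grad}(\bar\omega_{s-1},\bar\sigma_2)-\bar\omega_{s-1}\Bigr),\quad s\ge4,$$ where, for $s\ge 4$, the functional $(\bar\omega_{s-1},\bar\sigma_2)$ has a gradient for which this equality holds. The Hamiltonians are given by $\bar J_1=\frac h2(\bar x\bar u,\bar u)$, $\bar J_3=\int_0^1(\bar\omega_3(\lambda\bar u),\bar u)\,d\lambda$ and $$\bar J_s=\frac1h\Bigl(\frac1{s-3}(\bar\omega_{s-1},\bar\sigma_2)-\bar J_{s-1}\Bigr),\quad s>1,\ s\ne3 .$$ -/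

import Mathlib

noncomputable section

namespace DDKP

open scoped ContDiff

/-! ### The phase space

A function `v(n, x)` of the lattice variable `n` and of the continuous variable `x` is a function
`ℤ → ℝ → ℝ`. -/

/-- `v` is smooth in `x` and decreases rapidly, with all its `x`-derivatives, as `|x| → ∞` and as
`n → -∞`. Every rapidly decreasing function on `ℤ × ℝ` is of this kind. -/
def RapidlyDecreasing (v : ℤ → ℝ → ℝ) : Prop :=
  (∀ n, ContDiff ℝ ∞ (v n)) ∧
    ∀ (N : ℤ) (a k l : ℕ), ∃ C : ℝ, ∀ n ≤ N, ∀ x : ℝ,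
      |(n : ℝ)| ^ a * |x| ^ k * |iteratedDeriv l (v n) x| ≤ C

namespace RapidlyDecreasing

variable {v w : ℤ → ℝ → ℝ}

theorem contDiffAt (hv : RapidlyDecreasing v) (n : ℤ) (l : ℕ) (x : ℝ) :
    ContDiffAt ℝ l (v n) x :=
  ((hv.1 n).of_le (by exact_mod_cast le_top)).contDiffAt

theorem zero : RapidlyDecreasing 0 := by
  refine ⟨fun n => contDiff_const, fun N a k l => ⟨0, fun n _ x => ?_⟩⟩
  have : iteratedDeriv l (fun _ : ℝ => (0 : ℝ)) x = 0 := by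
    simp
  have h2 : iteratedDeriv l ((0 : ℤ → ℝ → ℝ) n) x = 0 := this
  rw [h2]; simp

theorem add (hv : RapidlyDecreasing v) (hw : RapidlyDecreasing w) : RapidlyDecreasing (v + w) := by
  refine ⟨fun n => (hv.1 n).add (hw.1 n), fun N a k l => ?_⟩
  obtain ⟨C, hC⟩ := hv.2 N a k l
  obtain ⟨D, hD⟩ := hw.2 N a k l
  refine ⟨C + D, fun n hn x => ?_⟩
  have h1 := hC n hn x
  have h2 := hD n hn x
  rw [Pi.add_apply, iteratedDeriv_add (hv.contDiffAt n l x) (hw.contDiffAt n l x)]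
  calc _ ≤ |(n : ℝ)| ^ a * |x| ^ k * (|iteratedDeriv l (v n) x| + |iteratedDeriv l (w n) x|) := by
        gcongr; exact abs_add_le _ _
    _ ≤ _ := by rw [mul_add]; exact add_le_add h1 h2

theorem smul (c : ℝ) (hv : RapidlyDecreasing v) : RapidlyDecreasing (c • v) := by
  refine ⟨fun n => (hv.1 n).const_smul c, fun N a k l => ?_⟩
  obtain ⟨C, hC⟩ := hv.2 N a k l
  refine ⟨|c| * C, fun n hn x => ?_⟩
  rw [Pi.smul_apply, iteratedDeriv_const_smul_field c (v n), smul_eq_mul, abs_mul]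
  calc _ = |c| * (|(n : ℝ)| ^ a * |x| ^ k * |iteratedDeriv l (v n) x|) := by ring
    _ ≤ _ := by gcongr; exact hC n hn x

/-- Multiplication by a function all of whose derivatives are bounded by a power of `|n|` and `|x|`
(stated for a finite sum of such bounds). -/
theorem mul_of_bound {p : ℤ → ℝ → ℝ} (hp : ∀ n, ContDiff ℝ ∞ (p n))
    (hb : ∀ (N : ℤ) (l : ℕ), ∃ (B : ℝ) (a k : ℕ), 0 ≤ B ∧ ∀ n ≤ N, ∀ x : ℝ,
      |iteratedDeriv l (p n) x| ≤ B * ((1 + |(n : ℝ)| ^ a) * (1 + |x| ^ k)))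
    (hv : RapidlyDecreasing v) : RapidlyDecreasing (p * v) := by
  refine ⟨fun n => (hp n).mul (hv.1 n), fun N a k l => ?_⟩
  have key : ∀ i, ∃ C : ℝ, ∀ n ≤ N, ∀ x : ℝ,
      |(n : ℝ)| ^ a * |x| ^ k * |iteratedDeriv i (p n) x * iteratedDeriv (l - i) (v n) x| ≤ C := by
    intro i
    obtain ⟨B, a', k', hB, hB'⟩ := hb N i
    obtain ⟨C1, h1⟩ := hv.2 N a k (l - i)
    obtain ⟨C2, h2⟩ := hv.2 N (a + a') k (l - i)
    obtain ⟨C3, h3⟩ := hv.2 N a (k + k') (l - i)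
    obtain ⟨C4, h4⟩ := hv.2 N (a + a') (k + k') (l - i)
    refine ⟨B * (C1 + C2 + C3 + C4), fun n hn x => ?_⟩
    have := hB' n hn x
    rw [abs_mul]
    calc _ ≤ |(n : ℝ)| ^ a * |x| ^ k * ((B * ((1 + |(n : ℝ)| ^ a') * (1 + |x| ^ k'))) *
          |iteratedDeriv (l - i) (v n) x|) := by gcongr
      _ = B * (|(n : ℝ)| ^ a * |x| ^ k * |iteratedDeriv (l - i) (v n) x|
          + |(n : ℝ)| ^ (a + a') * |x| ^ k * |iteratedDeriv (l - i) (v n) x|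
          + |(n : ℝ)| ^ a * |x| ^ (k + k') * |iteratedDeriv (l - i) (v n) x|
          + |(n : ℝ)| ^ (a + a') * |x| ^ (k + k') * |iteratedDeriv (l - i) (v n) x|) := by
        simp only [pow_add]; ring
      _ ≤ _ := by
        gcongr
        · exact h1 n hn x
        · exact h2 n hn x
        · exact h3 n hn x
        · exact h4 n hn x
  choose C hC using key
  refine ⟨∑ i ∈ Finset.range (l + 1), (l.choose i : ℝ) * C i, fun n hn x => ?_⟩
  have hpn : ContDiffAt ℝ l (p n) x := ((hp n).of_le (by exact_mod_cast le_top)).contDiffAt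
  rw [Pi.mul_apply, iteratedDeriv_mul hpn (hv.contDiffAt n l x)]
  calc _ ≤ |(n : ℝ)| ^ a * |x| ^ k * ∑ i ∈ Finset.range (l + 1),
        |(l.choose i : ℝ) * iteratedDeriv i (p n) x * iteratedDeriv (l - i) (v n) x| := by
        gcongr; exact Finset.abs_sum_le_sum_abs _ _
    _ = ∑ i ∈ Finset.range (l + 1), (l.choose i : ℝ) * (|(n : ℝ)| ^ a * |x| ^ k *
        |iteratedDeriv i (p n) x * iteratedDeriv (l - i) (v n) x|) := by
        rw [Finset.mul_sum]
        refine Finset.sum_congr rfl fun i _ => ?_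
        rw [mul_assoc (l.choose i : ℝ), abs_mul (l.choose i : ℝ), Nat.abs_cast]; ring
    _ ≤ _ := by
        gcongr with i hi
        exact hC i n hn x

theorem mul (hv : RapidlyDecreasing v) (hw : RapidlyDecreasing w) : RapidlyDecreasing (v * w) := by
  refine mul_of_bound hv.1 (fun N l => ?_) hw
  obtain ⟨C, hC⟩ := hv.2 N 0 0 l
  refine ⟨|C|, 0, 0, abs_nonneg _, fun n hn x => ?_⟩
  have := hC n hn x
  simp only [pow_zero, one_mul] at this ⊢
  nlinarith [le_abs_self C, abs_nonneg C]

theorem mulX (hv : RapidlyDecreasing v) : RapidlyDecreasing (fun n x => x * v n x) := by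
  refine mul_of_bound (p := fun _ x => x) (fun _ => contDiff_id) (fun N l => ?_) hv
  refine ⟨1, 0, 1, zero_le_one, fun n hn x => ?_⟩
  have hx := abs_nonneg x
  rcases l with _ | _ | l
  · simp only [iteratedDeriv_zero, pow_zero, pow_one]; linarith
  · simp only [zero_add, iteratedDeriv_one, deriv_id'', abs_one, pow_zero, pow_one]; linarith
  · have : iteratedDeriv (l + 1 + 1) (fun x : ℝ => x) x = 0 := by
      rw [iteratedDeriv_succ', iteratedDeriv_succ']
      simp
    rw [this]
    simp only [abs_zero, pow_zero, pow_one]; linarith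

theorem mulN (hv : RapidlyDecreasing v) : RapidlyDecreasing (fun n x => (n : ℝ) * v n x) := by
  refine mul_of_bound (p := fun n _ => (n : ℝ)) (fun _ => contDiff_const) (fun N l => ?_) hv
  refine ⟨1, 1, 0, zero_le_one, fun n hn x => ?_⟩
  have hx := abs_nonneg (n : ℝ)
  rcases l with _ | l
  · simp only [iteratedDeriv_zero, pow_zero, pow_one]; linarith
  · rw [iteratedDeriv_succ']
    simp; linarith

theorem shift (j : ℤ) (hv : RapidlyDecreasing v) : RapidlyDecreasing (fun n => v (n + j)) := by
  refine ⟨fun n => hv.1 _, fun N a k l => ?_⟩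
  obtain ⟨C, hC⟩ := hv.2 (N + j) a k l
  obtain ⟨D, hD⟩ := hv.2 (N + j) 0 k l
  refine ⟨2 ^ a * (C + |(j : ℝ)| ^ a * D), fun n hn x => ?_⟩
  have h1 := hC (n + j) (by omega) x
  have h2 := hD (n + j) (by omega) x
  have hle : |(n : ℝ)| ^ a ≤ 2 ^ a * (|((n + j : ℤ) : ℝ)| ^ a + |(j : ℝ)| ^ a) := by
    have e : |(n : ℝ)| ≤ |((n + j : ℤ) : ℝ)| + |(j : ℝ)| := by
      have := abs_sub ((n + j : ℤ) : ℝ) (j : ℝ)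
      push_cast at this ⊢
      simpa using this
    calc |(n : ℝ)| ^ a ≤ (2 * max |((n + j : ℤ) : ℝ)| |(j : ℝ)|) ^ a := by
          gcongr
          linarith [le_max_left |((n + j : ℤ) : ℝ)| |(j : ℝ)|,
            le_max_right |((n + j : ℤ) : ℝ)| |(j : ℝ)|]
      _ = 2 ^ a * (max |((n + j : ℤ) : ℝ)| |(j : ℝ)|) ^ a := mul_pow _ _ _
      _ ≤ _ := by
          gcongr
          rcases le_total |((n + j : ℤ) : ℝ)| |(j : ℝ)| with h | h
          · rw [max_eq_right h]; linarith [pow_nonneg (abs_nonneg ((n + j : ℤ) : ℝ)) a]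
          · rw [max_eq_left h]; linarith [pow_nonneg (abs_nonneg (j : ℝ)) a]
  calc _ ≤ 2 ^ a * (|((n + j : ℤ) : ℝ)| ^ a + |(j : ℝ)| ^ a) * |x| ^ k *
        |iteratedDeriv l (v (n + j)) x| := by gcongr
    _ = 2 ^ a * (|((n + j : ℤ) : ℝ)| ^ a * |x| ^ k * |iteratedDeriv l (v (n + j)) x|
        + |(j : ℝ)| ^ a * (|((n + j : ℤ) : ℝ)| ^ 0 * |x| ^ k * |iteratedDeriv l (v (n + j)) x|)) := by
        ring
    _ ≤ _ := by gcongr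

theorem deriv (hv : RapidlyDecreasing v) : RapidlyDecreasing (fun n => _root_.deriv (v n)) := by
  refine ⟨fun n => ?_, fun N a k l => ?_⟩
  · exact (contDiff_infty_iff_deriv.1 (hv.1 n)).2
  · obtain ⟨C, hC⟩ := hv.2 N a k (l + 1)
    refine ⟨C, fun n hn x => ?_⟩
    have := hC n hn x
    rwa [iteratedDeriv_succ'] at this

theorem summable_inv : Summable fun m : ℤ => 1 / (1 + (m : ℝ) ^ 2) := by
  have h : Summable fun m : ℤ => 1 / (m : ℝ) ^ 2 := Real.summable_one_div_int_pow.2 one_lt_two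
  have h0 : Summable fun m : ℤ => if m = 0 then (1 : ℝ) else 0 :=
    summable_of_hasFiniteSupport ((Set.finite_singleton (0 : ℤ)).subset (by
      intro m hm; by_contra hne; simp at hne; simp [hne] at hm))
  refine Summable.of_nonneg_of_le (fun m => by positivity) (fun m => ?_) (h0.add h)
  by_cases hm : m = 0
  · simp [hm]
  · have : (0 : ℝ) < (m : ℝ) ^ 2 := by positivity
    simp only [hm, if_false, zero_add]
    gcongr
    linarith

/-- The points `n - 1, n - 2, …` to the left of `n`. -/
theorem left_injective (n : ℤ) : Function.Injective fun j : ℕ => n - 1 - (j : ℤ) := by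
  intro i j hij
  simpa using hij

theorem exists_bound (hv : RapidlyDecreasing v) (N : ℤ) (a k l : ℕ) :
    ∃ C : ℝ, 0 ≤ C ∧ ∀ n ≤ N, ∀ x : ℝ,
      |(n : ℝ)| ^ a * |x| ^ k * |iteratedDeriv l (v n) x| ≤ C * (1 / (1 + (n : ℝ) ^ 2)) := by
  obtain ⟨C, hC⟩ := hv.2 N a k l
  obtain ⟨D, hD⟩ := hv.2 N (a + 2) k l
  refine ⟨|C| + |D|, by positivity, fun n hn x => ?_⟩
  have h1 := (hC n hn x).trans (le_abs_self C)
  have h2 := (hD n hn x).trans (le_abs_self D)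
  rw [mul_one_div, le_div_iff₀ (by positivity)]
  calc _ = |(n : ℝ)| ^ a * |x| ^ k * |iteratedDeriv l (v n) x|
        + |(n : ℝ)| ^ (a + 2) * |x| ^ k * |iteratedDeriv l (v n) x| := by
        rw [pow_add, sq_abs]; ring
    _ ≤ _ := add_le_add h1 h2

theorem summable_left (n : ℤ) : Summable fun j : ℕ => 1 / (1 + ((n - 1 - (j : ℤ) : ℤ) : ℝ) ^ 2) :=
  summable_inv.comp_injective (left_injective n)

theorem contDiff_sum (hv : RapidlyDecreasing v) (n : ℤ) :
    ContDiff ℝ ∞ (fun x => ∑' j : ℕ, v (n - 1 - (j : ℤ)) x) ∧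
    ∀ (l : ℕ) (x : ℝ), iteratedDeriv l (fun x => ∑' j : ℕ, v (n - 1 - (j : ℤ)) x) x =
      ∑' j : ℕ, iteratedDeriv l (v (n - 1 - (j : ℤ))) x := by
  have hb := fun l : ℕ => hv.exists_bound n 0 0 l
  choose C hC0 hC using hb
  have hs : ∀ l : ℕ, ((l : ℕ∞) ≤ (⊤ : ℕ∞)) →
      Summable fun j : ℕ => C l * (1 / (1 + ((n - 1 - (j : ℤ) : ℤ) : ℝ) ^ 2)) :=
    fun l _ => (summable_left n).mul_left _
  have hbound : ∀ (l : ℕ) (j : ℕ) (x : ℝ), ((l : ℕ∞) ≤ (⊤ : ℕ∞)) →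
      ‖iteratedFDeriv ℝ l (v (n - 1 - (j : ℤ))) x‖ ≤
        C l * (1 / (1 + ((n - 1 - (j : ℤ) : ℤ) : ℝ) ^ 2)) := by
    intro l j x _
    have := hC l (n - 1 - (j : ℤ)) (by omega) x
    simp only [pow_zero, one_mul] at this
    rwa [norm_iteratedFDeriv_eq_norm_iteratedDeriv, Real.norm_eq_abs]
  refine ⟨contDiff_tsum (N := ⊤) (fun j => hv.1 _) hs hbound, fun l x => ?_⟩
  rw [iteratedDeriv_eq_iteratedFDeriv,
    iteratedFDeriv_tsum_apply (N := ⊤) (fun j => hv.1 _) hs hbound (k := l) le_top x]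
  have hsum : Summable fun j : ℕ => iteratedFDeriv ℝ l (v (n - 1 - (j : ℤ))) x :=
    Summable.of_norm_bounded (hs l le_top) fun j => hbound l j x le_top
  have := (ContinuousMultilinearMap.apply ℝ (fun _ : Fin l => ℝ) ℝ (fun _ => (1 : ℝ))).map_tsum hsum
  simpa [iteratedDeriv_eq_iteratedFDeriv] using this

theorem summable (hv : RapidlyDecreasing v) (n : ℤ) (l : ℕ) (x : ℝ) :
    Summable fun j : ℕ => iteratedDeriv l (v (n - 1 - (j : ℤ))) x := by
  obtain ⟨C, _, hC⟩ := hv.exists_bound n 0 0 l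
  refine Summable.of_norm_bounded ((summable_left n).mul_left C) fun j => ?_
  have := hC (n - 1 - (j : ℤ)) (by omega) x
  simpa using this

theorem sum (hv : RapidlyDecreasing v) :
    RapidlyDecreasing (fun n x => ∑' j : ℕ, v (n - 1 - (j : ℤ)) x) := by
  refine ⟨fun n => (hv.contDiff_sum n).1, fun N a k l => ?_⟩
  obtain ⟨C, hC0, hC⟩ := hv.exists_bound N a k l
  obtain ⟨D, hD0, hD⟩ := hv.exists_bound N 0 k l
  set S : ℝ := ∑' m : ℤ, 1 / (1 + (m : ℝ) ^ 2) with hS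
  refine ⟨(C + |(N : ℝ)| ^ a * D) * S, fun n hn x => ?_⟩
  rw [(hv.contDiff_sum n).2 l x]
  have hterm : ∀ j : ℕ, |(n : ℝ)| ^ a * |x| ^ k * |iteratedDeriv l (v (n - 1 - (j : ℤ))) x| ≤
      (C + |(N : ℝ)| ^ a * D) * (1 / (1 + ((n - 1 - (j : ℤ) : ℤ) : ℝ) ^ 2)) := by
    intro j
    set m : ℤ := n - 1 - (j : ℤ) with hm
    have h1 := hC m (by omega) x
    have h2 := hD m (by omega) x
    have hle : |(n : ℝ)| ^ a ≤ |(m : ℝ)| ^ a + |(N : ℝ)| ^ a := by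
      rcases le_total n 0 with h0 | h0
      · have : |(n : ℝ)| ≤ |(m : ℝ)| := by
          have : |n| ≤ |m| := by rw [abs_of_nonpos h0, abs_of_nonpos (by omega)]; omega
          exact_mod_cast this
        have := pow_le_pow_left₀ (abs_nonneg _) this a
        have := pow_nonneg (abs_nonneg (N : ℝ)) a
        linarith
      · have : |(n : ℝ)| ≤ |(N : ℝ)| := by
          have : |n| ≤ |N| := by rw [abs_of_nonneg h0, abs_of_nonneg (by omega)]; omega
          exact_mod_cast this
        have := pow_le_pow_left₀ (abs_nonneg _) this a
        have := pow_nonneg (abs_nonneg (m : ℝ)) a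
        linarith
    calc _ ≤ (|(m : ℝ)| ^ a + |(N : ℝ)| ^ a) * |x| ^ k * |iteratedDeriv l (v m) x| := by gcongr
      _ = |(m : ℝ)| ^ a * |x| ^ k * |iteratedDeriv l (v m) x| +
          |(N : ℝ)| ^ a * (|(m : ℝ)| ^ 0 * |x| ^ k * |iteratedDeriv l (v m) x|) := by ring
      _ ≤ C * (1 / (1 + (m : ℝ) ^ 2)) + |(N : ℝ)| ^ a * (D * (1 / (1 + (m : ℝ) ^ 2))) := by gcongr
      _ = _ := by ring
  have habs := (hv.summable n l x).abs
  calc _ ≤ |(n : ℝ)| ^ a * |x| ^ k * ∑' j : ℕ, |iteratedDeriv l (v (n - 1 - (j : ℤ))) x| := by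
        gcongr
        simpa [Real.norm_eq_abs] using norm_tsum_le_tsum_norm
          (f := fun j : ℕ => iteratedDeriv l (v (n - 1 - (j : ℤ))) x) (by simpa using habs)
    _ = ∑' j : ℕ, |(n : ℝ)| ^ a * |x| ^ k * |iteratedDeriv l (v (n - 1 - (j : ℤ))) x| := by
        rw [tsum_mul_left]
    _ ≤ ∑' j : ℕ, (C + |(N : ℝ)| ^ a * D) * (1 / (1 + ((n - 1 - (j : ℤ) : ℤ) : ℝ) ^ 2)) :=
        (habs.mul_left _).tsum_le_tsum hterm ((summable_left n).mul_left _)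
    _ = (C + |(N : ℝ)| ^ a * D) * ∑' j : ℕ, 1 / (1 + ((n - 1 - (j : ℤ) : ℤ) : ℝ) ^ 2) :=
        tsum_mul_left
    _ ≤ _ := by
        gcongr
        exact tsum_comp_le_tsum_of_inj summable_inv (fun m => by positivity) (left_injective n)

end RapidlyDecreasing

/-- The algebra of functions `u(n, x)` that decrease rapidly. -/
def phaseAlgebra : NonUnitalSubalgebra ℝ (ℤ → ℝ → ℝ) where
  carrier := {v | RapidlyDecreasing v}
  add_mem' := RapidlyDecreasing.add
  zero_mem' := RapidlyDecreasing.zero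
  mul_mem' := RapidlyDecreasing.mul
  smul_mem' := fun c _ h => h.smul c

/-- The phase space, in which the field `u` varies. -/
abbrev Phase : Type := phaseAlgebra

namespace Phase

instance : NonUnitalCommRing Phase := NonUnitalSubalgebra.toNonUnitalCommRing phaseAlgebra

instance : Module ℝ Phase := inferInstanceAs (Module ℝ phaseAlgebra)

instance : IsScalarTower ℝ Phase Phase :=
  ⟨fun a v w => Subtype.ext (smul_mul_assoc a v.1 w.1)⟩

instance : SMulCommClass ℝ Phase Phase :=
  ⟨fun a v w => Subtype.ext (mul_smul_comm a v.1 w.1).symm⟩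

/-- The shift `E ^ j`, that is `(E ^ j v)(n, x) = v(n + j, x)`. -/
def shift (j : ℤ) : Phase →ₗ[ℝ] Phase where
  toFun v := ⟨fun n => v.1 (n + j), RapidlyDecreasing.shift j v.2⟩
  map_add' _ _ := rfl
  map_smul' _ _ := rfl

/-- The difference operator `Δ = E - 1`. -/
def diff : Phase →ₗ[ℝ] Phase := shift 1 - LinearMap.id

/-- The partial derivative `∂ₓ`. -/
def dx : Phase →ₗ[ℝ] Phase where
  toFun v := ⟨fun n => deriv (v.1 n), RapidlyDecreasing.deriv v.2⟩
  map_add' v w := by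
    ext n x
    exact deriv_add ((v.2.1 n).differentiable (by simp) x) ((w.2.1 n).differentiable (by simp) x)
  map_smul' c v := by
    ext n x
    exact deriv_const_smul_field c (v.1 n)

/-- Multiplication by the independent variable `x`. -/
def mulX : Phase →ₗ[ℝ] Phase where
  toFun v := ⟨fun n x => x * v.1 n x, RapidlyDecreasing.mulX v.2⟩
  map_add' v w := by
    ext n x
    exact mul_add x (v.1 n x) (w.1 n x)
  map_smul' c v := by
    ext n x
    exact mul_left_comm x c (v.1 n x)

/-- Multiplication by the independent variable `n`. -/
def mulN : Phase →ₗ[ℝ] Phase where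
  toFun v := ⟨fun n x => (n : ℝ) * v.1 n x, RapidlyDecreasing.mulN v.2⟩
  map_add' v w := by
    ext n x
    exact mul_add (n : ℝ) (v.1 n x) (w.1 n x)
  map_smul' c v := by
    ext n x
    exact mul_left_comm (n : ℝ) c (v.1 n x)

/-- The inverse `Δ⁻¹` of the difference operator: `(Δ⁻¹ v)(n, x) = ∑_{m < n} v(m, x)`. -/
def invDiff : Phase →ₗ[ℝ] Phase where
  toFun v := ⟨fun n x => ∑' j : ℕ, v.1 (n - 1 - (j : ℤ)) x, RapidlyDecreasing.sum v.2⟩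
  map_add' v w := by
    ext n x
    have hv := RapidlyDecreasing.summable v.2 n 0 x
    have hw := RapidlyDecreasing.summable w.2 n 0 x
    simp only [iteratedDeriv_zero] at hv hw
    exact hv.tsum_add hw
  map_smul' c v := by
    ext n x
    exact tsum_mul_left

theorem diff_invDiff (v : Phase) : diff (invDiff v) = v := by
  ext n x
  have hv := RapidlyDecreasing.summable v.2 (n + 1) 0 x
  simp only [iteratedDeriv_zero] at hv
  change (∑' j : ℕ, v.1 (n + 1 - 1 - (j : ℤ)) x) - ∑' j : ℕ, v.1 (n - 1 - (j : ℤ)) x = v.1 n x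
  rw [hv.tsum_eq_zero_add]
  have : ∀ j : ℕ, n + 1 - 1 - ((j + 1 : ℕ) : ℤ) = n - 1 - (j : ℤ) := fun j => by push_cast; ring
  simp only [this]
  simp

theorem invDiff_diff (v : Phase) : invDiff (diff v) = v := by
  have h : diff (invDiff (diff v) - v) = 0 := by
    rw [map_sub, diff_invDiff, sub_self]
  set w : Phase := invDiff (diff v) - v with hw
  have hstep : ∀ n x, w.1 (n + 1) x = w.1 n x := fun n x => by
    have := congrArg (fun z : Phase => z.1 n x) h
    exact sub_eq_zero.1 this
  have hconst : ∀ (x : ℝ) (n : ℤ) (j : ℕ), w.1 (n - j) x = w.1 n x := by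
    intro x n j
    induction j with
    | zero => simp
    | succ j ih =>
      rw [← ih, ← hstep (n - ((j + 1 : ℕ) : ℤ)) x]
      have : n - ((j + 1 : ℕ) : ℤ) + 1 = n - (j : ℤ) := by push_cast; ring
      rw [this]
  have hzero : w = 0 := by
    ext n x
    change w.1 n x = 0
    have hs := RapidlyDecreasing.summable w.2 (n + 1) 0 x
    have ht := hs.tendsto_atTop_zero
    simp only [iteratedDeriv_zero, add_sub_cancel_right, hconst] at ht
    exact tendsto_nhds_unique tendsto_const_nhds ht
  exact sub_eq_zero.1 hzero

end Phase

/-! ### Functions `f(u)` of the field -/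

/-- `f = f(u)` is built from the field `u` by the algebra operations, multiplication by `x` and `n`,
shifts, `Δ⁻¹` and `∂ₓ`. -/
inductive IsFieldFunction : (Phase → Phase) → Prop
  | field : IsFieldFunction fun u => u
  | zero : IsFieldFunction 0
  | add {f g : Phase → Phase} : IsFieldFunction f → IsFieldFunction g → IsFieldFunction (f + g)
  | smul {f : Phase → Phase} (c : ℝ) : IsFieldFunction f → IsFieldFunction (c • f)
  | mul {f g : Phase → Phase} : IsFieldFunction f → IsFieldFunction g → IsFieldFunction (f * g)
  | mulX {f : Phase → Phase} : IsFieldFunction f → IsFieldFunction fun u => Phase.mulX (f u)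
  | mulN {f : Phase → Phase} : IsFieldFunction f → IsFieldFunction fun u => Phase.mulN (f u)
  | shift {f : Phase → Phase} (j : ℤ) :
      IsFieldFunction f → IsFieldFunction fun u => Phase.shift j (f u)
  | invDiff {f : Phase → Phase} :
      IsFieldFunction f → IsFieldFunction fun u => Phase.invDiff (f u)
  | dx {f : Phase → Phase} : IsFieldFunction f → IsFieldFunction fun u => Phase.dx (f u)

/-- The algebra `𝓕` of functions `f(u)` of the field (they all vanish at `u = 0`). -/
def fieldAlgebra : NonUnitalSubalgebra ℝ (Phase → Phase) where
  carrier := {f | IsFieldFunction f}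
  add_mem' := IsFieldFunction.add
  zero_mem' := IsFieldFunction.zero
  mul_mem' := IsFieldFunction.mul
  smul_mem' := fun c _ h => h.smul c

/-- The type of the functions `f(u)` of the field. -/
abbrev FieldFun : Type := fieldAlgebra

namespace FieldFun

instance : NonUnitalCommRing FieldFun := NonUnitalSubalgebra.toNonUnitalCommRing fieldAlgebra

instance : Module ℝ FieldFun := inferInstanceAs (Module ℝ fieldAlgebra)

/-- The value `f(u)(n, x)`. -/
def eval (f : FieldFun) (u : Phase) (n : ℤ) (x : ℝ) : ℝ := (f.1 u).1 n x

/-- The field `u` itself. -/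
def field : FieldFun := ⟨fun u => u, .field⟩

/-- `E ^ j` on `𝓕`. -/
def shift (j : ℤ) : FieldFun →ₗ[ℝ] FieldFun where
  toFun f := ⟨fun u => Phase.shift j (f.1 u), .shift j f.2⟩
  map_add' f g := Subtype.ext (funext fun u => map_add (Phase.shift j) (f.1 u) (g.1 u))
  map_smul' c f := Subtype.ext (funext fun u => map_smul (Phase.shift j) c (f.1 u))

/-- `Δ = E - 1` on `𝓕`. -/
def diff : FieldFun →ₗ[ℝ] FieldFun := shift 1 - LinearMap.id

/-- `Δ⁻¹` on `𝓕`. -/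
def invDiff : FieldFun →ₗ[ℝ] FieldFun where
  toFun f := ⟨fun u => Phase.invDiff (f.1 u), .invDiff f.2⟩
  map_add' f g := Subtype.ext (funext fun u => map_add Phase.invDiff (f.1 u) (g.1 u))
  map_smul' c f := Subtype.ext (funext fun u => map_smul Phase.invDiff c (f.1 u))

/-- `∂ₓ` on `𝓕`. -/
def dx : FieldFun →ₗ[ℝ] FieldFun where
  toFun f := ⟨fun u => Phase.dx (f.1 u), .dx f.2⟩
  map_add' f g := Subtype.ext (funext fun u => map_add Phase.dx (f.1 u) (g.1 u))
  map_smul' c f := Subtype.ext (funext fun u => map_smul Phase.dx c (f.1 u))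

/-- Multiplication by `x` on `𝓕`. -/
def mulX : FieldFun →ₗ[ℝ] FieldFun where
  toFun f := ⟨fun u => Phase.mulX (f.1 u), .mulX f.2⟩
  map_add' f g := Subtype.ext (funext fun u => map_add Phase.mulX (f.1 u) (g.1 u))
  map_smul' c f := Subtype.ext (funext fun u => map_smul Phase.mulX c (f.1 u))

/-- Multiplication by `n` on `𝓕`. -/
def mulN : FieldFun →ₗ[ℝ] FieldFun where
  toFun f := ⟨fun u => Phase.mulN (f.1 u), .mulN f.2⟩
  map_add' f g := Subtype.ext (funext fun u => map_add Phase.mulN (f.1 u) (g.1 u))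
  map_smul' c f := Subtype.ext (funext fun u => map_smul Phase.mulN c (f.1 u))

/-- Along the line `u + ε g(u)`, a function of the field is a polynomial in `ε` with coefficients
in `𝓕`. -/
theorem exists_expansion (f : Phase → Phase) (hf : IsFieldFunction f) (g : FieldFun) :
    ∃ (ι : Type) (_ : Fintype ι) (e : ι → ℕ) (c : ι → FieldFun),
      ∀ (u : Phase) (ε : ℝ), f (u + ε • g.1 u) = ∑ i, ε ^ e i • (c i).1 u := by
  have lin : ∀ (T : Phase →ₗ[ℝ] Phase) (S : FieldFun → FieldFun)
      (_ : ∀ (a : FieldFun) (u : Phase), (S a).1 u = T (a.1 u)) {k : Phase → Phase},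
      (∃ (ι : Type) (_ : Fintype ι) (e : ι → ℕ) (c : ι → FieldFun),
        ∀ (u : Phase) (ε : ℝ), k (u + ε • g.1 u) = ∑ i, ε ^ e i • (c i).1 u) →
      ∃ (ι : Type) (_ : Fintype ι) (e : ι → ℕ) (c : ι → FieldFun),
        ∀ (u : Phase) (ε : ℝ), T (k (u + ε • g.1 u)) = ∑ i, ε ^ e i • (c i).1 u := by
    rintro T S hS k ⟨ι, hι, e, c, h⟩
    refine ⟨ι, hι, e, fun i => S (c i), fun u ε => ?_⟩
    rw [h, map_sum]
    simp only [map_smul, hS]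
  induction hf with
  | field =>
    refine ⟨Bool, inferInstance, fun b => if b then 1 else 0, fun b => if b then g else field,
      fun u ε => ?_⟩
    rw [Fintype.sum_bool]
    simp [field, add_comm]
  | zero => exact ⟨Empty, inferInstance, fun _ => 0, fun _ => 0, fun u ε => by simp⟩
  | add _ _ ih1 ih2 =>
    obtain ⟨ι, hι, e, c, h⟩ := ih1
    obtain ⟨κ, hκ, e', c', h'⟩ := ih2
    refine ⟨ι ⊕ κ, inferInstance, Sum.elim e e', Sum.elim c c', fun u ε => ?_⟩
    rw [Pi.add_apply, h, h', Fintype.sum_sum_type]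
    simp
  | smul a _ ih =>
    exact lin (a • LinearMap.id) (fun b => a • b) (fun _ _ => rfl) ih
  | mul _ _ ih1 ih2 =>
    obtain ⟨ι, hι, e, c, h⟩ := ih1
    obtain ⟨κ, hκ, e', c', h'⟩ := ih2
    refine ⟨ι × κ, inferInstance, fun p => e p.1 + e' p.2, fun p => c p.1 * c' p.2,
      fun u ε => ?_⟩
    rw [Pi.mul_apply, h, h', Finset.sum_mul_sum, Fintype.sum_prod_type]
    refine Finset.sum_congr rfl fun i _ => Finset.sum_congr rfl fun j _ => ?_
    rw [smul_mul_smul_comm, pow_add]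
    rfl
  | mulX _ ih => exact lin Phase.mulX mulX (fun _ _ => rfl) ih
  | mulN _ ih => exact lin Phase.mulN mulN (fun _ _ => rfl) ih
  | shift j _ ih => exact lin (Phase.shift j) (shift j) (fun _ _ => rfl) ih
  | invDiff _ ih => exact lin Phase.invDiff invDiff (fun _ _ => rfl) ih
  | dx _ ih => exact lin Phase.dx dx (fun _ _ => rfl) ih

theorem exists_gateaux (f g : FieldFun) :
    ∃ d : FieldFun, ∀ (u : Phase) (n : ℤ) (x : ℝ),
      HasDerivAt (fun ε : ℝ => eval f (u + ε • g.1 u) n x) (eval d u n x) 0 := by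
  obtain ⟨ι, hι, e, c, h⟩ := exists_expansion f.1 f.2 g
  have ev : ∀ (u : Phase) (n : ℤ) (x : ℝ) (s : ι → Phase),
      (∑ i, s i).1 n x = ∑ i, (s i).1 n x := by
    intro u n x s
    let T : Phase →+ ℝ := { toFun := fun v => v.1 n x, map_zero' := rfl, map_add' := fun _ _ => rfl }
    exact map_sum T s Finset.univ
  refine ⟨∑ i, (if e i = 1 then (1 : ℝ) else 0) • c i, fun u n x => ?_⟩
  have h1 : ∀ ε : ℝ, eval f (u + ε • g.1 u) n x = ∑ i, ε ^ e i * eval (c i) u n x := fun ε => by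
    unfold eval
    rw [h, ev u]
    rfl
  have h2 : eval (∑ i, (if e i = 1 then (1 : ℝ) else 0) • c i : FieldFun) u n x =
      ∑ i, (if e i = 1 then (1 : ℝ) else 0) * eval (c i) u n x := by
    let T : FieldFun →+ ℝ :=
      { toFun := fun v => eval v u n x, map_zero' := rfl, map_add' := fun _ _ => rfl }
    exact map_sum T _ Finset.univ
  simp only [h1]
  rw [h2]
  refine HasDerivAt.fun_sum fun i _ => ?_
  have h3 : (if e i = 1 then (1 : ℝ) else 0) = (e i : ℝ) * 0 ^ (e i - 1) := by
    generalize e i = k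
    rcases k with _ | _ | k <;> simp
  rw [h3]
  exact (hasDerivAt_pow (e i) (0 : ℝ)).mul_const (eval (c i) u n x)

/-- The Gateaux derivative `f'[g] = d/dε f(u + ε g(u))` at `ε = 0`. -/
def gateaux (f g : FieldFun) : FieldFun := (exists_gateaux f g).choose

theorem gateaux_spec (f g : FieldFun) (u : Phase) (n : ℤ) (x : ℝ) :
    HasDerivAt (fun ε : ℝ => eval f (u + ε • g.1 u) n x) (eval (gateaux f g) u n x) 0 :=
  (exists_gateaux f g).choose_spec u n x

end FieldFun

open FieldFun (eval gateaux)

/-! ### Functionals, inner product, gradient, implectic operators -/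

/-- The space `𝓕²` of densities, spanned by the products of two elements of `𝓕`. -/
def Density : Submodule ℝ FieldFun :=
  Submodule.span ℝ {ρ | ∃ f g : FieldFun, ρ = f * g}

/-- The densities with vanishing integral: the total differences and total `x`-derivatives of
densities. (`Δ f` and `∂ₓ f` for a general `f` in `𝓕` are not included: `Δ` maps `𝓕` onto `𝓕`.) -/
def NullDensity : Submodule ℝ FieldFun :=
  Density.map FieldFun.diff ⊔ Density.map FieldFun.dx

/-- Functionals of `u`, as densities up to total differences and total derivatives. -/
abbrev Functional : Type := FieldFun ⧸ NullDensity

/-- The functional `∑ₙ ∫ ρ(u) dx` with density `ρ`: the universal linear functional of the density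
that is invariant under shifts in `n` and allows integration by parts in `x`. -/
def integral : FieldFun →ₗ[ℝ] Functional := NullDensity.mkQ

/-- The inner product `(f, g) = (h² / 2) ∑ₙ ∫ f(u) g(u) dx`. -/
def inner (h : ℝ) (f g : FieldFun) : Functional := (h ^ 2 / 2) • integral (f * g)

/-- `f = grad H = δH/δu`: one has `H'[g] = (f, g)` for all `g` in `𝓕`, where
`H'[g] = ∑ₙ ∫ ρ'[g] dx` for `H = ∑ₙ ∫ ρ dx`. -/
def IsGradient (h : ℝ) (H : Functional) (f : FieldFun) : Prop :=
  ∃ ρ ∈ Density, H = integral ρ ∧ ∀ g : FieldFun, integral (gateaux ρ g) = inner h f g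

/-- The derivative `θ'[k] g = (θ g)'[k] - θ (g'[k])` of an operator `θ` on `𝓕`. -/
def operatorDeriv (θ : FieldFun →ₗ[ℝ] FieldFun) (k g : FieldFun) : FieldFun :=
  gateaux (θ g) k - θ (gateaux g k)

/-- `θ` is implectic: skew-symmetric, with the Jacobi identity. -/
def IsImplectic (h : ℝ) (θ : FieldFun →ₗ[ℝ] FieldFun) : Prop :=
  (∀ f g : FieldFun, inner h (θ f) g = -inner h f (θ g)) ∧
    ∀ f g k : FieldFun,
      inner h f (operatorDeriv θ (θ g) k) + inner h k (operatorDeriv θ (θ f) g) +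
        inner h g (operatorDeriv θ (θ k) f) = 0

/-- The evolution equation `u_t = σ(u)` is Hamiltonian with operator `θ` and Hamiltonian `H`:
`σ = θ (δH/δu)` with `θ` implectic, and `f` is the gradient `δH/δu`. -/
def IsHamiltonian (h : ℝ) (θ : FieldFun →ₗ[ℝ] FieldFun) (σ f : FieldFun) (H : Functional) : Prop :=
  IsImplectic h θ ∧ IsGradient h H f ∧ σ = θ f

/-! ### Pseudo-difference operators -/

/-- Coefficients: arbitrary functions of `u`, `n` and `x`. -/
abbrev Coeff : Type := Phase → ℤ → ℝ → ℝ

namespace Coeff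

/-- `E ^ j` on coefficients. -/
def shift (j : ℤ) (c : Coeff) : Coeff := fun u n x => c u (n + j) x

/-- `Δ = E - 1` on coefficients. -/
def diff (c : Coeff) : Coeff := shift 1 c - c

/-- `∂ₓ` on coefficients. -/
def dx (c : Coeff) : Coeff := fun u n => deriv (c u n)

/-- The Gateaux derivative of a coefficient in the direction `g`. -/
def gateaux (c : Coeff) (g : FieldFun) : Coeff :=
  fun u n x => deriv (fun ε : ℝ => c (u + ε • g.1 u) n x) 0

end Coeff

/-- The formal operator `∑_k P k Δ ^ k`, given by its coefficients. -/
abbrev PseudoDiff : Type := ℤ → Coeff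

namespace PseudoDiff

/-- The operator of multiplication by a coefficient. -/
def ofCoeff (c : Coeff) : PseudoDiff := Pi.single 0 c

/-- The product, by the Leibniz rule `Δ ^ s b = ∑_i C(s, i) (Δ ^ i E ^ (s - i) b) Δ ^ (s - i)`, so
that the coefficient of `Δ ^ k` in `P Q` is the sum of all
`C(s, i) P_s (Δ ^ i E ^ (s - i) Q_t)` with `s + t - i = k`. For operators of bounded order only
finitely many of these terms are non-zero. -/
def mul (P Q : PseudoDiff) : PseudoDiff := fun k =>
  ∑ᶠ p : ℤ × ℕ, (Ring.choose p.1 p.2 : ℤ) •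
    (P p.1 * Coeff.diff^[p.2] (Coeff.shift (p.1 - p.2) (Q (k - p.1 + p.2))))

/-- The powers `P ^ m`. -/
def pow (P : PseudoDiff) : ℕ → PseudoDiff
  | 0 => ofCoeff 1
  | m + 1 => mul (pow P m) P

/-- The commutator `[P, Q] = P Q - Q P`. -/
def comm (P Q : PseudoDiff) : PseudoDiff := mul P Q - mul Q P

/-- The derivative `P_x`, taken in the coefficients. -/
def dx (P : PseudoDiff) : PseudoDiff := fun k => Coeff.dx (P k)

/-- The Gateaux derivative `P'[g]`, taken in the coefficients. This is the time derivative of `P`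
when `u` evolves by `u_t = g(u)`. -/
def gateaux (P : PseudoDiff) (g : FieldFun) : PseudoDiff := fun k => Coeff.gateaux (P k) g

/-- The difference-operator part `P₊`, with the non-negative powers of `Δ`. -/
def posPart (P : PseudoDiff) : PseudoDiff := fun k => if 0 ≤ k then P k else 0

end PseudoDiff

/-! ### The Lax triads and the two hierarchies -/

/-- `A₁ = h⁻¹ Δ + u`. -/
def opA₁ (h : ℝ) : PseudoDiff :=
  Pi.single 1 (fun _ _ _ => h⁻¹) + PseudoDiff.ofCoeff (eval FieldFun.field)

/-- `L = h⁻¹ Δ + u + h u₁ Δ⁻¹ + h² u₂ Δ⁻² + ⋯`, where `u₁, u₂, …` in `𝓕` are expressed through `u`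
by `L_x = [A₁, L]`. -/
def IsLaxOperator (h : ℝ) (L : PseudoDiff) : Prop :=
  (∀ k, 1 < k → L k = 0) ∧ L 1 = (fun _ _ _ => h⁻¹) ∧ L 0 = (eval FieldFun.field) ∧
    (∀ j : ℕ, 1 ≤ j → ∃ w : FieldFun, L (-(j : ℤ)) = h ^ j • eval w) ∧
    PseudoDiff.dx L = PseudoDiff.comm (opA₁ h) L

/-- `A_m = (L ^ m)₊`. -/
def opA (L : PseudoDiff) (m : ℕ) : PseudoDiff := PseudoDiff.posPart (PseudoDiff.pow L m)

/-- `K = K_m` is the isospectral flow `K_m = A_{m, x} - [A₁, A_m]`. -/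
def IsIsospectralFlow (h : ℝ) (L : PseudoDiff) (m : ℕ) (K : FieldFun) : Prop :=
  PseudoDiff.ofCoeff (eval K) = PseudoDiff.dx (opA L m) - PseudoDiff.comm (opA₁ h) (opA L m)

/-- The asymptotic form `h^{-(m-1)} x Δ^m + h^{-(m-1)} (x + h n) Δ^{m-1}` of `B_m` at `u = 0`. -/
def asymptoticB (h : ℝ) (m : ℕ) : PseudoDiff :=
  Pi.single (m : ℤ) (fun _ _ x => h ^ (1 - (m : ℤ)) * x) +
    Pi.single ((m : ℤ) - 1) (fun _ (n : ℤ) x => h ^ (1 - (m : ℤ)) * (x + h * n))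

/-- `B = B_m` is a difference operator of order at most `m`, `σ = σ_m` is in `𝓕`, and they satisfy
the compatibility conditions of the non-isospectral Lax triad
`L φ = η φ`, `φ_x = A₁ φ`, `φ_t = B φ`, `η_t = h η^m + η^{m-1}`, that is
`L_t = [B, L] + h L^m + L^{m-1}` and `σ = B_x - [A₁, B]` for the evolution `u_t = σ(u)`,
with the prescribed value of `B` at `u = 0`. -/
def IsNonisospectralFlow (h : ℝ) (L : PseudoDiff) (m : ℕ) (B : PseudoDiff) (σ : FieldFun) : Prop :=
  (∀ k : ℤ, k < 0 ∨ (m : ℤ) < k → B k = 0) ∧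
    (∀ k : ℤ, ∃ w : FieldFun, B k = asymptoticB h m k + eval w) ∧
    PseudoDiff.gateaux L σ =
      PseudoDiff.comm B L + h • PseudoDiff.pow L m + PseudoDiff.pow L (m - 1) ∧
    PseudoDiff.ofCoeff (eval σ) = PseudoDiff.dx B - PseudoDiff.comm (opA₁ h) B

end DDKP

end

/-! In powers of `E` instead of `Δ`, the operators form a ring of twisted Laurent series `∑ c_k E^k`
with `E c = (shift c) E`, whose product is a twisted convolution. The two bases are related by `E^s
= (Δ + 1)^s` and `Δ^s = (E - 1)^s`; `toPseudoDiff` is injective and carries the convolution to the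
Leibniz product of the statement (`toShift_mulDiff`, `Op.toPseudoDiff_mul`), so all the work is done
in a genuine ring.

Everything about the Lax triads rests on one uniqueness principle. The map `zeroCurv P = P_x - [A₁,
P]` is a derivation, and its coefficient at `E^(k+1)` contains the coefficients of `P` only through
`P_(k+1)` and `h⁻¹ Δ P_k`. Since `Δ` is injective on functions of the field, an operator that
vanishes at `u = 0` and has zero curvature is zero, by descending induction on `k`
(`Op.coeff_eq_zero_of_zeroCurv`). Hence an operator is determined by its value at `u = 0` and its
curvature equation. This gives uniqueness of `L`, of `A_s` and of `B_s`, and turns identities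
between operators into computations at `u = 0`, where `L` becomes `D = h⁻¹ Δ` and `B_s` becomes `M
D^(s-1)` with `M = x E + h n` and `[D, M] = h D + 1`.

For two flows with operators `b, b'` the bracket `b'[σ'] - b''[σ] + [b, b']`, in which the first two
terms are the derivatives of `b` and `b'` along the opposite flows, again has curvature in degree
zero only, and at `u = 0` its value comes from `[M D^j, M D] = (j - 1)(h M D^(j+1) + M D^j)`. Thus
bracketing with `B₂` produces the next flow whenever `j ≠ 1` (`Op.IsFlowOp.succ`). For `j = 1` the
factor vanishes, which is why `ω₃` must be given explicitly; `B₁, B₂, B₃` are written down and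
checked. The degree-zero coefficient of a commutator of difference operators is zero, so on
gradients the bracket is `ω'[σ₂] - ω₂'[σ]`.

On the variational side, a gradient has a symmetric derivative because second derivatives commute
(`IsGradient.sym`), and for symmetric `f, g` the functional `(f, g_x)` has gradient `f'[g_x] -
g'[f_x]` (`Sym.isGradient_inner`). With `g = ω₂` this is exactly the bracket above, so the recursion
for flows is also the recursion for Hamiltonians. The base cases are `ω₁` and `ω₃`, whose
homogeneous parts are symmetric and therefore gradients by Euler's formula; `ω₂` follows from the
bracket of the first two flows. -/

noncomputable section

-- Shortcuts for instance search; local, since the statement is elaborated without them.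
local instance : AddCommGroup DDKP.FieldFun := inferInstance
local instance : AddCommMonoid DDKP.FieldFun := inferInstance
local instance : AddGroup DDKP.FieldFun := inferInstance
local instance : AddMonoid DDKP.FieldFun := inferInstance
local instance : AddZeroClass DDKP.FieldFun := inferInstance
local instance : Add DDKP.FieldFun := inferInstance
local instance : Sub DDKP.FieldFun := inferInstance
local instance : Mul DDKP.FieldFun := inferInstance
local instance : SMul ℝ DDKP.FieldFun := inferInstance

namespace DDKP

/-! ### Twisted Laurent series -/

section SkewLaurent

open Finset

variable {R : Type*} [CommRing R]

/-- The sequences of coefficients that vanish for large indices. -/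
def BoundedAbove (R : Type*) [CommRing R] : AddSubgroup (ℤ → R) where
  carrier := {P | ∃ N : ℤ, ∀ k, N < k → P k = 0}
  add_mem' := by
    rintro P Q ⟨p, hp⟩ ⟨q, hq⟩
    exact ⟨max p q, fun k hk => by
      simp [hp k (lt_of_le_of_lt (le_max_left _ _) hk), hq k (lt_of_le_of_lt (le_max_right _ _) hk)]⟩
  zero_mem' := ⟨0, fun _ _ => rfl⟩
  neg_mem' := by
    rintro P ⟨p, hp⟩
    exact ⟨p, fun k hk => by simp [hp k hk]⟩

/-- The formal series `∑_k P k E ^ k` with `P k = 0` for large `k`, where `E c = τ c E`. -/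
def SkewLaurent (_ : RingAut R) : Type _ := BoundedAbove R

namespace SkewLaurent

variable {τ : RingAut R}

instance : AddCommGroup (SkewLaurent τ) := inferInstanceAs (AddCommGroup (BoundedAbove R))

/-- The coefficient of `E ^ k`. -/
def coeff (P : SkewLaurent τ) (k : ℤ) : R := P.1 k

theorem exists_bound (P : SkewLaurent τ) : ∃ N : ℤ, ∀ k, N < k → P.coeff k = 0 := P.2

/-- The series with given coefficients. -/
def mk (P : ℤ → R) (N : ℤ) (h : ∀ k, N < k → P k = 0) : SkewLaurent τ := ⟨P, N, h⟩

@[simp] theorem coeff_mk (P : ℤ → R) (N : ℤ) (h) (k : ℤ) :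
    (mk P N h : SkewLaurent τ).coeff k = P k := rfl

@[ext] theorem ext {P Q : SkewLaurent τ} (h : ∀ k, P.coeff k = Q.coeff k) : P = Q :=
  Subtype.ext (funext h)

@[simp] theorem coeff_zero (k : ℤ) : (0 : SkewLaurent τ).coeff k = 0 := rfl
@[simp] theorem coeff_add (P Q : SkewLaurent τ) (k : ℤ) :
    (P + Q).coeff k = P.coeff k + Q.coeff k := rfl
@[simp] theorem coeff_sub (P Q : SkewLaurent τ) (k : ℤ) :
    (P - Q).coeff k = P.coeff k - Q.coeff k := rfl

/-- The monomial `c E ^ k`. -/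
def single (k : ℤ) (c : R) : SkewLaurent τ :=
  mk (Pi.single k c) k fun j hj => by simp [hj.ne']

theorem coeff_single (k j : ℤ) (c : R) :
    (single k c : SkewLaurent τ).coeff j = if j = k then c else 0 := by
  simp [single, Pi.single_apply]

theorem single_add (k : ℤ) (c d : R) :
    (single k (c + d) : SkewLaurent τ) = single k c + single k d := by
  ext j
  simp only [coeff_single, coeff_add]
  split_ifs <;> simp

/-- The coefficients of a product. -/
def mulCoeff (P Q : SkewLaurent τ) (k : ℤ) : R := ∑ᶠ i : ℤ, P.coeff i * (τ ^ i) (Q.coeff (k - i))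

theorem mulCoeff_eq_sum (P Q : SkewLaurent τ) (k : ℤ) (s : Finset ℤ)
    (h : ∀ i ∉ s, P.coeff i = 0 ∨ Q.coeff (k - i) = 0) :
    mulCoeff P Q k = ∑ i ∈ s, P.coeff i * (τ ^ i) (Q.coeff (k - i)) := by
  refine finsum_eq_sum_of_support_subset _ fun i hi => ?_
  by_contra hs
  rcases h i hs with h | h <;> simp [h] at hi

theorem mulCoeff_eq_sum_Icc {P Q : SkewLaurent τ} {p q : ℤ} (hp : ∀ k, p < k → P.coeff k = 0)
    (hq : ∀ k, q < k → Q.coeff k = 0) (k : ℤ) {a b : ℤ} (ha : a ≤ k - q) (hb : p ≤ b) :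
    mulCoeff P Q k = ∑ i ∈ Icc a b, P.coeff i * (τ ^ i) (Q.coeff (k - i)) := by
  refine mulCoeff_eq_sum P Q k _ fun i hi => ?_
  simp only [mem_Icc, not_and_or, not_le] at hi
  rcases hi with hi | hi
  · exact Or.inr (hq _ (by omega))
  · exact Or.inl (hp _ (by omega))

instance : Mul (SkewLaurent τ) where
  mul P Q := ⟨mulCoeff P Q, by
    obtain ⟨p, hp⟩ := P.exists_bound
    obtain ⟨q, hq⟩ := Q.exists_bound
    refine ⟨p + q, fun k hk => ?_⟩
    rw [mulCoeff_eq_sum P Q k ∅ fun i _ => ?_, sum_empty]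
    by_cases hi : p < i
    · exact Or.inl (hp i hi)
    · exact Or.inr (hq _ (by omega))⟩

theorem coeff_mul (P Q : SkewLaurent τ) (k : ℤ) : (P * Q).coeff k = mulCoeff P Q k := rfl

theorem coeff_single_mul (i k : ℤ) (c : R) (P : SkewLaurent τ) :
    (single i c * P).coeff k = c * (τ ^ i) (P.coeff (k - i)) := by
  rw [coeff_mul, mulCoeff_eq_sum _ _ _ {i} fun j hj => ?_]
  · simp [coeff_single]
  · left; simp only [mem_singleton] at hj; simp [coeff_single, hj]

theorem coeff_mul_single (i k : ℤ) (c : R) (P : SkewLaurent τ) :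
    (P * single i c).coeff k = P.coeff (k - i) * (τ ^ (k - i)) c := by
  rw [coeff_mul, mulCoeff_eq_sum _ _ _ {k - i} fun j hj => ?_]
  · simp [coeff_single]
  · right; simp only [mem_singleton] at hj
    rw [coeff_single, if_neg (by omega)]

instance : One (SkewLaurent τ) := ⟨single 0 1⟩

theorem one_def : (1 : SkewLaurent τ) = single 0 1 := rfl

theorem mul_assoc' (P Q S : SkewLaurent τ) : P * Q * S = P * (Q * S) := by
  obtain ⟨p, hp⟩ := P.exists_bound
  obtain ⟨q, hq⟩ := Q.exists_bound
  obtain ⟨r, hr⟩ := S.exists_bound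
  ext k
  have hPQ : ∀ j, p + q < j → (P * Q).coeff j = 0 := fun j hj => by
    rw [coeff_mul, mulCoeff_eq_sum P Q j ∅ fun i _ => ?_, sum_empty]
    by_cases hi : p < i
    · exact Or.inl (hp i hi)
    · exact Or.inr (hq _ (by omega))
  have hQS : ∀ j, q + r < j → (Q * S).coeff j = 0 := fun j hj => by
    rw [coeff_mul, mulCoeff_eq_sum Q S j ∅ fun i _ => ?_, sum_empty]
    by_cases hi : q < i
    · exact Or.inl (hq i hi)
    · exact Or.inr (hr _ (by omega))
  rw [coeff_mul, mulCoeff_eq_sum_Icc hPQ hr k le_rfl le_rfl,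
    coeff_mul, mulCoeff_eq_sum_Icc hp hQS k (a := k - r - q) (by omega) le_rfl]
  -- Both products are the sum of `P_i τ^i(Q_(m-i)) τ^m(S_(k-m))` over one rectangle of pairs `(i,
  -- m)`, chosen large enough that outside it some factor vanishes.
  have h1 : ∀ m ∈ Icc (k - r) (p + q), (P * Q).coeff m * (τ ^ m) (S.coeff (k - m)) =
      ∑ i ∈ Icc (k - r - q) p,
        P.coeff i * (τ ^ i) (Q.coeff (m - i)) * (τ ^ m) (S.coeff (k - m)) := fun m hm => by
    rw [mem_Icc] at hm
    rw [coeff_mul, mulCoeff_eq_sum_Icc hp hq m (a := k - r - q) (by omega) le_rfl, sum_mul]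
  have h2 : ∀ i ∈ Icc (k - r - q) p, P.coeff i * (τ ^ i) ((Q * S).coeff (k - i)) =
      ∑ m ∈ Icc (k - r) (p + q),
        P.coeff i * (τ ^ i) (Q.coeff (m - i)) * (τ ^ m) (S.coeff (k - m)) := fun i hi => by
    rw [mem_Icc] at hi
    rw [coeff_mul, mulCoeff_eq_sum _ _ _ ((Icc (k - r) (p + q)).image fun m => m - i) fun j hj => ?_,
      sum_image fun a _ b _ hab => by simpa using hab, map_sum, mul_sum]
    · refine sum_congr rfl fun m _ => ?_
      rw [map_mul, ← RingAut.mul_apply, ← zpow_add, add_sub_cancel, sub_sub_sub_cancel_right,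
        mul_assoc]
    · by_contra hne
      push Not at hne
      refine hj (mem_image.2 ⟨j + i, mem_Icc.2 ⟨?_, ?_⟩, by ring⟩)
      · by_contra hlt
        exact hne.2 (hr _ (by omega))
      · by_contra hlt
        exact hne.1 (hq _ (by omega))
  rw [sum_congr rfl h1, sum_congr rfl h2, sum_comm]

instance : Ring (SkewLaurent τ) :=
  { (inferInstance : AddCommGroup (SkewLaurent τ)) with
    mul := (· * ·)
    one := 1
    mul_assoc := mul_assoc'
    one_mul := fun P => by ext k; rw [one_def, coeff_single_mul]; simp
    mul_one := fun P => by ext k; rw [one_def, coeff_mul_single]; simp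
    zero_mul := fun P => by
      ext k
      rw [coeff_mul, mulCoeff_eq_sum _ _ _ ∅ fun i _ => Or.inl rfl]; simp
    mul_zero := fun P => by
      ext k
      rw [coeff_mul, mulCoeff_eq_sum _ _ _ ∅ fun i _ => Or.inr rfl]; simp
    left_distrib := fun P Q S => by
      obtain ⟨p, hp⟩ := P.exists_bound
      obtain ⟨q, hq⟩ := Q.exists_bound
      obtain ⟨r, hr⟩ := S.exists_bound
      ext k
      have h : ∀ i ∉ Icc (k - max q r) p,
          P.coeff i = 0 ∨ (Q.coeff (k - i) = 0 ∧ S.coeff (k - i) = 0) := fun i hi => by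
        by_cases hpi : p < i
        · exact Or.inl (hp i hpi)
        · simp only [mem_Icc, not_and_or, not_le] at hi
          exact Or.inr ⟨hq _ (by omega), hr _ (by omega)⟩
      rw [coeff_add, coeff_mul, coeff_mul, coeff_mul, mulCoeff_eq_sum P Q k (Icc (k - max q r) p)
        fun i hi => (h i hi).imp id And.left, mulCoeff_eq_sum P S k (Icc (k - max q r) p)
        fun i hi => (h i hi).imp id And.right, mulCoeff_eq_sum P (Q + S) k (Icc (k - max q r) p)
        fun i hi => (h i hi).imp id fun h => by rw [coeff_add, h.1, h.2, add_zero],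
        ← sum_add_distrib]
      exact sum_congr rfl fun i _ => by rw [coeff_add, map_add, mul_add]
    right_distrib := fun P Q S => by
      obtain ⟨p, hp⟩ := P.exists_bound
      obtain ⟨q, hq⟩ := Q.exists_bound
      obtain ⟨r, hr⟩ := S.exists_bound
      ext k
      have h : ∀ i ∉ Icc (k - r) (max p q),
          (P.coeff i = 0 ∧ Q.coeff i = 0) ∨ S.coeff (k - i) = 0 := fun i hi => by
        simp only [mem_Icc, not_and_or, not_le] at hi
        rcases hi with hi | hi
        · exact Or.inr (hr _ (by omega))
        · exact Or.inl ⟨hp _ (by omega), hq _ (by omega)⟩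
      rw [coeff_add, coeff_mul, coeff_mul, coeff_mul, mulCoeff_eq_sum P S k (Icc (k - r) (max p q))
        fun i hi => (h i hi).imp And.left id, mulCoeff_eq_sum Q S k (Icc (k - r) (max p q))
        fun i hi => (h i hi).imp And.right id, mulCoeff_eq_sum (P + Q) S k (Icc (k - r) (max p q))
        fun i hi => (h i hi).imp (fun h => by rw [coeff_add, h.1, h.2, add_zero]) id,
        ← sum_add_distrib]
      exact sum_congr rfl fun i _ => by rw [coeff_add, add_mul] }

theorem coeff_one (k : ℤ) : (1 : SkewLaurent τ).coeff k = if k = 0 then 1 else 0 := by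
  rw [one_def, coeff_single]

theorem single_mul_single (i j : ℤ) (c d : R) :
    (single i c * single j d : SkewLaurent τ) = single (i + j) (c * (τ ^ i) d) := by
  ext k
  rw [coeff_single_mul, coeff_single, coeff_single]
  by_cases h : k = i + j
  · simp [h]
  · rw [if_neg h, if_neg (by omega)]; simp

/-- A derivation of the coefficients that commutes with `τ`, applied coefficientwise. -/
def mapCoeff (d : R →+ R) : SkewLaurent τ →+ SkewLaurent τ where
  toFun P := ⟨fun k => d (P.coeff k), by
    obtain ⟨p, hp⟩ := P.exists_bound
    exact ⟨p, fun k hk => by simp only [hp k hk, map_zero]⟩⟩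
  map_zero' := by ext k; exact map_zero d
  map_add' P Q := by ext k; exact map_add d _ _

@[simp] theorem coeff_mapCoeff (d : R →+ R) (P : SkewLaurent τ) (k : ℤ) :
    (mapCoeff d P).coeff k = d (P.coeff k) := rfl

theorem mapCoeff_mul (d : R →+ R) (hd : ∀ a b, d (a * b) = d a * b + a * d b)
    (hτ : ∀ (i : ℤ) (a : R), d ((τ ^ i) a) = (τ ^ i) (d a)) (P Q : SkewLaurent τ) :
    mapCoeff d (P * Q) = mapCoeff d P * Q + P * mapCoeff d Q := by
  obtain ⟨p, hp⟩ := P.exists_bound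
  obtain ⟨q, hq⟩ := Q.exists_bound
  ext k
  rw [coeff_mapCoeff, coeff_add, coeff_mul, coeff_mul, coeff_mul,
    mulCoeff_eq_sum_Icc hp hq k le_rfl le_rfl,
    mulCoeff_eq_sum_Icc (P := mapCoeff d P) (fun k hk => by rw [coeff_mapCoeff, hp k hk, map_zero])
      hq k le_rfl le_rfl,
    mulCoeff_eq_sum_Icc (Q := mapCoeff d Q) hp
      (fun k hk => by rw [coeff_mapCoeff, hq k hk, map_zero]) k le_rfl le_rfl,
    ← sum_add_distrib, map_sum]
  exact sum_congr rfl fun i _ => by rw [hd, hτ, coeff_mapCoeff, coeff_mapCoeff]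

theorem mul_mem_of_right {I : Ideal R} (hI : ∀ (i : ℤ), ∀ a ∈ I, (τ ^ i) a ∈ I)
    (P : SkewLaurent τ) {Q : SkewLaurent τ} (hQ : ∀ k, Q.coeff k ∈ I) (k : ℤ) :
    (P * Q).coeff k ∈ I := by
  obtain ⟨p, hp⟩ := P.exists_bound
  obtain ⟨q, hq⟩ := Q.exists_bound
  rw [coeff_mul, mulCoeff_eq_sum_Icc hp hq k le_rfl le_rfl]
  exact sum_mem fun i _ => I.mul_mem_left _ (hI _ _ (hQ _))

theorem mul_mem_of_left {I : Ideal R} {P : SkewLaurent τ} (hP : ∀ k, P.coeff k ∈ I)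
    (Q : SkewLaurent τ) (k : ℤ) : (P * Q).coeff k ∈ I := by
  obtain ⟨p, hp⟩ := P.exists_bound
  obtain ⟨q, hq⟩ := Q.exists_bound
  rw [coeff_mul, mulCoeff_eq_sum_Icc hp hq k le_rfl le_rfl]
  exact sum_mem fun i _ => I.mul_mem_right _ (hP _)

end SkewLaurent
end SkewLaurent
end DDKP

namespace DDKP

/-! ### The change of basis from powers of `E` to powers of `Δ` -/

section BasisChange

open Finset

/-- The binomial coefficient with an integer lower argument. -/
def binom (s d : ℤ) : ℤ := if 0 ≤ d then Ring.choose s d.toNat else 0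

theorem binom_natCast (s : ℤ) (d : ℕ) : binom s d = Ring.choose s d := by simp [binom]

theorem binom_of_neg (s : ℤ) {d : ℤ} (h : d < 0) : binom s d = 0 := if_neg (not_le.2 h)

theorem choose_mul_choose_sub (s : ℤ) {d e : ℕ} (h : e ≤ d) :
    Ring.choose s e * Ring.choose (s - e) (d - e) = d.choose e * Ring.choose s d := by
  rw [← Ring.choose_smul_choose s h, nsmul_eq_mul]

/-- Only the points within distance `d` below `c` contribute; counting by the distance `e` makes the
binomial indices natural numbers. -/
theorem sum_Icc_eq_sum_range {M : Type*} [AddCommMonoid M] (f : ℤ → M) {a b : ℤ} (c : ℤ) (d : ℕ)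
    (ha : a ≤ c - d) (hb : c ≤ b) (h : ∀ j, j < c - d ∨ c < j → f j = 0) :
    ∑ j ∈ Icc a b, f j = ∑ e ∈ range (d + 1), f (c - e) := by
  have hinj : Set.InjOn (fun e : ℕ => c - (e : ℤ)) (range (d + 1)) := fun x _ y _ hxy => by
    simpa using hxy
  rw [← sum_image (f := f) hinj]
  refine (sum_subset (fun j hj => ?_) fun j _ hj => ?_).symm
  · obtain ⟨e, he, rfl⟩ := mem_image.1 hj
    rw [mem_range] at he
    exact mem_Icc.2 ⟨by omega, by omega⟩
  · by_contra hne
    refine hj (mem_image.2 ⟨(c - j).toNat, mem_range.2 ?_, ?_⟩) <;>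
    · have := mt (h j) hne
      omega

/-- Since `C(s,e) C(s-e,d-e) = C(d,e) C(s,d)`, the sum is `C(s,d) (1 - 1)^d`. This and its mirror
image below say that the two changes of basis are mutually inverse. -/
theorem sum_binom_mul_binom (s : ℤ) (d : ℕ) :
    ∑ e ∈ range (d + 1), (-1 : ℤ) ^ (d - e) * (Ring.choose s e * Ring.choose (s - e) (d - e)) =
      if d = 0 then 1 else 0 := by
  have h : ∀ e ∈ range (d + 1),
      (-1 : ℤ) ^ (d - e) * (Ring.choose s e * Ring.choose (s - e) (d - e)) =
        (1 ^ e * (-1 : ℤ) ^ (d - e) * d.choose e) * Ring.choose s d := fun e he => by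
    rw [choose_mul_choose_sub s (mem_range_succ_iff.1 he)]; ring
  rw [sum_congr rfl h, ← sum_mul, ← add_pow]
  rcases d with _ | d <;> simp

theorem sum_binom_mul_binom' (s : ℤ) (d : ℕ) :
    ∑ e ∈ range (d + 1), (-1 : ℤ) ^ e * (Ring.choose s e * Ring.choose (s - e) (d - e)) =
      if d = 0 then 1 else 0 := by
  have h : ∀ e ∈ range (d + 1),
      (-1 : ℤ) ^ e * (Ring.choose s e * Ring.choose (s - e) (d - e)) =
        ((-1 : ℤ) ^ e * 1 ^ (d - e) * d.choose e) * Ring.choose s d := fun e he => by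
    rw [choose_mul_choose_sub s (mem_range_succ_iff.1 he)]; ring
  rw [sum_congr rfl h, ← sum_mul, ← add_pow]
  rcases d with _ | d <;> simp

variable {R : Type*} [CommRing R]

/-- The coefficients with respect to the powers of `Δ = E - 1` of `∑_k P k E ^ k`. -/
def toDiff (P : ℤ → R) (k : ℤ) : R := ∑ᶠ s : ℤ, binom s (s - k) • P s

/-- The coefficients with respect to the powers of `E` of `∑_k P k Δ ^ k`. -/
def toShift (P : ℤ → R) (k : ℤ) : R := ∑ᶠ s : ℤ, ((-1) ^ (s - k).natAbs * binom s (s - k)) • P s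

theorem toDiff_eq_sum {P : ℤ → R} {p : ℤ} (hp : ∀ k, p < k → P k = 0) {a b k : ℤ} (ha : a ≤ k)
    (hb : p ≤ b) : toDiff P k = ∑ s ∈ Icc a b, binom s (s - k) • P s := by
  refine finsum_eq_sum_of_support_subset _ fun s hs => ?_
  by_contra hne
  simp only [coe_Icc, Set.mem_Icc, not_and_or, not_le] at hne
  rcases hne with h | h
  · simp [binom_of_neg s (show s - k < 0 by omega)] at hs
  · simp [hp s (by omega)] at hs

theorem toShift_eq_sum {P : ℤ → R} {p : ℤ} (hp : ∀ k, p < k → P k = 0) {a b k : ℤ} (ha : a ≤ k)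
    (hb : p ≤ b) :
    toShift P k = ∑ s ∈ Icc a b, ((-1) ^ (s - k).natAbs * binom s (s - k)) • P s := by
  refine finsum_eq_sum_of_support_subset _ fun s hs => ?_
  by_contra hne
  simp only [coe_Icc, Set.mem_Icc, not_and_or, not_le] at hne
  rcases hne with h | h
  · simp [binom_of_neg s (show s - k < 0 by omega)] at hs
  · simp [hp s (by omega)] at hs

theorem toDiff_eq_zero {P : ℤ → R} {p : ℤ} (hp : ∀ k, p < k → P k = 0) {k : ℤ} (hk : p < k) :
    toDiff P k = 0 := by
  rw [toDiff_eq_sum hp le_rfl le_rfl, Icc_eq_empty (by omega), sum_empty]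

theorem toShift_eq_zero {P : ℤ → R} {p : ℤ} (hp : ∀ k, p < k → P k = 0) {k : ℤ} (hk : p < k) :
    toShift P k = 0 := by
  rw [toShift_eq_sum hp le_rfl le_rfl, Icc_eq_empty (by omega), sum_empty]

theorem toShift_toDiff {P : ℤ → R} {p : ℤ} (hp : ∀ k, p < k → P k = 0) :
    toShift (toDiff P) = P := by
  funext k
  rw [toShift_eq_sum (fun j hj => toDiff_eq_zero hp hj) le_rfl le_rfl]
  have h : ∀ j ∈ Icc k p, ((-1) ^ (j - k).natAbs * binom j (j - k)) • toDiff P j =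
      ∑ s ∈ Icc k p, ((-1) ^ (j - k).natAbs * binom j (j - k) * binom s (s - j)) • P s :=
    fun j hj => by
      rw [toDiff_eq_sum hp (mem_Icc.1 hj).1 le_rfl, smul_sum]
      simp only [smul_smul]
  rw [sum_congr rfl h, sum_comm]
  have h2 : ∀ s ∈ Icc k p,
      ∑ j ∈ Icc k p, ((-1) ^ (j - k).natAbs * binom j (j - k) * binom s (s - j)) • P s =
        if s = k then P s else 0 := fun s hs => by
    rw [mem_Icc] at hs
    obtain ⟨d, hd⟩ := Int.eq_ofNat_of_zero_le (show 0 ≤ s - k by omega)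
    rw [← sum_smul, sum_Icc_eq_sum_range _ s d (by omega) hs.2 fun j hj => ?_]
    · rw [sum_congr rfl fun e he => ?_, sum_binom_mul_binom s d]
      · by_cases h0 : d = 0
        · rw [if_pos h0, if_pos (by omega), one_smul]
        · rw [if_neg h0, if_neg (by omega), zero_smul]
      · rw [mem_range] at he
        rw [show s - e - k = ((d - e : ℕ) : ℤ) by omega, show s - (s - e) = (e : ℤ) by omega,
          binom_natCast, binom_natCast, Int.natAbs_natCast]
        ring
    · rcases hj with hj | hj
      · rw [binom_of_neg j (by omega)]; ring
      · rw [binom_of_neg s (by omega)]; ring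
  rw [sum_congr rfl h2, sum_ite_eq']
  split_ifs with hk
  · rfl
  · rw [mem_Icc] at hk
    exact (hp k (by omega)).symm

theorem toDiff_toShift {P : ℤ → R} {p : ℤ} (hp : ∀ k, p < k → P k = 0) :
    toDiff (toShift P) = P := by
  funext k
  rw [toDiff_eq_sum (fun j hj => toShift_eq_zero hp hj) le_rfl le_rfl]
  have h : ∀ j ∈ Icc k p, binom j (j - k) • toShift P j =
      ∑ s ∈ Icc k p, (binom j (j - k) * ((-1) ^ (s - j).natAbs * binom s (s - j))) • P s :=
    fun j hj => by
      rw [toShift_eq_sum hp (mem_Icc.1 hj).1 le_rfl, smul_sum]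
      simp only [smul_smul]
  rw [sum_congr rfl h, sum_comm]
  have h2 : ∀ s ∈ Icc k p,
      ∑ j ∈ Icc k p, (binom j (j - k) * ((-1) ^ (s - j).natAbs * binom s (s - j))) • P s =
        if s = k then P s else 0 := fun s hs => by
    rw [mem_Icc] at hs
    obtain ⟨d, hd⟩ := Int.eq_ofNat_of_zero_le (show 0 ≤ s - k by omega)
    rw [← sum_smul, sum_Icc_eq_sum_range _ s d (by omega) hs.2 fun j hj => ?_]
    · rw [sum_congr rfl fun e he => ?_, sum_binom_mul_binom' s d]
      · by_cases h0 : d = 0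
        · rw [if_pos h0, if_pos (by omega), one_smul]
        · rw [if_neg h0, if_neg (by omega), zero_smul]
      · rw [mem_range] at he
        rw [show s - e - k = ((d - e : ℕ) : ℤ) by omega, show s - (s - e) = (e : ℤ) by omega,
          binom_natCast, binom_natCast, Int.natAbs_natCast]
        ring
    · rcases hj with hj | hj
      · rw [binom_of_neg j (by omega)]; ring
      · rw [binom_of_neg s (by omega)]; ring
  rw [sum_congr rfl h2, sum_ite_eq']
  split_ifs with hk
  · rfl
  · rw [mem_Icc] at hk
    exact (hp k (by omega)).symm

/-! #### The product -/

variable {τ : RingAut R}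

/-- The difference `τ - 1`. -/
def differ (τ : RingAut R) (c : R) : R := τ c - c

/-- The product with respect to the powers of `Δ`. -/
def mulDiff (τ : RingAut R) (P Q : ℤ → R) (k : ℤ) : R :=
  ∑ᶠ p : ℤ × ℕ, (Ring.choose p.1 p.2 : ℤ) •
    (P p.1 * (differ τ)^[p.2] ((τ ^ (p.1 - p.2)) (Q (k - p.1 + p.2))))

theorem differ_iterate_zero (i : ℕ) : (differ τ)^[i] 0 = 0 := by
  induction i with
  | zero => rfl
  | succ i ih => rw [Function.iterate_succ_apply', ih, differ, map_zero, sub_zero]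

/-- Apply `1 = ((1 - τ) + τ)^e` to `τ^(s-e) b` and expand by the binomial theorem: `1 - τ` is minus
the difference operator and commutes with `τ`. -/
theorem sum_differ (s : ℤ) (e : ℕ) (b : R) :
    ∑ i ∈ range (e + 1), ((-1) ^ i * (e.choose i : ℤ)) • (differ τ)^[i] ((τ ^ (s - i)) b) =
      (τ ^ (s - e)) b := by
  let T : Module.End ℤ R := (τ : R →+* R).toAddMonoidHom.toIntLinearMap
  have hT : ∀ c, T c = τ c := fun _ => rfl
  have hTp : ∀ (i : ℕ) (c : R), (T ^ i) c = (τ ^ i) c := fun i => by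
    induction i with
    | zero => intro c; rfl
    | succ i ih => intro c; rw [pow_succ', pow_succ', Module.End.mul_apply, ih, hT]; rfl
  have hD : ∀ (i : ℕ) (c : R), ((1 - T) ^ i) c = ((-1 : ℤ) ^ i) • (differ τ)^[i] c := fun i => by
    induction i with
    | zero => intro c; simp
    | succ i ih =>
      intro c
      rw [pow_succ, Module.End.mul_apply, ih, Function.iterate_succ_apply, pow_succ, mul_smul]
      congr 1
      have hneg : ∀ x : R, (differ τ)^[i] (-x) = -(differ τ)^[i] x := fun x => by
        clear ih
        induction i generalizing x with
        | zero => rfl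
        | succ i ih =>
          rw [Function.iterate_succ_apply, Function.iterate_succ_apply, ← ih]
          congr 1
          simp only [differ, map_neg]; ring
      rw [neg_smul, one_smul, ← hneg]
      congr 1
      simp only [LinearMap.sub_apply, Module.End.one_apply, hT, differ]; ring
  have key := congrArg (fun f : Module.End ℤ R => f ((τ ^ (s - e)) b))
    (Commute.add_pow (show Commute (1 - T) T from (Commute.one_left T).sub_left rfl) e)
  simp only [sub_add_cancel, one_pow, Module.End.one_apply, LinearMap.sum_apply] at key
  rw [key]
  refine sum_congr rfl fun i hi => ?_
  have hie := mem_range_succ_iff.1 hi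
  rw [Module.End.mul_apply, Module.End.natCast_apply, map_nsmul, Module.End.mul_apply, hTp, hD, ← zpow_natCast,
    ← RingAut.mul_apply, ← zpow_add, show ((e - i : ℕ) : ℤ) + (s - e) = s - i by omega,
    mul_comm, mul_smul, natCast_zsmul]

/-- The pair `(s, i)` is replaced by `(s, t)` with `i = s + t - k`. The summation window depends on
`m ≤ k` only, so that the products for all `k ≥ m` can later be summed over the same window. -/
theorem mulDiff_eq_sum {P Q : ℤ → R} {p q : ℤ} (hp : ∀ k, p < k → P k = 0)
    (hq : ∀ k, q < k → Q k = 0) {m k : ℤ} (hmk : m ≤ k) :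
    mulDiff τ P Q k = ∑ s ∈ Icc (m - q) p, ∑ t ∈ Icc (m - p) q,
      binom s (s + t - k) •
        (P s * (differ τ)^[(s + t - k).toNat] ((τ ^ (s - (s + t - k).toNat)) (Q t))) := by
  let I := (Icc (m - q) p ×ˢ Icc (m - p) q).filter fun x => 0 ≤ x.1 + x.2 - k
  let φ : ℤ × ℤ → ℤ × ℕ := fun x => (x.1, (x.1 + x.2 - k).toNat)
  have hφ : Set.InjOn φ I := by
    rintro ⟨a, b⟩ hx ⟨c, d⟩ hy hxy
    simp only [I, coe_filter, Set.mem_ofPred_eq] at hx hy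
    simp only [φ, Prod.mk.injEq] at hxy ⊢
    omega
  rw [mulDiff, finsum_eq_sum_of_support_subset (s := I.image φ), sum_image hφ, sum_filter,
    sum_product]
  · refine sum_congr rfl fun s _ => sum_congr rfl fun t _ => ?_
    by_cases h : 0 ≤ s + t - k
    · rw [if_pos h, binom, if_pos h]
      simp only [φ]
      rw [show k - s + ((s + t - k).toNat : ℤ) = t by omega]
    · rw [if_neg h, binom, if_neg h, zero_smul]
  · rintro ⟨s, i⟩ hsi
    have h1 : s ≤ p := by
      by_contra h
      simp [hp s (by omega)] at hsi
    have h2 : k - s + i ≤ q := by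
      by_contra h
      simp [hq (k - s + i) (by omega), differ_iterate_zero] at hsi
    refine mem_image.2 ⟨(s, k - s + i), ?_, ?_⟩
    · simp only [I, mem_filter, mem_product, mem_Icc]; omega
    · simp only [φ, Prod.mk.injEq, true_and]; omega

/-- With `d = s + t - m`, the two sides are the coefficient of `E^m` in `Δ^s b Δ^t`: on the left
after the Leibniz rule, on the right after expanding both powers of `Δ` in powers of `E`.
Vandermonde for `C((s-i)+t, d-i)` followed by summation over `i` with `sum_differ` identifies them.
-/
theorem sum_choose_differ (s t : ℤ) (d : ℕ) (b : R) :
    ∑ i ∈ range (d + 1), ((-1) ^ (d - i) * Ring.choose (s + t - i) (d - i) * Ring.choose s i) •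
        (differ τ)^[i] ((τ ^ (s - i)) b) =
      ∑ e ∈ range (d + 1), ((-1) ^ d * (Ring.choose s e * Ring.choose t (d - e))) •
        (τ ^ (s - e)) b := by
  have h1 : ∀ i ∈ range (d + 1),
      ((-1) ^ (d - i) * Ring.choose (s + t - i) (d - i) * Ring.choose s i) •
        (differ τ)^[i] ((τ ^ (s - i)) b) =
      ∑ e ∈ range (d + 1), if i ≤ e then ((-1) ^ d * (Ring.choose s e * Ring.choose t (d - e)) *
        ((-1) ^ i * (e.choose i : ℤ))) • (differ τ)^[i] ((τ ^ (s - i)) b) else 0 := fun i hi => by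
    have hid := mem_range_succ_iff.1 hi
    rw [show s + t - (i : ℤ) = (s - i) + t by ring, Ring.add_choose_eq _ (Commute.all _ _),
      Nat.sum_antidiagonal_eq_sum_range_succ_mk, mul_sum, sum_mul, sum_smul, ← sum_filter]
    refine sum_bij' (fun e _ => e + i) (fun e _ => e - i) (fun e he => ?_) (fun e he => ?_)
      (fun e he => by omega) (fun e he => ?_) fun e he => ?_
    · rw [mem_range] at he
      rw [mem_filter, mem_range]; omega
    · rw [mem_filter, mem_range] at he
      rw [mem_range]; omega
    · rw [mem_filter] at he
      omega
    · congr 1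
      have h2 := choose_mul_choose_sub s (Nat.le_add_left i e)
      rw [Nat.add_sub_cancel] at h2
      have h3 : (-1 : ℤ) ^ (d - i) = (-1) ^ d * (-1) ^ i := by
        rw [← pow_add, show d + i = d - i + 2 * i by omega, pow_add, pow_mul]; simp
      rw [h3, show d - (e + i) = d - i - e by omega]
      linear_combination ((-1) ^ d * (-1) ^ i * Ring.choose t (d - i - e)) * h2
  rw [sum_congr rfl h1, sum_comm]
  refine sum_congr rfl fun e he => ?_
  have hed := mem_range_succ_iff.1 he
  rw [← sum_differ s e b, smul_sum, ← sum_filter]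
  simp only [smul_smul]
  refine sum_congr ?_ fun _ _ => rfl
  ext i
  simp only [mem_filter, mem_range]
  omega

/-- The Leibniz product becomes the twisted convolution in the basis of powers of `E`. Both sides
are biadditive, so it suffices to compare the contribution of each pair `P_s, Q_t`, which is
`sum_choose_differ`. -/
theorem toShift_mulDiff {P Q : ℤ → R} {p q : ℤ} (hp : ∀ k, p < k → P k = 0)
    (hq : ∀ k, q < k → Q k = 0) (m : ℤ) :
    toShift (mulDiff τ P Q) m =
      ∑ b ∈ Icc (m - q) p, toShift P b * (τ ^ b) (toShift Q (m - b)) := by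
  have hpq : ∀ k, p + q < k → mulDiff τ P Q k = 0 := fun k hk => by
    rw [mulDiff_eq_sum hp hq le_rfl, Icc_eq_empty (by omega), sum_empty]
  rw [toShift_eq_sum hpq le_rfl le_rfl]
  have hL : ∀ k ∈ Icc m (p + q), ((-1) ^ (k - m).natAbs * binom k (k - m)) • mulDiff τ P Q k =
      ∑ s ∈ Icc (m - q) p, ∑ t ∈ Icc (m - p) q, P s *
        (((-1) ^ (k - m).natAbs * binom k (k - m) * binom s (s + t - k)) •
          (differ τ)^[(s + t - k).toNat] ((τ ^ (s - (s + t - k).toNat)) (Q t))) := fun k hk => by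
    rw [mulDiff_eq_sum hp hq (mem_Icc.1 hk).1]
    simp only [smul_sum, smul_smul, mul_smul_comm]
  have hR : ∀ b ∈ Icc (m - q) p, toShift P b * (τ ^ b) (toShift Q (m - b)) =
      ∑ s ∈ Icc (m - q) p, ∑ t ∈ Icc (m - p) q, P s *
        ((((-1) ^ (s - b).natAbs * binom s (s - b)) *
          ((-1) ^ (t - (m - b)).natAbs * binom t (t - (m - b)))) • (τ ^ b) (Q t)) := fun b hb => by
    rw [mem_Icc] at hb
    rw [toShift_eq_sum hp (a := m - q) hb.1 le_rfl,
      toShift_eq_sum hq (a := m - p) (by omega) le_rfl, map_sum, sum_mul_sum]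
    refine sum_congr rfl fun s _ => sum_congr rfl fun t _ => ?_
    rw [map_zsmul, smul_mul_smul_comm, mul_smul_comm]
  rw [sum_congr rfl hL, sum_congr rfl hR, sum_comm, sum_comm (s := Icc (m - q) p)
    (t := Icc (m - q) p)]
  refine sum_congr rfl fun s hs => ?_
  rw [sum_comm, sum_comm (s := Icc (m - q) p) (t := Icc (m - p) q)]
  refine sum_congr rfl fun t ht => ?_
  rw [mem_Icc] at hs ht
  rw [← mul_sum, ← mul_sum]
  congr 1
  rcases lt_or_ge (s + t - m) 0 with hd | hd
  · rw [sum_eq_zero fun k hk => ?_, sum_eq_zero fun b hb => ?_]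
    · rcases lt_or_ge s b with h | h
      · rw [binom_of_neg s (show s - b < 0 by omega)]; simp
      · rw [binom_of_neg t (show t - (m - b) < 0 by omega)]; simp
    · rw [mem_Icc] at hk
      rw [binom_of_neg s (show s + t - k < 0 by omega)]; simp
  · obtain ⟨d, hd⟩ := Int.eq_ofNat_of_zero_le hd
    rw [sum_Icc_eq_sum_range _ (s + t) d (by omega) (by omega) fun k hk => ?_,
      sum_Icc_eq_sum_range _ s d (by omega) (by omega) fun b hb => ?_]
    · rw [sum_congr rfl fun i hi => ?_, sum_choose_differ s t d (Q t)]
      · refine sum_congr rfl fun e he => ?_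
        rw [mem_range] at he
        rw [show s - (s - e) = (e : ℤ) by omega,
          show t - (m - (s - e)) = ((d - e : ℕ) : ℤ) by omega, binom_natCast, binom_natCast,
          Int.natAbs_natCast, Int.natAbs_natCast]
        congr 1
        rw [show d = e + (d - e) by omega, pow_add, Nat.add_sub_cancel_left]
        ring
      · rw [mem_range] at hi
        rw [show s + t - (s + t - i) = (i : ℤ) by omega,
          show s + t - i - m = ((d - i : ℕ) : ℤ) by omega, binom_natCast, binom_natCast,
          Int.natAbs_natCast, Int.toNat_natCast]
    · rcases hb with h | h
      · rw [binom_of_neg t (show t - (m - b) < 0 by omega)]; simp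
      · rw [binom_of_neg s (show s - b < 0 by omega)]; simp
    · rcases hk with h | h
      · rw [binom_of_neg k (show k - m < 0 by omega)]; simp
      · rw [binom_of_neg s (show s + t - k < 0 by omega)]; simp

end BasisChange
end DDKP

namespace DDKP

open scoped ContDiff

/-! ### Calculus of functions of the field -/

namespace FieldFun

@[ext] theorem ext {f g : FieldFun} (H : ∀ u n x, eval f u n x = eval g u n x) : f = g :=
  Subtype.ext (funext fun u => Subtype.ext (funext fun n => funext fun x => H u n x))

theorem induction {P : FieldFun → Prop} (field : P field) (zero : P 0)
    (add : ∀ f g, P f → P g → P (f + g)) (smul : ∀ (c : ℝ) f, P f → P (c • f))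
    (mul : ∀ f g, P f → P g → P (f * g)) (mulX : ∀ f, P f → P (mulX f))
    (mulN : ∀ f, P f → P (mulN f)) (shift : ∀ j f, P f → P (shift j f))
    (invDiff : ∀ f, P f → P (invDiff f)) (dx : ∀ f, P f → P (dx f)) (f : FieldFun) : P f := by
  obtain ⟨f, hf⟩ := f
  induction hf with
  | field => exact field
  | zero => exact zero
  | add _ _ h1 h2 => exact add _ _ h1 h2
  | smul c _ h => exact smul c _ h
  | mul _ _ h1 h2 => exact mul _ _ h1 h2
  | mulX _ h => exact mulX _ h
  | mulN _ h => exact mulN _ h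
  | shift j _ h => exact shift j _ h
  | invDiff _ h => exact invDiff _ h
  | dx _ h => exact dx _ h

variable (f g : FieldFun) (u : Phase) (n : ℤ) (x : ℝ)

theorem eval_add : eval (f + g) u n x = eval f u n x + eval g u n x := rfl
theorem eval_mul : eval (f * g) u n x = eval f u n x * eval g u n x := rfl
theorem eval_smul (c : ℝ) : eval (c • f) u n x = c * eval f u n x := rfl
theorem eval_shift (j : ℤ) : eval (shift j f) u n x = eval f u (n + j) x := rfl
theorem eval_mulX : eval (mulX f) u n x = x * eval f u n x := rfl
theorem eval_mulN : eval (mulN f) u n x = n * eval f u n x := rfl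
theorem eval_field : eval field u n x = u.1 n x := rfl

theorem diff_eq : diff f = shift 1 f - f := rfl

theorem contDiff_eval : ContDiff ℝ ∞ (eval f u n) := (f.1 u).2.1 n

theorem differentiable_eval : Differentiable ℝ (eval f u n) :=
  (contDiff_eval f u n).differentiable (by simp)

@[simp] theorem diff_invDiff : diff (invDiff f) = f :=
  Subtype.ext (funext fun u => Phase.diff_invDiff (f.1 u))

@[simp] theorem invDiff_diff : invDiff (diff f) = f :=
  Subtype.ext (funext fun u => Phase.invDiff_diff (f.1 u))

theorem shift_invDiff : shift 1 (invDiff f) = invDiff f + f := by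
  have := diff_invDiff f
  rw [diff_eq] at this
  nth_rewrite 3 [← this]
  abel

variable {f g} in
theorem diff_injective (H : diff f = diff g) : f = g := by
  rw [← invDiff_diff f, H, invDiff_diff]

variable {f} in
theorem eq_zero_of_shift_eq (H : shift 1 f = f) : f = 0 := by
  apply diff_injective
  rw [diff_eq, H, sub_self, map_zero]

/-- A function with zero derivative is constant in `x`, and rapid decrease forces the constant to be
zero. -/
theorem dx_injective : Function.Injective dx := by
  rw [injective_iff_map_eq_zero]
  intro f hf
  ext u n x
  have hd : ∀ y, deriv (eval f u n) y = 0 := fun y => by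
    have := congrArg (fun w => eval w u n y) hf
    exact this
  have hc : ∀ y, eval f u n y = eval f u n x := fun y =>
    is_const_of_deriv_eq_zero (differentiable_eval f u n) hd y x
  obtain ⟨C, hC⟩ := (f.1 u).2.2 n 0 1 0
  by_contra hne
  change eval f u n x ≠ 0 at hne
  -- At this point the bound on `|x| |f|` would read `|C| + 1 ≤ C`.
  have h1 := hC n le_rfl ((|C| + 1) / |eval f u n x|)
  simp only [pow_zero, one_mul, pow_one, iteratedDeriv_zero] at h1
  change abs ((|C| + 1) / |eval f u n x|) * abs (eval f u n ((|C| + 1) / |eval f u n x|)) ≤ C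
    at h1
  rw [hc ((|C| + 1) / |eval f u n x|), abs_div, abs_abs, div_mul_cancel₀ _ (abs_ne_zero.2 hne),
    abs_of_nonneg (by positivity)] at h1
  linarith [le_abs_self C]

theorem dx_shift (j : ℤ) : dx (shift j f) = shift j (dx f) := rfl

theorem dx_mul : dx (f * g) = dx f * g + f * dx g := by
  ext u n x
  exact deriv_mul (differentiable_eval f u n x) (differentiable_eval g u n x)

theorem dx_invDiff : dx (invDiff f) = invDiff (dx f) := by
  apply diff_injective
  rw [diff_invDiff, diff_eq, ← dx_shift, shift_invDiff, map_add]
  abel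

theorem dx_mulX : dx (mulX f) = f + mulX (dx f) := by
  ext u n x
  refine ((hasDerivAt_id x).mul (differentiable_eval f u n x).hasDerivAt).deriv.trans ?_
  rw [one_mul]
  rfl

theorem dx_mulN : dx (mulN f) = mulN (dx f) := by
  ext u n x
  exact deriv_const_mul_field _

theorem shift_mul (j : ℤ) : shift j (f * g) = shift j f * shift j g := rfl

theorem mulX_mul : mulX (f * g) = mulX f * g := by
  ext u n x; simp only [eval_mul, eval_mulX]; ring

theorem mul_mulX : f * mulX g = mulX (f * g) := by
  ext u n x; simp only [eval_mul, eval_mulX]; ring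

theorem mulN_mul : mulN (f * g) = mulN f * g := by
  ext u n x; simp only [eval_mul, eval_mulN]; ring

theorem mul_mulN : f * mulN g = mulN (f * g) := by
  ext u n x; simp only [eval_mul, eval_mulN]; ring

theorem shift_mulX (j : ℤ) : shift j (mulX f) = mulX (shift j f) := rfl

theorem shift_mulN : shift 1 (mulN f) = mulN (shift 1 f) + shift 1 f := by
  ext u n x; simp only [eval_add, eval_shift, eval_mulN]; push_cast; ring

instance : IsScalarTower ℝ FieldFun FieldFun :=
  ⟨fun a f g => ext fun u n x => mul_assoc a (eval f u n x) (eval g u n x)⟩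

instance : SMulCommClass ℝ FieldFun FieldFun :=
  ⟨fun a f g => ext fun u n x => mul_left_comm a (eval f u n x) (eval g u n x)⟩

/-! #### The Gateaux derivative -/

variable {f g} in
theorem gateaux_eq {d : FieldFun} (H : ∀ u n x,
    HasDerivAt (fun ε : ℝ => eval f (u + ε • g.1 u) n x) (eval d u n x) 0) : gateaux f g = d :=
  ext fun u n x => (gateaux_spec f g u n x).unique (H u n x)

@[simp] theorem gateaux_field : gateaux field g = g := by
  refine gateaux_eq fun u n x => ?_
  have := ((hasDerivAt_id (0 : ℝ)).mul_const (eval g u n x)).const_add (u.1 n x)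
  rw [one_mul] at this
  exact this

theorem gateaux_add (f₁ f₂ : FieldFun) : gateaux (f₁ + f₂) g = gateaux f₁ g + gateaux f₂ g :=
  gateaux_eq fun u n x => (gateaux_spec f₁ g u n x).add (gateaux_spec f₂ g u n x)

theorem gateaux_smul (c : ℝ) : gateaux (c • f) g = c • gateaux f g :=
  gateaux_eq fun u n x => (gateaux_spec f g u n x).const_mul c

/-- The Gateaux derivative in the direction `g` as a linear map. -/
def gateauxₗ : FieldFun →ₗ[ℝ] FieldFun where
  toFun f := gateaux f g
  map_add' := gateaux_add g
  map_smul' c f := gateaux_smul f g c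

theorem gateaux_zero : gateaux 0 g = 0 := map_zero (gateauxₗ g)

theorem gateaux_sub (f₁ f₂ : FieldFun) : gateaux (f₁ - f₂) g = gateaux f₁ g - gateaux f₂ g :=
  map_sub (gateauxₗ g) f₁ f₂

theorem gateaux_mul (f₁ f₂ : FieldFun) :
    gateaux (f₁ * f₂) g = gateaux f₁ g * f₂ + f₁ * gateaux f₂ g := by
  refine gateaux_eq fun u n x => ?_
  have := (gateaux_spec f₁ g u n x).mul (gateaux_spec f₂ g u n x)
  simp only [zero_smul, add_zero] at this
  exact this

theorem gateaux_shift (j : ℤ) : gateaux (shift j f) g = shift j (gateaux f g) :=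
  gateaux_eq fun u n x => gateaux_spec f g u (n + j) x

theorem gateaux_mulX : gateaux (mulX f) g = mulX (gateaux f g) :=
  gateaux_eq fun u n x => (gateaux_spec f g u n x).const_mul x

theorem gateaux_mulN : gateaux (mulN f) g = mulN (gateaux f g) :=
  gateaux_eq fun u n x => (gateaux_spec f g u n x).const_mul (n : ℝ)

theorem gateaux_diff : gateaux (diff f) g = diff (gateaux f g) := by
  rw [diff_eq, gateaux_sub, gateaux_shift, diff_eq]

/-- `Δ` is injective and commutes with the derivative, so no differentiation under the infinite sum
defining `Δ⁻¹` is needed. -/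
theorem gateaux_invDiff : gateaux (invDiff f) g = invDiff (gateaux f g) := by
  apply diff_injective
  rw [← gateaux_diff, diff_invDiff, diff_invDiff]

/-- The Gateaux derivative is the coefficient of `ε` in an expansion of `f(u + ε g(u))`. -/
theorem gateaux_eq_sum {ι : Type} [Fintype ι] (e : ι → ℕ) (c : ι → FieldFun)
    (H : ∀ (u : Phase) (ε : ℝ), f.1 (u + ε • g.1 u) = ∑ i, ε ^ e i • (c i).1 u) :
    gateaux f g = ∑ i, (if e i = 1 then (1 : ℝ) else 0) • c i := by
  refine gateaux_eq fun u n x => ?_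
  have h1 : ∀ ε : ℝ, eval f (u + ε • g.1 u) n x = ∑ i, ε ^ e i * eval (c i) u n x := fun ε => by
    unfold eval
    rw [H]
    let T : Phase →+ ℝ := { toFun := fun v => v.1 n x, map_zero' := rfl, map_add' := fun _ _ => rfl }
    exact map_sum T _ Finset.univ
  have h2 : eval (∑ i, (if e i = 1 then (1 : ℝ) else 0) • c i : FieldFun) u n x =
      ∑ i, (if e i = 1 then (1 : ℝ) else 0) * eval (c i) u n x := by
    let T : FieldFun →+ ℝ :=
      { toFun := fun v => eval v u n x, map_zero' := rfl, map_add' := fun _ _ => rfl }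
    exact map_sum T _ Finset.univ
  simp only [h1]
  rw [h2]
  refine HasDerivAt.fun_sum fun i _ => ?_
  have h3 : (if e i = 1 then (1 : ℝ) else 0) = (e i : ℝ) * 0 ^ (e i - 1) := by
    generalize e i = k
    rcases k with _ | _ | k <;> simp
  rw [h3]
  exact (hasDerivAt_pow (e i) (0 : ℝ)).mul_const (eval (c i) u n x)

/-- Interchanging the `ε`- and `x`-derivatives costs no analysis: `f(u + ε g)` is a polynomial in
`ε` with coefficients in `𝓕`, and `∂ₓ` acts on those coefficients. -/
theorem gateaux_dx : gateaux (dx f) g = dx (gateaux f g) := by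
  obtain ⟨ι, _, e, c, H⟩ := exists_expansion f.1 f.2 g
  rw [gateaux_eq_sum f g e c H, gateaux_eq_sum (dx f) g e (fun i => dx (c i)) fun u ε => ?_,
    map_sum]
  · simp only [map_smul]
  · change Phase.dx (f.1 (u + ε • g.1 u)) = _
    rw [H, map_sum]
    simp only [map_smul]
    rfl

/-- The commutator of two Gateaux derivatives. -/
theorem gateaux_gateaux_sub (w : FieldFun) :
    gateaux (gateaux w g) f - gateaux (gateaux w f) g =
      gateaux w (gateaux g f) - gateaux w (gateaux f g) := by
  -- Both sides, as functions of `w`, are derivations commuting with `x`, `n`, the shifts, `Δ⁻¹` and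
  -- `∂ₓ`, so it is enough that they agree at `w = u`.
  induction w using induction with
  | field => simp only [gateaux_field]
  | zero => simp only [gateaux_zero]
  | add a b ha hb => simp only [gateaux_add, add_sub_add_comm, ha, hb]
  | smul c a ha => simp only [gateaux_smul, ← smul_sub, ha]
  | mul a b ha hb =>
    have : ∀ p q : FieldFun, gateaux (gateaux (a * b) q) p - gateaux (gateaux (a * b) p) q =
        (gateaux (gateaux a q) p - gateaux (gateaux a p) q) * b +
          a * (gateaux (gateaux b q) p - gateaux (gateaux b p) q) := fun p q => by
      simp only [gateaux_mul, gateaux_add, sub_mul, mul_sub]; abel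
    rw [this, ha, hb, gateaux_mul, gateaux_mul]
    simp only [sub_mul, mul_sub]; abel
  | mulX a ha => simp only [gateaux_mulX, ← map_sub, ha]
  | mulN a ha => simp only [gateaux_mulN, ← map_sub, ha]
  | shift j a ha => simp only [gateaux_shift, ← map_sub, ha]
  | invDiff a ha => simp only [gateaux_invDiff, ← map_sub, ha]
  | dx a ha => simp only [gateaux_dx, ← map_sub, ha]

theorem eval_zero_field : eval f 0 n x = 0 := by
  have : f.1 0 = 0 := by
    induction f using induction with
    | field => rfl
    | zero => rfl
    | add a b ha hb => change a.1 0 + b.1 0 = 0; rw [ha, hb, add_zero]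
    | smul c a ha => change c • a.1 0 = 0; rw [ha, smul_zero]
    | mul a b ha hb => change a.1 0 * b.1 0 = 0; rw [ha, zero_mul]
    | mulX a ha => change Phase.mulX (a.1 0) = 0; rw [ha, map_zero]
    | mulN a ha => change Phase.mulN (a.1 0) = 0; rw [ha, map_zero]
    | shift j a ha => change Phase.shift j (a.1 0) = 0; rw [ha, map_zero]
    | invDiff a ha => change Phase.invDiff (a.1 0) = 0; rw [ha, map_zero]
    | dx a ha => change Phase.dx (a.1 0) = 0; rw [ha, map_zero]
  unfold eval
  rw [this]
  rfl

end FieldFun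

end DDKP

namespace DDKP

open FieldFun (eval)

/-! ### The algebra of coefficients -/

/-- The coefficient `x`. -/
def coeffX : Coeff := fun _ _ x => x

/-- The coefficient `n`. -/
def coeffN : Coeff := fun _ n _ => n

/-- The algebra generated by `x`, `n` and the functions of the field. -/
def coeffAlgebra : Subalgebra ℝ Coeff :=
  Algebra.adjoin ℝ ({coeffX, coeffN} ∪ Set.range eval)

theorem eval_mem (w : FieldFun) : eval w ∈ coeffAlgebra :=
  Algebra.subset_adjoin (Or.inr ⟨w, rfl⟩)

theorem coeffX_mem : coeffX ∈ coeffAlgebra := Algebra.subset_adjoin (Or.inl (Or.inl rfl))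

theorem coeffN_mem : coeffN ∈ coeffAlgebra := Algebra.subset_adjoin (Or.inl (Or.inr rfl))

theorem coeffAlgebra_induction {P : (c : Coeff) → c ∈ coeffAlgebra → Prop}
    (X : P coeffX coeffX_mem) (N : P coeffN coeffN_mem)
    (eval : ∀ w : FieldFun, P (eval w) (eval_mem w))
    (const : ∀ r : ℝ, P (algebraMap ℝ Coeff r) (coeffAlgebra.algebraMap_mem r))
    (add : ∀ a b ha hb, P a ha → P b hb → P (a + b) (add_mem ha hb))
    (mul : ∀ a b ha hb, P a ha → P b hb → P (a * b) (mul_mem ha hb))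
    {c : Coeff} (hc : c ∈ coeffAlgebra) : P c hc := by
  induction hc using Algebra.adjoin_induction with
  | mem a ha =>
    rcases ha with (rfl | rfl) | ⟨w, rfl⟩
    · exact X
    · exact N
    · exact eval w
  | algebraMap r => exact const r
  | add a b ha hb h1 h2 => exact add a b ha hb h1 h2
  | mul a b ha hb h1 h2 => exact mul a b ha hb h1 h2

namespace Coeff

theorem shift_mem {c : Coeff} (hc : c ∈ coeffAlgebra) (j : ℤ) : shift j c ∈ coeffAlgebra := by
  induction hc using coeffAlgebra_induction with
  | X => exact coeffX_mem
  | N =>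
    have : shift j coeffN = coeffN + algebraMap ℝ Coeff j := by
      funext u n x; simp [shift, coeffN]
    rw [this]
    exact add_mem coeffN_mem (coeffAlgebra.algebraMap_mem _)
  | eval w => exact eval_mem (FieldFun.shift j w)
  | const r => exact coeffAlgebra.algebraMap_mem r
  | add a b _ _ h1 h2 => exact add_mem h1 h2
  | mul a b _ _ h1 h2 => exact mul_mem h1 h2

theorem differentiable {c : Coeff} (hc : c ∈ coeffAlgebra) (u : Phase) (n : ℤ) :
    Differentiable ℝ (c u n) := by
  induction hc using coeffAlgebra_induction with
  | X => exact differentiable_id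
  | N => exact differentiable_const _
  | eval w => exact FieldFun.differentiable_eval w u n
  | const r => exact differentiable_const r
  | add a b _ _ h1 h2 => exact h1.add h2
  | mul a b _ _ h1 h2 => exact h1.mul h2

theorem dx_add {a b : Coeff} (ha : a ∈ coeffAlgebra) (hb : b ∈ coeffAlgebra) :
    dx (a + b) = dx a + dx b := by
  funext u n x
  exact deriv_add (differentiable ha u n x) (differentiable hb u n x)

theorem dx_mul {a b : Coeff} (ha : a ∈ coeffAlgebra) (hb : b ∈ coeffAlgebra) :
    dx (a * b) = dx a * b + a * dx b := by
  funext u n x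
  exact deriv_mul (differentiable ha u n x) (differentiable hb u n x)

theorem dx_algebraMap (r : ℝ) : dx (algebraMap ℝ Coeff r) = 0 := by
  funext u n x
  exact deriv_const x r

theorem dx_X : dx coeffX = 1 := by
  funext u n x
  exact deriv_id x

theorem dx_N : dx coeffN = 0 := by
  funext u n x
  exact deriv_const x _

theorem dx_mem {c : Coeff} (hc : c ∈ coeffAlgebra) : dx c ∈ coeffAlgebra := by
  induction hc using coeffAlgebra_induction with
  | X => rw [dx_X]; exact one_mem _
  | N => rw [dx_N]; exact zero_mem _
  | eval w => exact eval_mem (FieldFun.dx w)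
  | const r => rw [dx_algebraMap]; exact zero_mem _
  | add a b ha hb h1 h2 => rw [dx_add ha hb]; exact add_mem h1 h2
  | mul a b ha hb h1 h2 =>
    rw [dx_mul ha hb]; exact add_mem (mul_mem h1 hb) (mul_mem ha h2)

/-- The value of a coefficient at `u = 0`. -/
def atZero : Coeff →+* (ℤ → ℝ → ℝ) where
  toFun c := c 0
  map_one' := rfl
  map_mul' _ _ := rfl
  map_zero' := rfl
  map_add' _ _ := rfl

/-- A coefficient is its value at `u = 0`, a polynomial in `x` and `n`, plus an element of `𝓕`. The
second clause, stability of `𝓕` under multiplication by that polynomial, is what carries the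
induction through products. -/
theorem exists_eval_eq {c : Coeff} (hc : c ∈ coeffAlgebra) :
    (∃ w : FieldFun, c = (fun _ => c 0) + eval w) ∧
      ∀ w : FieldFun, ∃ w' : FieldFun, (fun _ => c 0) * eval w = eval w' := by
  induction hc using coeffAlgebra_induction with
  | X => exact ⟨⟨0, (add_zero _).symm⟩, fun w => ⟨FieldFun.mulX w, rfl⟩⟩
  | N => exact ⟨⟨0, (add_zero _).symm⟩, fun w => ⟨FieldFun.mulN w, rfl⟩⟩
  | eval w =>
    have h0 : (fun _ => eval w 0 : Coeff) = 0 := by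
      funext u n x; exact FieldFun.eval_zero_field w n x
    rw [h0]
    exact ⟨⟨w, (zero_add _).symm⟩, fun _ => ⟨0, zero_mul _⟩⟩
  | const r => exact ⟨⟨0, (add_zero _).symm⟩, fun w => ⟨r • w, rfl⟩⟩
  | add a b _ _ h1 h2 =>
    obtain ⟨⟨v, hv⟩, h1⟩ := h1
    obtain ⟨⟨w, hw⟩, h2⟩ := h2
    refine ⟨⟨v + w, ?_⟩, fun z => ?_⟩
    · nth_rewrite 1 [hv, hw]
      exact add_add_add_comm _ _ _ _
    · obtain ⟨y, hy⟩ := h1 z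
      obtain ⟨y', hy'⟩ := h2 z
      refine ⟨y + y', ?_⟩
      change ((fun _ => a 0) + (fun _ => b 0)) * eval z = eval y + eval y'
      rw [add_mul, hy, hy']
  | mul a b _ _ h1 h2 =>
    obtain ⟨⟨v, hv⟩, h1⟩ := h1
    obtain ⟨⟨w, hw⟩, h2⟩ := h2
    refine ⟨?_, fun z => ?_⟩
    · obtain ⟨y, hy⟩ := h1 w
      obtain ⟨y', hy'⟩ := h2 v
      refine ⟨y + y' + v * w, ?_⟩
      nth_rewrite 1 [hv, hw]
      change _ = (fun _ => a 0) * (fun _ => b 0) + (eval y + eval y' + eval v * eval w)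
      rw [← hy, ← hy']
      ring
    · obtain ⟨y, hy⟩ := h2 z
      obtain ⟨y', hy'⟩ := h1 y
      refine ⟨y', ?_⟩
      change (fun _ => a 0) * (fun _ => b 0) * eval z = eval y'
      rw [mul_assoc, hy, hy']

theorem exists_eval {c : Coeff} (hc : c ∈ coeffAlgebra) (h0 : ∀ n x, c 0 n x = 0) :
    ∃ w : FieldFun, c = eval w := by
  obtain ⟨⟨w, hw⟩, -⟩ := exists_eval_eq hc
  refine ⟨w, ?_⟩
  rw [hw]
  funext u n x
  change c 0 n x + _ = _
  rw [h0, zero_add]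

theorem hasDerivAt {c : Coeff} (hc : c ∈ coeffAlgebra) (g : FieldFun) (u : Phase) (n : ℤ) (x : ℝ) :
    HasDerivAt (fun ε : ℝ => c (u + ε • g.1 u) n x) (gateaux c g u n x) 0 := by
  refine DifferentiableAt.hasDerivAt ?_
  obtain ⟨⟨w, hw⟩, -⟩ := exists_eval_eq hc
  rw [hw]
  exact ((FieldFun.gateaux_spec w g u n x).const_add (c 0 n x)).differentiableAt

theorem gateaux_eval (w g : FieldFun) : gateaux (eval w) g = eval (FieldFun.gateaux w g) := by
  funext u n x
  exact (FieldFun.gateaux_spec w g u n x).deriv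

theorem gateaux_add {a b : Coeff} (ha : a ∈ coeffAlgebra) (hb : b ∈ coeffAlgebra) (g : FieldFun) :
    gateaux (a + b) g = gateaux a g + gateaux b g := by
  funext u n x
  exact ((hasDerivAt ha g u n x).add (hasDerivAt hb g u n x)).deriv

theorem gateaux_mul {a b : Coeff} (ha : a ∈ coeffAlgebra) (hb : b ∈ coeffAlgebra) (g : FieldFun) :
    gateaux (a * b) g = gateaux a g * b + a * gateaux b g := by
  funext u n x
  have := ((hasDerivAt ha g u n x).mul (hasDerivAt hb g u n x)).deriv
  simp only [zero_smul, add_zero] at this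
  exact this

theorem gateaux_of_const (c : ℤ → ℝ → ℝ) (g : FieldFun) : gateaux (fun _ => c) g = 0 := by
  funext u n x
  exact deriv_const _ _

/-- The derivative does not see the value at `u = 0`. One `w` serves both `c` and `∂ₓ c`, so
commutation with `∂ₓ` is inherited from `𝓕`. -/
theorem exists_gateaux_eq {c : Coeff} (hc : c ∈ coeffAlgebra) :
    ∃ w : FieldFun, (∀ g, gateaux c g = eval (FieldFun.gateaux w g)) ∧
      ∀ g, gateaux (dx c) g = eval (FieldFun.gateaux (FieldFun.dx w) g) := by
  obtain ⟨⟨w, hw⟩, -⟩ := exists_eval_eq hc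
  have key : ∀ (p : ℤ → ℝ → ℝ) (w g : FieldFun), gateaux ((fun _ => p) + eval w) g =
      eval (FieldFun.gateaux w g) := fun p w g => by
    funext u n x
    exact ((FieldFun.gateaux_spec w g u n x).const_add (p n x)).deriv
  have hdx : dx c = (fun _ => dx c 0) + eval (FieldFun.dx w) := by
    funext u n x
    have h1 : (c u n : ℝ → ℝ) = c 0 n + eval w u n := congrFun (congrFun hw u) n
    change deriv (c u n) x = deriv (c 0 n) x + deriv (eval w u n) x
    rw [h1]
    exact deriv_add (differentiable hc 0 n x) (FieldFun.differentiable_eval w u n x)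
  exact ⟨w, fun g => by rw [hw, key], fun g => by rw [hdx, key]⟩

theorem gateaux_mem {c : Coeff} (hc : c ∈ coeffAlgebra) (g : FieldFun) :
    gateaux c g ∈ coeffAlgebra := by
  obtain ⟨w, hw, -⟩ := exists_gateaux_eq hc
  rw [hw]
  exact eval_mem _

theorem gateaux_dx {c : Coeff} (hc : c ∈ coeffAlgebra) (g : FieldFun) :
    gateaux (dx c) g = dx (gateaux c g) := by
  obtain ⟨w, hw, hw'⟩ := exists_gateaux_eq hc
  rw [hw, hw', FieldFun.gateaux_dx]
  rfl

end Coeff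

/-- The type of the elements of `coeffAlgebra`. -/
abbrev Scalar : Type := coeffAlgebra

namespace Scalar

instance : CommRing Scalar := inferInstance

@[ext] theorem ext {a b : Scalar} (h : a.1 = b.1) : a = b := Subtype.ext h

/-- The shift `E` as an automorphism. -/
def shift : RingAut Scalar where
  toFun c := ⟨Coeff.shift 1 c.1, Coeff.shift_mem c.2 1⟩
  invFun c := ⟨Coeff.shift (-1) c.1, Coeff.shift_mem c.2 (-1)⟩
  left_inv c := by ext u n x; simp [Coeff.shift]
  right_inv c := by ext u n x; simp [Coeff.shift]
  map_mul' _ _ := rfl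
  map_add' _ _ := rfl

theorem shift_zpow_val (j : ℤ) : ∀ c : Scalar, ((shift ^ j) c).1 = Coeff.shift j c.1 := by
  induction j using Int.induction_on with
  | zero => intro c; ext u n x; simp [Coeff.shift]
  | succ i ih =>
    intro c
    rw [zpow_add_one, RingAut.mul_apply, ih]
    funext u n x
    exact congrArg (fun m => c.1 u m x) (by ring)
  | pred i ih =>
    intro c
    rw [zpow_sub_one, RingAut.mul_apply, ih]
    funext u n x
    exact congrArg (fun m => c.1 u m x) (by ring)

/-- `∂ₓ` on scalars. -/
def dx : Scalar →+ Scalar where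
  toFun c := ⟨Coeff.dx c.1, Coeff.dx_mem c.2⟩
  map_zero' := ext (by have := Coeff.dx_algebraMap 0; rw [map_zero] at this; exact this)
  map_add' a b := ext (Coeff.dx_add a.2 b.2)

theorem dx_mul (a b : Scalar) : dx (a * b) = dx a * b + a * dx b := ext (Coeff.dx_mul a.2 b.2)

theorem dx_shift_zpow (j : ℤ) (a : Scalar) : dx ((shift ^ j) a) = (shift ^ j) (dx a) := by
  apply ext
  rw [shift_zpow_val]
  change Coeff.dx ((shift ^ j) a).1 = _
  rw [shift_zpow_val]
  rfl

/-- The Gateaux derivative of scalars. -/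
def gateaux (g : FieldFun) : Scalar →+ Scalar where
  toFun c := ⟨Coeff.gateaux c.1 g, Coeff.gateaux_mem c.2 g⟩
  map_zero' := ext (Coeff.gateaux_of_const 0 g)
  map_add' a b := ext (Coeff.gateaux_add a.2 b.2 g)

theorem gateaux_mul (g : FieldFun) (a b : Scalar) :
    gateaux g (a * b) = gateaux g a * b + a * gateaux g b := ext (Coeff.gateaux_mul a.2 b.2 g)

theorem gateaux_shift_zpow (g : FieldFun) (j : ℤ) (a : Scalar) :
    gateaux g ((shift ^ j) a) = (shift ^ j) (gateaux g a) := by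
  apply ext
  rw [shift_zpow_val]
  change Coeff.gateaux ((shift ^ j) a).1 g = _
  rw [shift_zpow_val]
  rfl

theorem gateaux_dx (g : FieldFun) (a : Scalar) : gateaux g (dx a) = dx (gateaux g a) :=
  ext (Coeff.gateaux_dx a.2 g)

/-- A function of the field as a scalar. -/
def ofField : FieldFun →+ Scalar where
  toFun w := ⟨eval w, eval_mem w⟩
  map_zero' := rfl
  map_add' _ _ := rfl

/-- A real number as a scalar. -/
def const : ℝ →+* Scalar := algebraMap ℝ Scalar

/-- The scalar `x`. -/
def X : Scalar := ⟨coeffX, coeffX_mem⟩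

/-- The scalar `n`. -/
def N : Scalar := ⟨coeffN, coeffN_mem⟩

theorem ofField_injective : Function.Injective ofField := fun _ _ h =>
  FieldFun.ext fun u n x => congrFun (congrFun (congrFun (congrArg Subtype.val h) u) n) x

theorem ofField_mul (f g : FieldFun) : ofField (f * g) = ofField f * ofField g := rfl
theorem ofField_smul (r : ℝ) (f : FieldFun) : ofField (r • f) = const r * ofField f := rfl
theorem ofField_mulX (f : FieldFun) : ofField (FieldFun.mulX f) = X * ofField f := rfl
theorem ofField_mulN (f : FieldFun) : ofField (FieldFun.mulN f) = N * ofField f := rfl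

theorem shift_ofField (f : FieldFun) : shift (ofField f) = ofField (FieldFun.shift 1 f) := rfl

theorem shift_zpow_ofField (j : ℤ) (f : FieldFun) :
    (shift ^ j) (ofField f) = ofField (FieldFun.shift j f) := ext (shift_zpow_val j _)

theorem dx_ofField (f : FieldFun) : dx (ofField f) = ofField (FieldFun.dx f) := rfl

theorem gateaux_ofField (g f : FieldFun) :
    gateaux g (ofField f) = ofField (FieldFun.gateaux f g) := ext (Coeff.gateaux_eval f g)

theorem shift_const (r : ℝ) : shift (const r) = const r := rfl
theorem shift_X : shift X = X := rfl
theorem shift_N : shift N = N + 1 := by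
  ext u n x
  exact Int.cast_add n 1 |>.trans (by simp [N, coeffN])

theorem dx_const (r : ℝ) : dx (const r) = 0 := ext (Coeff.dx_algebraMap r)
theorem dx_X : dx X = 1 := ext Coeff.dx_X
theorem dx_N : dx N = 0 := ext Coeff.dx_N

theorem gateaux_const (g : FieldFun) (r : ℝ) : gateaux g (const r) = 0 :=
  ext (Coeff.gateaux_of_const _ g)
theorem gateaux_N (g : FieldFun) : gateaux g N = 0 := ext (Coeff.gateaux_of_const _ g)

theorem shift_zpow_of_eq {c : Scalar} (h : shift c = c) (j : ℤ) : (shift ^ j) c = c := by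
  induction j using Int.induction_on with
  | zero => rfl
  | succ i ih => rw [zpow_add_one, RingAut.mul_apply, h, ih]
  | pred i ih =>
    rw [zpow_sub_one, RingAut.mul_apply, (RingEquiv.symm_apply_eq shift).2 h.symm |> fun e =>
      show (shift⁻¹) c = c from e, ih]

/-- The ideal of scalars that vanish at `u = 0`. -/
def vanishing : Ideal Scalar := RingHom.ker (Coeff.atZero.comp coeffAlgebra.val.toRingHom)

/-- This identifies `𝓕` with an ideal of the coefficient ring, so that evaluation at `u = 0` amounts
to working modulo `𝓕`. -/
theorem mem_vanishing_iff {c : Scalar} : c ∈ vanishing ↔ ∃ w : FieldFun, c = ofField w := by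
  constructor
  · intro h
    have h0 : c.1 0 = 0 := h
    obtain ⟨w, hw⟩ := Coeff.exists_eval c.2 fun n x => by rw [h0]; rfl
    exact ⟨w, ext hw⟩
  · rintro ⟨w, rfl⟩
    change eval w 0 = 0
    funext n x
    exact FieldFun.eval_zero_field w n x

theorem ofField_mem (w : FieldFun) : ofField w ∈ vanishing := mem_vanishing_iff.2 ⟨w, rfl⟩

theorem shift_zpow_mem (j : ℤ) : ∀ c ∈ vanishing, (shift ^ j) c ∈ vanishing := by
  intro c hc
  obtain ⟨w, rfl⟩ := mem_vanishing_iff.1 hc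
  rw [shift_zpow_ofField]
  exact ofField_mem _

theorem gateaux_mem (g : FieldFun) (c : Scalar) : gateaux g c ∈ vanishing := by
  obtain ⟨w, hw, -⟩ := Coeff.exists_gateaux_eq c.2
  exact mem_vanishing_iff.2 ⟨_, ext (hw g)⟩

/-- Constants and functions of `x` alone are also shift-invariant; it is the vanishing at `u = 0`
that excludes them. The whole uniqueness argument depends on this. -/
theorem eq_zero_of_shift_eq {c : Scalar} (hc : c ∈ vanishing) (h : shift c = c) : c = 0 := by
  obtain ⟨w, rfl⟩ := mem_vanishing_iff.1 hc
  rw [shift_ofField] at h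
  rw [FieldFun.eq_zero_of_shift_eq (ofField_injective h), map_zero]

end Scalar

end DDKP

namespace DDKP

/-! ### Supports, maps and powers of `Δ` under the change of basis -/

section

open Finset

variable {R : Type*} [CommRing R] {τ : RingAut R}

theorem mulDiff_eq_zero {P Q : ℤ → R} {p q : ℤ} (hp : ∀ k, p < k → P k = 0)
    (hq : ∀ k, q < k → Q k = 0) {k : ℤ} (hk : p + q < k) : mulDiff τ P Q k = 0 := by
  rw [mulDiff_eq_sum hp hq le_rfl, Icc_eq_empty (by omega), sum_empty]

theorem toDiff_mem {S : AddSubgroup R} {P : ℤ → R} {p : ℤ} (hp : ∀ k, p < k → P k = 0)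
    (hS : ∀ k, P k ∈ S) (k : ℤ) : toDiff P k ∈ S := by
  rw [toDiff_eq_sum hp le_rfl le_rfl]
  exact sum_mem fun s _ => zsmul_mem (hS s) _

theorem toShift_mem {S : AddSubgroup R} {P : ℤ → R} {p : ℤ} (hp : ∀ k, p < k → P k = 0)
    (hS : ∀ k, P k ∈ S) (k : ℤ) : toShift P k ∈ S := by
  rw [toShift_eq_sum hp le_rfl le_rfl]
  exact sum_mem fun s _ => zsmul_mem (hS s) _

/-- For `s ≥ 0` and `k < 0` the lower index `s - k` exceeds `s`. Hence non-negative powers of `E`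
and of `Δ` span the same operators. -/
theorem binom_eq_zero_of_neg {s k : ℤ} (hs : 0 ≤ s) (hk : k < 0) : binom s (s - k) = 0 := by
  lift s to ℕ using hs
  rw [show (s : ℤ) - k = ((s - k : ℤ).toNat : ℤ) by omega, binom_natCast, Ring.choose_natCast,
    Nat.choose_eq_zero_of_lt (by omega), Nat.cast_zero]

theorem toDiff_eq_zero_of_neg {P : ℤ → R} (hP : ∀ k < 0, P k = 0) {k : ℤ} (hk : k < 0) :
    toDiff P k = 0 := by
  rw [toDiff, ← finsum_zero (α := ℤ)]
  refine finsum_congr fun s => ?_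
  rcases lt_or_ge s 0 with hs | hs
  · rw [hP s hs, smul_zero]
  · rw [binom_eq_zero_of_neg hs hk, zero_smul]

theorem toShift_eq_zero_of_neg {P : ℤ → R} (hP : ∀ k < 0, P k = 0) {k : ℤ} (hk : k < 0) :
    toShift P k = 0 := by
  rw [toShift, ← finsum_zero (α := ℤ)]
  refine finsum_congr fun s => ?_
  rcases lt_or_ge s 0 with hs | hs
  · rw [hP s hs, smul_zero]
  · rw [binom_eq_zero_of_neg hs hk, mul_zero, zero_smul]

theorem toDiff_eq_zero_of_nonneg {P : ℤ → R} (hP : ∀ k, 0 ≤ k → P k = 0) {k : ℤ} (hk : 0 ≤ k) :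
    toDiff P k = 0 :=
  toDiff_eq_zero (p := -1) (fun j hj => hP j (by omega)) (by omega)

theorem toDiff_map {P : ℤ → R} {p : ℤ} (hp : ∀ k, p < k → P k = 0) (d : R →+ R) (k : ℤ) :
    toDiff (fun j => d (P j)) k = d (toDiff P k) := by
  rw [toDiff_eq_sum hp le_rfl le_rfl,
    toDiff_eq_sum (p := p) (fun j hj => by rw [hp j hj, map_zero]) le_rfl le_rfl, map_sum]
  exact sum_congr rfl fun s _ => (map_zsmul d _ _).symm

theorem toDiff_add {P Q : ℤ → R} {p q : ℤ} (hp : ∀ k, p < k → P k = 0)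
    (hq : ∀ k, q < k → Q k = 0) (k : ℤ) :
    toDiff (fun j => P j + Q j) k = toDiff P k + toDiff Q k := by
  rw [toDiff_eq_sum hp le_rfl (le_max_left p q), toDiff_eq_sum hq le_rfl (le_max_right p q),
    toDiff_eq_sum (p := max p q) (fun j hj => ?_) le_rfl le_rfl, ← sum_add_distrib]
  · exact sum_congr rfl fun s _ => smul_add _ _ _
  · rw [hp j (lt_of_le_of_lt (le_max_left _ _) hj), hq j (lt_of_le_of_lt (le_max_right _ _) hj),
      add_zero]

theorem differ_iterate_one {i : ℕ} (hi : i ≠ 0) : (differ τ)^[i] 1 = 0 := by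
  obtain ⟨i, rfl⟩ := Nat.exists_eq_succ_of_ne_zero hi
  rw [Function.iterate_succ_apply, differ, map_one, sub_self, differ_iterate_zero]

/-- In the Leibniz rule all terms with `i > 0` contain `Δ^i 1 = 0`, so right multiplication by `Δ^t`
only shifts the index. -/
theorem mulDiff_single_one (P : ℤ → R) (t k : ℤ) :
    mulDiff τ P (Pi.single t 1) k = P (k - t) := by
  rw [mulDiff, finsum_eq_single _ (k - t, 0)]
  · simp
  · rintro ⟨s, i⟩ hne
    by_cases h : k - s + i = t
    · have hi : i ≠ 0 := by
        rintro rfl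
        refine hne ?_
        rw [Prod.mk.injEq]
        refine ⟨?_, rfl⟩
        push_cast at h; omega
      simp only [h, Pi.single_eq_same, map_one]
      rw [differ_iterate_one hi, mul_zero, smul_zero]
    · simp only [Pi.single_eq_of_ne h, map_zero]
      rw [differ_iterate_zero, mul_zero, smul_zero]

theorem toShift_single_one_one (k : ℤ) :
    toShift (Pi.single 1 1 : ℤ → R) k = (if k = 1 then 1 else 0) - (if k = 0 then 1 else 0) := by
  rw [toShift, finsum_eq_single _ (1 : ℤ) fun s hs => by rw [Pi.single_eq_of_ne hs, smul_zero]]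
  rw [Pi.single_eq_same]
  rcases lt_trichotomy k 0 with hk | rfl | hk
  · rw [binom_eq_zero_of_neg zero_le_one hk, if_neg (by omega), if_neg (by omega)]; simp
  · simp [binom]
  · rcases eq_or_ne k 1 with rfl | h1
    · simp [binom]
    · rw [binom_of_neg _ (by omega), if_neg h1, if_neg (by omega)]; simp

end

/-! ### Operators with scalar coefficients -/

/-- The operators `∑_k c_k E ^ k`. -/
abbrev Op : Type := SkewLaurent Scalar.shift

namespace Op

open SkewLaurent

/-- Multiplication by a scalar. -/
def C : Scalar →+* Op where
  toFun c := single 0 c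
  map_one' := rfl
  map_mul' c d := by rw [single_mul_single]; rfl
  map_zero' := by ext k; rw [coeff_single]; split_ifs <;> rfl
  map_add' c d := single_add 0 c d

theorem coeff_C (c : Scalar) (k : ℤ) : (C c).coeff k = if k = 0 then c else 0 := coeff_single _ _ _

theorem coeff_C_mul (c : Scalar) (P : Op) (k : ℤ) : (C c * P).coeff k = c * P.coeff k := by
  refine (coeff_single_mul _ _ _ _).trans ?_
  rw [sub_zero, zpow_zero]; rfl

theorem coeff_mul_C (c : Scalar) (P : Op) (k : ℤ) :
    (P * C c).coeff k = P.coeff k * (Scalar.shift ^ k) c := by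
  refine (coeff_mul_single _ _ _ _).trans ?_
  rw [sub_zero]

instance : Algebra ℝ Op := (C.comp Scalar.const).toAlgebra' fun r P => by
  ext k
  rw [RingHom.comp_apply, coeff_C_mul, coeff_mul_C,
    Scalar.shift_zpow_of_eq (Scalar.shift_const r), mul_comm]

theorem smul_def (r : ℝ) (P : Op) : r • P = C (Scalar.const r) * P := rfl

theorem coeff_smul (r : ℝ) (P : Op) (k : ℤ) : (r • P).coeff k = Scalar.const r * P.coeff k :=
  coeff_C_mul _ _ _

/-- The shift operator. -/
def E : Op := single 1 1

theorem coeff_E_mul (P : Op) (k : ℤ) : (E * P).coeff k = Scalar.shift (P.coeff (k - 1)) := by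
  refine (coeff_single_mul _ _ _ _).trans ?_
  rw [one_mul, zpow_one]

theorem coeff_mul_E (P : Op) (k : ℤ) : (P * E).coeff k = P.coeff (k - 1) := by
  refine (coeff_mul_single _ _ _ _).trans ?_
  rw [map_one, mul_one]

/-- `∂ₓ` applied to the coefficients. -/
def dx : Op →+ Op := mapCoeff Scalar.dx

/-- The Gateaux derivative of the coefficients. -/
def gateaux (g : FieldFun) : Op →+ Op := mapCoeff (Scalar.gateaux g)

theorem coeff_dx (P : Op) (k : ℤ) : (dx P).coeff k = Scalar.dx (P.coeff k) := rfl

theorem coeff_gateaux (g : FieldFun) (P : Op) (k : ℤ) :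
    (gateaux g P).coeff k = Scalar.gateaux g (P.coeff k) := rfl

theorem dx_mul (P Q : Op) : dx (P * Q) = dx P * Q + P * dx Q :=
  mapCoeff_mul _ Scalar.dx_mul Scalar.dx_shift_zpow P Q

theorem gateaux_mul (g : FieldFun) (P Q : Op) :
    gateaux g (P * Q) = gateaux g P * Q + P * gateaux g Q :=
  mapCoeff_mul _ (Scalar.gateaux_mul g) (Scalar.gateaux_shift_zpow g) P Q

theorem gateaux_dx (g : FieldFun) (P : Op) : gateaux g (dx P) = dx (gateaux g P) := by
  ext1 k
  exact Scalar.gateaux_dx g _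

theorem dx_smul (r : ℝ) (P : Op) : dx (r • P) = r • dx P := by
  ext1 k
  rw [coeff_smul, coeff_dx, coeff_smul, Scalar.dx_mul, Scalar.dx_const, zero_mul, zero_add]
  rfl

/-- The part with the non-negative powers of `E`. -/
def posPart (P : Op) : Op := ⟨fun k => if 0 ≤ k then P.coeff k else 0, by
  obtain ⟨p, hp⟩ := P.exists_bound
  exact ⟨p, fun k hk => by simp only [hp k hk, ite_self]⟩⟩

theorem coeff_posPart (P : Op) (k : ℤ) :
    (posPart P).coeff k = if 0 ≤ k then P.coeff k else 0 := rfl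

/-! #### The coefficients with respect to the powers of `Δ` -/

/-- The coefficients with respect to the powers of `Δ`. -/
def toPseudoDiff (P : Op) : PseudoDiff := fun k => (toDiff P.coeff k).1

theorem toPseudoDiff_injective : Function.Injective toPseudoDiff := fun P Q h => by
  obtain ⟨p, hp⟩ := P.exists_bound
  obtain ⟨q, hq⟩ := Q.exists_bound
  have : toDiff P.coeff = toDiff Q.coeff := funext fun k => Scalar.ext (congrFun h k)
  ext1 k
  rw [← toShift_toDiff hp, this, toShift_toDiff hq]

theorem exists_toPseudoDiff_eq {P : PseudoDiff} {p : ℤ} (hp : ∀ k, p < k → P k = 0)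
    (hP : ∀ k, P k ∈ coeffAlgebra) :
    ∃ Q : Op, toPseudoDiff Q = P ∧ (∀ k, Q.coeff k = toShift (fun k => (⟨P k, hP k⟩ : Scalar)) k) ∧
      ∀ k, p < k → Q.coeff k = 0 := by
  have hp' : ∀ k, p < k → (⟨P k, hP k⟩ : Scalar) = 0 := fun k hk => Scalar.ext (hp k hk)
  refine ⟨mk _ p fun k hk => toShift_eq_zero hp' hk, ?_, fun k => rfl,
    fun k hk => toShift_eq_zero hp' hk⟩
  funext k
  exact congrArg Subtype.val (congrFun (toDiff_toShift hp') k)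

/-- Serves the uniqueness statements: the deviation of a competing operator from its prescribed part
comes from a series in `E`, and vanishing at `u = 0`, the order bound and the absence of negative
powers survive the change of basis. -/
theorem exists_toPseudoDiff_eq_of_vanishing {P : PseudoDiff} {p : ℤ} (hp : ∀ k, p < k → P k = 0)
    (hP : ∀ k, ∃ w : FieldFun, P k = FieldFun.eval w) :
    ∃ Q : Op, toPseudoDiff Q = P ∧ (∀ k, Q.coeff k ∈ Scalar.vanishing) ∧
      (∀ k, p < k → Q.coeff k = 0) ∧ ((∀ k < 0, P k = 0) → ∀ k < 0, Q.coeff k = 0) := by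
  have hP' : ∀ k, P k ∈ coeffAlgebra := fun k => by
    obtain ⟨w, hw⟩ := hP k
    rw [hw]
    exact eval_mem w
  have hp' : ∀ k, p < k → (⟨P k, hP' k⟩ : Scalar) = 0 := fun k hk => Scalar.ext (hp k hk)
  obtain ⟨Q, h1, h2, h3⟩ := exists_toPseudoDiff_eq hp hP'
  refine ⟨Q, h1, fun k => ?_, h3, fun h k hk => ?_⟩
  · rw [h2]
    refine toShift_mem (S := Scalar.vanishing.toAddSubgroup) hp' (fun j => ?_) k
    obtain ⟨w, hw⟩ := hP j
    exact Scalar.mem_vanishing_iff.2 ⟨w, Scalar.ext hw⟩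
  · rw [h2]
    exact toShift_eq_zero_of_neg (fun j hj => Scalar.ext (h j hj)) hk

theorem toPseudoDiff_eq_eval {P : Op} (hP : ∀ k, P.coeff k ∈ Scalar.vanishing) (k : ℤ) :
    ∃ w : FieldFun, toPseudoDiff P k = FieldFun.eval w := by
  obtain ⟨p, hp⟩ := P.exists_bound
  obtain ⟨w, hw⟩ := Scalar.mem_vanishing_iff.1
    (toDiff_mem (S := Scalar.vanishing.toAddSubgroup) hp hP k)
  exact ⟨w, congrArg Subtype.val hw⟩

theorem toPseudoDiff_eq_zero {P : Op} {p k : ℤ} (hp : ∀ k, p < k → P.coeff k = 0) (hk : p < k) :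
    toPseudoDiff P k = 0 := congrArg Subtype.val (toDiff_eq_zero hp hk)

theorem toPseudoDiff_eq_zero_of_neg {P : Op} {k : ℤ} (hp : ∀ k < 0, P.coeff k = 0) (hk : k < 0) :
    toPseudoDiff P k = 0 := congrArg Subtype.val (toDiff_eq_zero_of_neg hp hk)

theorem toPseudoDiff_add (P Q : Op) :
    toPseudoDiff (P + Q) = toPseudoDiff P + toPseudoDiff Q := by
  obtain ⟨p, hp⟩ := P.exists_bound
  obtain ⟨q, hq⟩ := Q.exists_bound
  funext k
  exact congrArg Subtype.val (toDiff_add hp hq k)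

theorem toPseudoDiff_sub (P Q : Op) :
    toPseudoDiff (P - Q) = toPseudoDiff P - toPseudoDiff Q := by
  rw [eq_sub_iff_add_eq, ← toPseudoDiff_add, sub_add_cancel]

theorem toPseudoDiff_dx (P : Op) : PseudoDiff.dx (toPseudoDiff P) = toPseudoDiff (dx P) := by
  obtain ⟨p, hp⟩ := P.exists_bound
  funext k
  exact (congrArg Subtype.val (toDiff_map hp Scalar.dx k)).symm

theorem toPseudoDiff_gateaux (g : FieldFun) (P : Op) :
    PseudoDiff.gateaux (toPseudoDiff P) g = toPseudoDiff (gateaux g P) := by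
  obtain ⟨p, hp⟩ := P.exists_bound
  funext k
  exact (congrArg Subtype.val (toDiff_map hp (Scalar.gateaux g) k)).symm

theorem toPseudoDiff_C_mul (c : Scalar) (P : Op) (k : ℤ) :
    toPseudoDiff (C c * P) k = c.1 * toPseudoDiff P k := by
  obtain ⟨p, hp⟩ := P.exists_bound
  have := toDiff_map hp (AddMonoidHom.mulLeft c) k
  have h2 : (C c * P).coeff = fun j => AddMonoidHom.mulLeft c (P.coeff j) :=
    funext fun j => coeff_C_mul c P j
  rw [toPseudoDiff, h2, this]
  rfl

theorem toPseudoDiff_smul (r : ℝ) (P : Op) : toPseudoDiff (r • P) = r • toPseudoDiff P := by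
  funext k
  rw [smul_def, toPseudoDiff_C_mul]
  rfl

theorem toDiff_mul (P Q : Op) :
    toDiff (P * Q).coeff = mulDiff Scalar.shift (toDiff P.coeff) (toDiff Q.coeff) := by
  obtain ⟨p, hp⟩ := P.exists_bound
  obtain ⟨q, hq⟩ := Q.exists_bound
  have hp' : ∀ k, p < k → toDiff P.coeff k = 0 := fun k hk => toDiff_eq_zero hp hk
  have hq' : ∀ k, q < k → toDiff Q.coeff k = 0 := fun k hk => toDiff_eq_zero hq hk
  have h2 : toShift (mulDiff Scalar.shift (toDiff P.coeff) (toDiff Q.coeff)) = (P * Q).coeff := by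
    funext m
    rw [toShift_mulDiff hp' hq', toShift_toDiff hp, toShift_toDiff hq, coeff_mul,
      mulCoeff_eq_sum_Icc hp hq m le_rfl le_rfl]
  rw [← h2, toDiff_toShift fun k hk => mulDiff_eq_zero hp' hq' hk]

theorem toPseudoDiff_mul (P Q : Op) :
    PseudoDiff.mul (toPseudoDiff P) (toPseudoDiff Q) = toPseudoDiff (P * Q) := by
  have hdiff : ∀ (i : ℕ) (c : Scalar), Coeff.diff^[i] c.1 = ((differ Scalar.shift)^[i] c).1 := by
    intro i
    induction i with
    | zero => intro c; rfl
    | succ i ih =>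
      intro c
      rw [Function.iterate_succ_apply, Function.iterate_succ_apply, ← ih]
      rfl
  funext k
  rw [toPseudoDiff, toDiff_mul]
  -- Injectivity of the inclusion lets it pass through the `finsum` without a separate finiteness
  -- argument.
  let ν : Scalar →+ Coeff := coeffAlgebra.val.toRingHom.toAddMonoidHom
  refine Eq.trans ?_ (ν.map_finsum_of_injective Subtype.val_injective _).symm
  refine finsum_congr fun x => ?_
  refine Eq.trans ?_ (map_zsmul ν _ _).symm
  refine congrArg _ ?_
  change _ = toPseudoDiff P x.1 * ((differ Scalar.shift)^[x.2] _).1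
  rw [← hdiff, Scalar.shift_zpow_val]
  rfl

theorem toPseudoDiff_comm (P Q : Op) :
    PseudoDiff.comm (toPseudoDiff P) (toPseudoDiff Q) = toPseudoDiff ⁅P, Q⁆ := by
  rw [PseudoDiff.comm, toPseudoDiff_mul, toPseudoDiff_mul, ← toPseudoDiff_sub]
  rfl

/-- The difference operator `Δ = E - 1`. -/
def Δ : Op := E - 1

theorem toDiff_Δ : toDiff (Δ : Op).coeff = Pi.single 1 1 := by
  have h : (Δ : Op).coeff = toShift (Pi.single 1 1 : ℤ → Scalar) := by
    funext k
    rw [toShift_single_one_one, Δ, coeff_sub, coeff_one, E, coeff_single]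
  rw [h, toDiff_toShift (p := 1) fun k hk => Pi.single_eq_of_ne hk.ne' _]

theorem toPseudoDiff_C (c : Scalar) : toPseudoDiff (C c) = PseudoDiff.ofCoeff c.1 := by
  have h0 : ∀ k, 0 < k → (C c).coeff k = 0 := fun k hk => by rw [coeff_C, if_neg hk.ne']
  funext k
  rcases lt_trichotomy k 0 with hk | rfl | hk
  · rw [toPseudoDiff_eq_zero_of_neg (fun j hj => by rw [coeff_C, if_neg hj.ne]) hk,
      PseudoDiff.ofCoeff, Pi.single_eq_of_ne hk.ne]
  · rw [toPseudoDiff, toDiff_eq_sum h0 le_rfl le_rfl]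
    simp [coeff_C, binom, PseudoDiff.ofCoeff]
  · rw [toPseudoDiff_eq_zero h0 hk, PseudoDiff.ofCoeff, Pi.single_eq_of_ne hk.ne']

theorem toPseudoDiff_one : toPseudoDiff 1 = PseudoDiff.ofCoeff 1 := by
  rw [← map_one C, toPseudoDiff_C]
  rfl

theorem toPseudoDiff_pow (P : Op) (m : ℕ) :
    PseudoDiff.pow (toPseudoDiff P) m = toPseudoDiff (P ^ m) := by
  induction m with
  | zero => rw [pow_zero, toPseudoDiff_one]; rfl
  | succ m ih => rw [pow_succ, ← toPseudoDiff_mul, ← ih]; rfl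

theorem toDiff_Δ_pow (m : ℕ) : toDiff (Δ ^ m : Op).coeff = Pi.single (m : ℤ) 1 := by
  induction m with
  | zero =>
    funext k
    apply Scalar.ext
    refine (congrFun toPseudoDiff_one k).trans ?_
    rcases eq_or_ne k 0 with rfl | hk
    · rfl
    · rw [PseudoDiff.ofCoeff, Pi.single_eq_of_ne hk, Nat.cast_zero, Pi.single_eq_of_ne hk]
      rfl
  | succ m ih =>
    funext k
    rw [pow_succ, toDiff_mul, toDiff_Δ, mulDiff_single_one, ih, Nat.cast_succ]
    by_cases hk : k = m + 1
    · rw [hk, add_sub_cancel_right, Pi.single_eq_same, Pi.single_eq_same]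
    · rw [Pi.single_eq_of_ne hk, Pi.single_eq_of_ne (by omega)]

theorem toPseudoDiff_C_mul_Δ_pow (c : Scalar) (m : ℕ) :
    toPseudoDiff (C c * Δ ^ m) = Pi.single (m : ℤ) c.1 := by
  funext k
  rw [toPseudoDiff_C_mul, toPseudoDiff, toDiff_Δ_pow]
  by_cases hk : k = m
  · rw [hk, Pi.single_eq_same, Pi.single_eq_same]
    exact mul_one _
  · rw [Pi.single_eq_of_ne hk, Pi.single_eq_of_ne hk]
    exact mul_zero _

/-- Strictly negative powers of `E` expand into strictly negative powers of `Δ`, and non-negative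
ones into non-negative ones, so truncating in either basis gives the same operator. -/
theorem toPseudoDiff_posPart (P : Op) :
    toPseudoDiff (posPart P) = PseudoDiff.posPart (toPseudoDiff P) := by
  obtain ⟨p, hp⟩ := P.exists_bound
  have hneg : ∀ k, 0 ≤ k → (P - posPart P).coeff k = 0 := fun k hk => by
    rw [coeff_sub, coeff_posPart, if_pos hk, sub_self]
  have h := toPseudoDiff_sub P (posPart P)
  funext k
  rw [PseudoDiff.posPart]
  split_ifs with hk
  · have h0 : toPseudoDiff (P - posPart P) k = 0 :=
      congrArg Subtype.val (toDiff_eq_zero_of_nonneg hneg hk)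
    rw [h, Pi.sub_apply, sub_eq_zero] at h0
    exact h0.symm
  · exact toPseudoDiff_eq_zero_of_neg (fun j hj => by rw [coeff_posPart, if_neg (by omega)])
      (not_le.1 hk)

end Op

end DDKP

namespace DDKP

namespace Op

open SkewLaurent

/-! ### Operators that vanish at `u = 0` -/

/-- The operators whose coefficients vanish at `u = 0`. -/
def vanishing : Submodule ℝ Op where
  carrier := {P | ∀ k, P.coeff k ∈ Scalar.vanishing}
  add_mem' h1 h2 k := add_mem (h1 k) (h2 k)
  zero_mem' _ := zero_mem _
  smul_mem' r P h k := by
    rw [coeff_smul]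
    exact Scalar.vanishing.mul_mem_left _ (h k)

/-- With the next lemma, `vanishing` is a two-sided ideal; products, commutators and powers may then
be computed modulo it, that is at `u = 0`. -/
theorem mul_mem_vanishing (P : Op) {Q : Op} (hQ : Q ∈ vanishing) : P * Q ∈ vanishing :=
  mul_mem_of_right Scalar.shift_zpow_mem P hQ

theorem mul_mem_vanishing' {P : Op} (hP : P ∈ vanishing) (Q : Op) : P * Q ∈ vanishing :=
  mul_mem_of_left hP Q

theorem mul_sub_mul_mem {P P' Q Q' : Op} (hP : P - P' ∈ vanishing) (hQ : Q - Q' ∈ vanishing) :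
    P * Q - P' * Q' ∈ vanishing := by
  have : P * Q - P' * Q' = (P - P') * Q + P' * (Q - Q') := by noncomm_ring
  rw [this]
  exact add_mem (mul_mem_vanishing' hP Q) (mul_mem_vanishing P' hQ)

theorem lie_sub_lie_mem {P P' Q Q' : Op} (hP : P - P' ∈ vanishing) (hQ : Q - Q' ∈ vanishing) :
    ⁅P, Q⁆ - ⁅P', Q'⁆ ∈ vanishing := by
  rw [Ring.lie_def, Ring.lie_def, sub_sub_sub_comm]
  exact sub_mem (mul_sub_mul_mem hP hQ) (mul_sub_mul_mem hQ hP)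

theorem pow_sub_pow_mem {P P' : Op} (hP : P - P' ∈ vanishing) (m : ℕ) :
    P ^ m - P' ^ m ∈ vanishing := by
  induction m with
  | zero => simp
  | succ m ih => rw [pow_succ, pow_succ]; exact mul_sub_mul_mem ih hP

theorem gateaux_mem_vanishing (g : FieldFun) (P : Op) : gateaux g P ∈ vanishing :=
  fun _ => Scalar.gateaux_mem g _

theorem C_mem_vanishing (w : FieldFun) : C (Scalar.ofField w) ∈ vanishing := fun k => by
  rw [coeff_C]
  split_ifs
  · exact Scalar.ofField_mem w
  · exact zero_mem _

/-! ### Difference operators -/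

/-- `P` has no negative powers of `E`. -/
def IsDifference (P : Op) : Prop := ∀ k < 0, P.coeff k = 0

namespace IsDifference

variable {P Q : Op}

theorem add (hP : IsDifference P) (hQ : IsDifference Q) : IsDifference (P + Q) := fun k hk => by
  rw [coeff_add, hP k hk, hQ k hk, add_zero]

theorem sub (hP : IsDifference P) (hQ : IsDifference Q) : IsDifference (P - Q) := fun k hk => by
  rw [coeff_sub, hP k hk, hQ k hk, sub_zero]

theorem smul (r : ℝ) (hP : IsDifference P) : IsDifference (r • P) := fun k hk => by
  rw [coeff_smul, hP k hk, mul_zero]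

theorem gateaux (g : FieldFun) (hP : IsDifference P) : IsDifference (gateaux g P) := fun k hk => by
  rw [coeff_gateaux, hP k hk, map_zero]

theorem mul (hP : IsDifference P) (hQ : IsDifference Q) : IsDifference (P * Q) := fun k hk => by
  rw [coeff_mul, mulCoeff_eq_sum P Q k ∅ fun i _ => ?_, Finset.sum_empty]
  rcases lt_or_ge i 0 with h | h
  · exact Or.inl (hP i h)
  · exact Or.inr (hQ _ (by omega))

theorem coeff_mul_zero (hP : IsDifference P) (hQ : IsDifference Q) :
    (P * Q).coeff 0 = P.coeff 0 * Q.coeff 0 := by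
  rw [coeff_mul, mulCoeff_eq_sum P Q 0 {0} fun i hi => ?_, Finset.sum_singleton]
  · rfl
  · rw [Finset.mem_singleton] at hi
    rcases lt_or_gt_of_ne hi with h | h
    · exact Or.inl (hP i h)
    · exact Or.inr (hQ _ (by omega))

theorem lie (hP : IsDifference P) (hQ : IsDifference Q) : IsDifference ⁅P, Q⁆ :=
  (hP.mul hQ).sub (hQ.mul hP)

/-- Without negative powers of `E`, the coefficients at `E^0` multiply among themselves, and they
commute. -/
theorem coeff_lie_zero (hP : IsDifference P) (hQ : IsDifference Q) : ⁅P, Q⁆.coeff 0 = 0 := by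
  rw [Ring.lie_def, coeff_sub, hP.coeff_mul_zero hQ, hQ.coeff_mul_zero hP, mul_comm, sub_self]

end IsDifference

/-! ### The zero curvature equation -/

variable (h : ℝ)

/-- `A₁ = h⁻¹ Δ + u`. -/
def A₁ : Op := h⁻¹ • Δ + C (Scalar.ofField FieldFun.field)

theorem toPseudoDiff_A₁ : toPseudoDiff (A₁ h) = opA₁ h := by
  have := toPseudoDiff_C_mul_Δ_pow (Scalar.const h⁻¹) 1
  rw [pow_one] at this
  rw [A₁, toPseudoDiff_add, toPseudoDiff_C, smul_def, this]
  rfl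

/-- The operator `P_x - [A₁, P]`. -/
def zeroCurv (P : Op) : Op := dx P - ⁅A₁ h, P⁆

theorem zeroCurv_add (P Q : Op) : zeroCurv h (P + Q) = zeroCurv h P + zeroCurv h Q := by
  simp only [zeroCurv, map_add, Ring.lie_def, mul_add, add_mul]; abel

theorem zeroCurv_sub (P Q : Op) : zeroCurv h (P - Q) = zeroCurv h P - zeroCurv h Q := by
  simp only [zeroCurv, map_sub, Ring.lie_def, mul_sub, sub_mul]; abel

theorem zeroCurv_smul (r : ℝ) (P : Op) : zeroCurv h (r • P) = r • zeroCurv h P := by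
  simp only [zeroCurv, dx_smul, Ring.lie_def, mul_smul_comm, smul_mul_assoc, smul_sub]

theorem zeroCurv_mul (P Q : Op) : zeroCurv h (P * Q) = zeroCurv h P * Q + P * zeroCurv h Q := by
  simp only [zeroCurv, dx_mul, Ring.lie_def]; noncomm_ring

theorem zeroCurv_lie (P Q : Op) : zeroCurv h ⁅P, Q⁆ = ⁅zeroCurv h P, Q⁆ + ⁅P, zeroCurv h Q⁆ := by
  simp only [Ring.lie_def, zeroCurv_sub, zeroCurv_mul]; noncomm_ring

theorem zeroCurv_one : zeroCurv h 1 = 0 := by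
  have := zeroCurv_mul h 1 1
  simpa using this

theorem zeroCurv_pow {P : Op} (hP : zeroCurv h P = 0) (m : ℕ) : zeroCurv h (P ^ m) = 0 := by
  induction m with
  | zero => rw [pow_zero, zeroCurv_one]
  | succ m ih => rw [pow_succ, zeroCurv_mul, ih, hP, zero_mul, mul_zero, add_zero]

theorem gateaux_A₁ (g : FieldFun) : gateaux g (A₁ h) = C (Scalar.ofField g) := by
  ext1 k
  rw [coeff_gateaux, A₁, coeff_add, coeff_smul, map_add, Scalar.gateaux_mul, Scalar.gateaux_const,
    zero_mul, zero_add, coeff_C, coeff_C, Δ, coeff_sub, E, coeff_single, coeff_one]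
  have h1 : Scalar.gateaux g 1 = 0 := by rw [← map_one Scalar.const, Scalar.gateaux_const]
  have h2 : ∀ p q : Prop, [Decidable p] → [Decidable q] →
      Scalar.gateaux g ((if p then 1 else 0) - if q then 1 else 0) = 0 := fun p q _ _ => by
    rw [map_sub]
    split_ifs <;> simp [h1]
  rw [h2, mul_zero, zero_add]
  split_ifs
  · rw [Scalar.gateaux_ofField, FieldFun.gateaux_field]
  · rw [map_zero]

/-- The extra commutator comes from the dependence of `A₁` on `u`: its derivative along `g` is
multiplication by `g`. -/
theorem zeroCurv_gateaux (g : FieldFun) (P : Op) :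
    zeroCurv h (gateaux g P) = gateaux g (zeroCurv h P) + ⁅C (Scalar.ofField g), P⁆ := by
  simp only [zeroCurv, Ring.lie_def, map_sub, gateaux_mul, gateaux_dx, gateaux_A₁]
  noncomm_ring

/-- Only the degrees `k` and `k - 1` of `P` occur, the lower one under `h⁻¹ Δ`: the equation
determines the coefficients recursively from the top. -/
theorem coeff_zeroCurv (P : Op) (k : ℤ) : (zeroCurv h P).coeff k =
    Scalar.dx (P.coeff k) - (Scalar.const h⁻¹ * (Scalar.shift (P.coeff (k - 1)) - P.coeff (k - 1)) +
      (Scalar.ofField FieldFun.field - (Scalar.shift ^ k) (Scalar.ofField FieldFun.field)) *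
        P.coeff k) := by
  rw [zeroCurv, Ring.lie_def, A₁, add_mul, mul_add, smul_mul_assoc, mul_smul_comm, Δ, sub_mul,
    mul_sub, one_mul, mul_one]
  simp only [coeff_sub, coeff_add, coeff_smul, coeff_dx, coeff_E_mul, coeff_mul_E, coeff_C_mul,
    coeff_mul_C]
  ring

variable {h}

/-- A solution of the zero curvature equation that vanishes at `u = 0` vanishes. -/
theorem coeff_eq_zero_of_zeroCurv (hh : h ≠ 0) {Y : Op} (m : ℤ)
    (hY : ∀ k, m ≤ k → Y.coeff k ∈ Scalar.vanishing)
    (hz : ∀ k, m < k → (zeroCurv h Y).coeff k = 0) (k : ℤ) (hk : m ≤ k) : Y.coeff k = 0 := by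
  obtain ⟨p, hp⟩ := Y.exists_bound
  -- Descending induction from the order bound `p`: once degree `k + 1` is known to vanish, the
  -- curvature in degree `k + 1` reduces to `-h⁻¹ Δ Y_k`.
  have key : ∀ (i : ℕ) (k : ℤ), m ≤ k → p < k + i → Y.coeff k = 0 := by
    intro i
    induction i with
    | zero => intro k _ hpk; exact hp k (by omega)
    | succ i ih =>
      intro k hmk hpk
      have h1 := ih (k + 1) (by omega) (by push_cast at hpk; omega)
      have h2 := hz (k + 1) (by omega)
      rw [coeff_zeroCurv, h1, add_sub_cancel_right, map_zero, mul_zero, add_zero, zero_sub,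
        neg_eq_zero] at h2
      refine Scalar.eq_zero_of_shift_eq (hY k hmk) (sub_eq_zero.1 ?_)
      have h3 : Scalar.const h * Scalar.const h⁻¹ = 1 := by
        rw [← map_mul, mul_inv_cancel₀ hh, map_one]
      rw [← one_mul (_ - _), ← h3, mul_assoc, h2, mul_zero]
  exact key (p - k + 1).toNat k hk (by omega)

theorem eq_zero_of_zeroCurv (hh : h ≠ 0) {Y : Op} (hY : Y ∈ vanishing) (hz : zeroCurv h Y = 0) :
    Y = 0 := by
  ext1 k
  exact coeff_eq_zero_of_zeroCurv hh k (fun j _ => hY j) (fun j _ => by rw [hz]; rfl) k le_rfl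

/-- In degree zero there is no contribution from degree `-1`, and the factor `u - E^0 u` is zero;
only `∂ₓ P_0` is left. -/
theorem zeroCurv_eq_C {P : Op} (hP : IsDifference P)
    (hz : ∀ k, 1 ≤ k → (zeroCurv h P).coeff k = 0) :
    zeroCurv h P = C (Scalar.dx (P.coeff 0)) := by
  ext1 k
  rw [coeff_C]
  rcases lt_trichotomy k 0 with hk | rfl | hk
  · rw [if_neg hk.ne, coeff_zeroCurv, hP k hk, hP (k - 1) (by omega)]; simp
  · rw [if_pos rfl, coeff_zeroCurv, hP (0 - 1) (by omega)]; simp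
  · rw [if_neg hk.ne', hz k hk]

variable (h)

/-! ### The Lax operator -/

/-- The coefficient of `E ^ (-(j + 1))` in the Lax operator. -/
def laxCoeff : ℕ → FieldFun
  | 0 => h • FieldFun.invDiff (FieldFun.dx FieldFun.field)
  | j + 1 => h • FieldFun.invDiff (FieldFun.dx (laxCoeff j) -
      (FieldFun.field - FieldFun.shift (-((j : ℤ) + 1)) FieldFun.field) * laxCoeff j)

/-- The part of the Lax operator with negative powers of `E`. -/
def laxNeg : Op := mk (fun k => if k < 0 then Scalar.ofField (laxCoeff h (-k - 1).toNat) else 0) (-1)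
  fun k hk => if_neg (by omega)

theorem coeff_laxNeg (k : ℤ) : (laxNeg h).coeff k =
    if k < 0 then Scalar.ofField (laxCoeff h (-k - 1).toNat) else 0 := rfl

/-- The Lax operator. -/
def lax : Op := A₁ h + laxNeg h

theorem laxNeg_mem : laxNeg h ∈ vanishing := fun k => by
  rw [coeff_laxNeg]
  split_ifs
  · exact Scalar.ofField_mem _
  · exact zero_mem _

theorem const_inv_mul_shift_sub {f : FieldFun} (hh : h ≠ 0) :
    Scalar.const h⁻¹ * (Scalar.shift (Scalar.ofField (h • FieldFun.invDiff f)) -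
      Scalar.ofField (h • FieldFun.invDiff f)) = Scalar.ofField f := by
  rw [Scalar.shift_ofField, ← map_sub, ← Scalar.ofField_smul, ← FieldFun.diff_eq,
    map_smul FieldFun.diff,
    FieldFun.diff_invDiff, smul_smul, inv_mul_cancel₀ hh, one_smul]

/-- The recursion in `laxCoeff` is the vanishing of the curvature in degrees `k ≤ 0`. Its starting
value `h Δ⁻¹ u_x` cancels the curvature `u_x` of `A₁` in degree zero. -/
theorem zeroCurv_lax (hh : h ≠ 0) : zeroCurv h (lax h) = 0 := by
  have h1 : zeroCurv h (A₁ h) = C (Scalar.ofField (FieldFun.dx FieldFun.field)) := by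
    rw [zeroCurv, Ring.lie_def, sub_self, sub_zero]
    ext1 k
    rw [coeff_dx, A₁, coeff_add, coeff_smul, map_add, Scalar.dx_mul, Scalar.dx_const,
      zero_mul, zero_add, coeff_C, coeff_C, Δ, coeff_sub, E, coeff_single, coeff_one]
    have h1 : Scalar.dx 1 = 0 := by rw [← map_one Scalar.const, Scalar.dx_const]
    have h2 : ∀ p q : Prop, [Decidable p] → [Decidable q] →
        Scalar.dx ((if p then 1 else 0) - if q then 1 else 0) = 0 := fun p q _ _ => by
      rw [map_sub]
      split_ifs <;> simp [h1]
    rw [h2, mul_zero, zero_add]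
    split_ifs
    · rw [Scalar.dx_ofField]
    · rw [map_zero]
  rw [lax, zeroCurv_add, h1]
  ext1 k
  rw [coeff_add, coeff_C, coeff_zeroCurv, coeff_zero]
  rcases lt_trichotomy k 0 with hk | rfl | hk
  · obtain ⟨j, rfl⟩ : ∃ j : ℕ, k = -((j : ℤ) + 1) := ⟨(-k - 1).toNat, by omega⟩
    rw [if_neg hk.ne, coeff_laxNeg, coeff_laxNeg, if_pos hk, if_pos (by omega),
      show (-(-((j : ℤ) + 1)) - 1).toNat = j by omega,
      show (-(-((j : ℤ) + 1) - 1) - 1).toNat = j + 1 by omega, laxCoeff,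
      const_inv_mul_shift_sub h hh, Scalar.shift_zpow_ofField, Scalar.dx_ofField, map_sub,
      Scalar.ofField_mul, map_sub]
    ring
  · rw [if_pos rfl, coeff_laxNeg, coeff_laxNeg, if_neg (lt_irrefl 0), if_pos (by omega),
      show (-(0 - 1 : ℤ) - 1).toNat = 0 by omega, laxCoeff, const_inv_mul_shift_sub h hh, map_zero]
    ring
  · rw [if_neg hk.ne', coeff_laxNeg, coeff_laxNeg, if_neg (by omega), if_neg (by omega), map_zero,
      map_zero]
    ring

theorem zeroCurv_eq_zero_iff (P : Op) : zeroCurv h P = 0 ↔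
    PseudoDiff.dx (toPseudoDiff P) = PseudoDiff.comm (opA₁ h) (toPseudoDiff P) := by
  rw [← toPseudoDiff_A₁, toPseudoDiff_comm, toPseudoDiff_dx, toPseudoDiff_injective.eq_iff,
    zeroCurv, sub_eq_zero]

theorem opA₁_one : opA₁ h 1 = fun _ _ _ => h⁻¹ := by
  rw [opA₁, Pi.add_apply, PseudoDiff.ofCoeff, Pi.single_eq_same, Pi.single_eq_of_ne one_ne_zero,
    add_zero]

theorem opA₁_zero : opA₁ h 0 = FieldFun.eval FieldFun.field := by
  rw [opA₁, Pi.add_apply, PseudoDiff.ofCoeff, Pi.single_eq_same, Pi.single_eq_of_ne zero_ne_one,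
    zero_add]

theorem opA₁_of_ne {k : ℤ} (h0 : k ≠ 0) (h1 : k ≠ 1) : opA₁ h k = 0 := by
  rw [opA₁, Pi.add_apply, PseudoDiff.ofCoeff, Pi.single_eq_of_ne h1, Pi.single_eq_of_ne h0,
    add_zero]

theorem toPseudoDiff_laxNeg_of_nonneg {k : ℤ} (hk : 0 ≤ k) : toPseudoDiff (laxNeg h) k = 0 :=
  toPseudoDiff_eq_zero (p := -1) (fun j hj => if_neg (by omega)) (by omega)

theorem isLaxOperator_lax (hh : h ≠ 0) : IsLaxOperator h (toPseudoDiff (lax h)) := by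
  have hL : ∀ k, toPseudoDiff (lax h) k = opA₁ h k + toPseudoDiff (laxNeg h) k := fun k => by
    rw [lax, toPseudoDiff_add, toPseudoDiff_A₁]; rfl
  refine ⟨fun k hk => ?_, ?_, ?_, fun j hj => ?_, (zeroCurv_eq_zero_iff h _).1 (zeroCurv_lax h hh)⟩
  · rw [hL, opA₁_of_ne h (by omega) (by omega), toPseudoDiff_laxNeg_of_nonneg h (by omega), add_zero]
  · rw [hL, opA₁_one, toPseudoDiff_laxNeg_of_nonneg h (by omega), add_zero]
  · rw [hL, opA₁_zero, toPseudoDiff_laxNeg_of_nonneg h le_rfl, add_zero]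
  · obtain ⟨w, hw⟩ := toPseudoDiff_eq_eval (laxNeg_mem h) (-(j : ℤ))
    -- The normalisation `h^j u_j` of the coefficient at `Δ^(-j)` is divided out.
    refine ⟨(h ^ j)⁻¹ • w, ?_⟩
    rw [hL, opA₁_of_ne h (by omega) (by omega), zero_add, hw]
    funext u n x
    change _ = h ^ j * ((h ^ j)⁻¹ * FieldFun.eval w u n x)
    rw [mul_inv_cancel_left₀ (pow_ne_zero j hh)]

/-- The prescribed coefficients at `Δ` and `Δ^0` leave a remainder `L - A₁` in `𝓕`; hence the
difference from `lax h` vanishes at `u = 0` and has zero curvature. -/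
theorem eq_of_isLaxOperator (hh : h ≠ 0) {L : PseudoDiff} (hL : IsLaxOperator h L) :
    L = toPseudoDiff (lax h) := by
  obtain ⟨h2, h1, h0, hneg, hx⟩ := hL
  have hz : ∀ k, 0 ≤ k → (L - opA₁ h) k = 0 := fun k hk => by
    rw [Pi.sub_apply]
    rcases eq_or_ne k 0 with rfl | hk0
    · rw [h0, opA₁_zero, sub_self]
    rcases eq_or_ne k 1 with rfl | hk1
    · rw [h1, opA₁_one, sub_self]
    · rw [opA₁_of_ne h hk0 hk1, h2 k (by omega), sub_zero]
  obtain ⟨Q, hQ, hQv, -⟩ := exists_toPseudoDiff_eq_of_vanishing (P := L - opA₁ h) (p := 0)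
    (fun k hk => hz k hk.le) fun k => by
      rcases le_or_gt 0 k with hk | hk
      · exact ⟨0, hz k hk⟩
      · obtain ⟨w, hw⟩ := hneg (-k).toNat (by omega)
        rw [show (-((-k).toNat : ℤ)) = k by omega] at hw
        exact ⟨h ^ (-k).toNat • w, by
          rw [Pi.sub_apply, opA₁_of_ne h (by omega) (by omega), sub_zero, hw]; rfl⟩
  have hLQ : L = toPseudoDiff (A₁ h + Q) := by
    rw [toPseudoDiff_add, hQ, toPseudoDiff_A₁, add_sub_cancel]
  have hcurv : zeroCurv h (A₁ h + Q) = 0 := (zeroCurv_eq_zero_iff h _).2 (by rw [← hLQ]; exact hx)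
  have : A₁ h + Q - lax h = 0 := by
    refine eq_zero_of_zeroCurv hh ?_ (by rw [zeroCurv_sub, hcurv, zeroCurv_lax h hh, sub_zero])
    rw [lax, add_sub_add_left_eq_sub]
    exact sub_mem hQv (laxNeg_mem h)
  rw [hLQ, sub_eq_zero.1 this]

/-- The value `h⁻¹ Δ` of the Lax operator at `u = 0`. -/
def D : Op := h⁻¹ • Δ

theorem lax_sub_D_mem : lax h - D h ∈ vanishing := by
  have : lax h - D h = C (Scalar.ofField FieldFun.field) + laxNeg h := by
    rw [lax, A₁, D]; abel
  rw [this]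
  exact add_mem (C_mem_vanishing _) (laxNeg_mem h)

/-! ### The isospectral flows -/

/-- Recognises `(L^s)₊` without computing any power: it is the only difference operator with value
`D^s` at `u = 0` and no curvature in positive degrees. The flow is then `∂ₓ` of its coefficient at
`E^0`, from which the constant `r` drops out. -/
theorem isIsospectralFlow_of_zeroCurv (hh : h ≠ 0) (s : ℕ) {P : Op} (hP : IsDifference P)
    (hv : P - D h ^ s ∈ vanishing) (hz : ∀ k, 1 ≤ k → (zeroCurv h P).coeff k = 0) {γ : FieldFun}
    {r : ℝ} (hγ : P.coeff 0 = Scalar.ofField γ + Scalar.const r) :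
    IsIsospectralFlow h (toPseudoDiff (lax h)) s (FieldFun.dx γ) ∧
      ∀ γ', IsIsospectralFlow h (toPseudoDiff (lax h)) s (FieldFun.dx γ') → γ' = γ := by
  have hLs := pow_sub_pow_mem (lax_sub_D_mem h) s
  have hpos : IsDifference (posPart (lax h ^ s)) := fun k hk => by
    rw [coeff_posPart, if_neg (by omega)]
  -- The curvature in degree `k ≥ 1` involves only degrees `k` and `k - 1`, which the truncation of
  -- `L^s` leaves untouched.
  have hzpos : ∀ k, 1 ≤ k → (zeroCurv h (posPart (lax h ^ s))).coeff k = 0 := fun k hk => by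
    have := congrArg (fun Q : Op => Q.coeff k) (zeroCurv_pow h (zeroCurv_lax h hh) s)
    simp only [coeff_zeroCurv, coeff_zero] at this ⊢
    rw [coeff_posPart, coeff_posPart, if_pos (by omega), if_pos (by omega), this]
  have hPpos : P = posPart (lax h ^ s) := by
    rw [← sub_eq_zero]
    ext1 k
    rcases lt_or_ge k 0 with hk | hk
    · exact hP.sub hpos k hk
    · refine coeff_eq_zero_of_zeroCurv hh 0 (fun j hj => ?_) (fun j hj => ?_) k hk
      · rw [coeff_sub, coeff_posPart, if_pos hj]
        have := sub_mem (hv j) (hLs j)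
        rwa [coeff_sub, coeff_sub, sub_sub_sub_cancel_right] at this
      · rw [zeroCurv_sub, coeff_sub, hz j hj, hzpos j hj, sub_zero]
  have hA : opA (toPseudoDiff (lax h)) s = toPseudoDiff P := by
    rw [opA, toPseudoDiff_pow, ← toPseudoDiff_posPart, hPpos]
  have hiff : ∀ K, IsIsospectralFlow h (toPseudoDiff (lax h)) s K ↔ K = FieldFun.dx γ := fun K => by
    have hC : PseudoDiff.ofCoeff (FieldFun.eval K) = toPseudoDiff (C (Scalar.ofField K)) :=
      (toPseudoDiff_C (Scalar.ofField K)).symm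
    rw [IsIsospectralFlow, hA, ← toPseudoDiff_A₁, toPseudoDiff_comm, toPseudoDiff_dx,
      ← toPseudoDiff_sub, hC, toPseudoDiff_injective.eq_iff]
    change _ = zeroCurv h P ↔ _
    rw [zeroCurv_eq_C hP hz, hγ, map_add, Scalar.dx_const, add_zero, Scalar.dx_ofField]
    constructor
    · intro H
      have := congrArg (fun Q : Op => Q.coeff 0) H
      simp only [coeff_C, if_true] at this
      exact Scalar.ofField_injective this
    · rintro rfl; rfl
  exact ⟨(hiff _).2 rfl, fun γ' hγ' => FieldFun.dx_injective ((hiff _).1 hγ')⟩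

end Op

end DDKP

namespace DDKP

namespace Op

open SkewLaurent

variable (h : ℝ)

/-! ### The non-isospectral flows -/

/-- The operator `x E + h n`. -/
def M : Op := C Scalar.X * E + C (Scalar.const h * Scalar.N)

theorem M_eq : M h = C Scalar.X * Δ + C (Scalar.X + Scalar.const h * Scalar.N) := by
  rw [M, Δ, mul_sub, mul_one, map_add]; abel

theorem D_pow (j : ℕ) : D h ^ j = h⁻¹ ^ j • Δ ^ j := by rw [D, smul_pow]

theorem M_mul_D_pow (j : ℕ) : M h * D h ^ j = h⁻¹ ^ j • (C Scalar.X * Δ ^ (j + 1) +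
    C (Scalar.X + Scalar.const h * Scalar.N) * Δ ^ j) := by
  rw [D_pow, mul_smul_comm, M_eq, add_mul, mul_assoc, ← pow_succ']

theorem toPseudoDiff_M_mul_D_pow (j : ℕ) :
    toPseudoDiff (M h * D h ^ j) = asymptoticB h (j + 1) := by
  have hpow : h ^ (1 - ((j + 1 : ℕ) : ℤ)) = h⁻¹ ^ j := by
    rw [Nat.cast_succ, show (1 : ℤ) - (j + 1) = -(j : ℤ) by ring, zpow_neg, zpow_natCast, inv_pow]
  have hsmul : ∀ (k : ℤ) (r : ℝ) (c : Coeff),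
      (r • Pi.single k c : PseudoDiff) = Pi.single k (r • c) := fun k r c => by
    funext i
    rw [Pi.smul_apply]
    rcases eq_or_ne i k with rfl | hi
    · rw [Pi.single_eq_same, Pi.single_eq_same]
    · rw [Pi.single_eq_of_ne hi, Pi.single_eq_of_ne hi, smul_zero]
  rw [M_mul_D_pow, toPseudoDiff_smul, toPseudoDiff_add, toPseudoDiff_C_mul_Δ_pow,
    toPseudoDiff_C_mul_Δ_pow, smul_add, hsmul, hsmul, asymptoticB, hpow,
    show ((j + 1 : ℕ) : ℤ) - 1 = j by push_cast; ring]
  rfl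

theorem isDifference_E : IsDifference E := fun k hk => by
  rw [E, coeff_single, if_neg (by omega)]

theorem isDifference_C (c : Scalar) : IsDifference (C c) := fun k hk => by
  rw [coeff_C, if_neg hk.ne]

theorem isDifference_D : IsDifference (D h) :=
  ((isDifference_E.sub (by rw [← map_one C]; exact isDifference_C 1)).smul _)

theorem isDifference_M : IsDifference (M h) :=
  ((isDifference_C _).mul isDifference_E).add (isDifference_C _)

theorem isDifference_pow {P : Op} (hP : IsDifference P) (j : ℕ) : IsDifference (P ^ j) := by
  induction j with
  | zero => rw [pow_zero, ← map_one C]; exact isDifference_C 1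
  | succ j ih => rw [pow_succ]; exact ih.mul hP

theorem coeff_mul_eq_zero {P Q : Op} {p q : ℤ} (hp : ∀ k, p < k → P.coeff k = 0)
    (hq : ∀ k, q < k → Q.coeff k = 0) (k : ℤ) (hk : p + q < k) : (P * Q).coeff k = 0 := by
  rw [coeff_mul, mulCoeff_eq_sum P Q k ∅ fun i _ => ?_, Finset.sum_empty]
  by_cases hi : p < i
  · exact Or.inl (hp i hi)
  · exact Or.inr (hq _ (by omega))

theorem coeff_D_eq_zero (k : ℤ) (hk : 1 < k) : (D h).coeff k = 0 := by
  rw [D, coeff_smul, Δ, coeff_sub, E, coeff_single, coeff_one, if_neg (by omega),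
    if_neg (by omega), sub_zero, mul_zero]

theorem coeff_M_eq_zero (k : ℤ) (hk : 1 < k) : (M h).coeff k = 0 := by
  rw [M, coeff_add, coeff_C_mul, E, coeff_single, coeff_C, if_neg (by omega), if_neg (by omega),
    mul_zero, add_zero]

theorem coeff_D_pow_eq_zero (j : ℕ) : ∀ k : ℤ, (j : ℤ) < k → (D h ^ j).coeff k = 0 := by
  induction j with
  | zero => intro k hk; rw [pow_zero, coeff_one, if_neg (by omega)]
  | succ j ih =>
    intro k hk
    rw [pow_succ]
    exact coeff_mul_eq_zero ih (coeff_D_eq_zero h) k (by push_cast at hk; omega)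

theorem coeff_M_mul_D_pow_eq_zero (j : ℕ) (k : ℤ) (hk : (j : ℤ) + 1 < k) :
    (M h * D h ^ j).coeff k = 0 :=
  coeff_mul_eq_zero (coeff_M_eq_zero h) (coeff_D_pow_eq_zero h j) k (by omega)

variable {h}

/-- Here `h D + 1 = E`; the commutator arises from `E n = (n + 1) E`, while `x` commutes with `E`.
-/
theorem D_mul_M (hh : h ≠ 0) : D h * M h = M h * D h + (h • D h + 1) := by
  have hhD : h • D h + 1 = E := by
    rw [D, smul_smul, mul_inv_cancel₀ hh, one_smul, Δ, sub_add_cancel]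
  have hX : E * C Scalar.X = C Scalar.X * E := by
    ext1 k
    rw [coeff_E_mul, coeff_C_mul, coeff_C, E, coeff_single]
    by_cases hk : k = 1
    · rw [if_pos (by omega), if_pos hk, mul_one, Scalar.shift_X]
    · rw [if_neg (by omega), if_neg hk, mul_zero, map_zero]
  have hN : E * C (Scalar.const h * Scalar.N) = C (Scalar.const h * Scalar.N) * E + h • E := by
    ext1 k
    rw [coeff_E_mul, coeff_add, coeff_smul, coeff_C_mul, coeff_C, E, coeff_single]
    by_cases hk : k = 1
    · rw [if_pos (by omega), if_pos hk, map_mul, Scalar.shift_const, Scalar.shift_N]; ring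
    · rw [if_neg (by omega), if_neg hk, mul_zero, map_zero, mul_zero, add_zero]
  rw [hhD, D, M, smul_mul_assoc, mul_smul_comm, Δ, sub_mul, mul_add, ← mul_assoc, hX, hN, one_mul,
    mul_sub, mul_one, add_mul, mul_assoc]
  rw [← add_assoc, add_sub_right_comm, smul_add, smul_smul, inv_mul_cancel₀ hh, one_smul]

theorem D_pow_mul_M_mul_D (hh : h ≠ 0) (k : ℕ) : D h ^ k * M h * D h =
    M h * D h ^ (k + 1) + (k : ℝ) • (h • D h ^ (k + 1) + D h ^ k) := by
  induction k with
  | zero => simp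
  | succ k ih =>
    rw [pow_succ' (D h) k, mul_assoc, mul_assoc, ← mul_assoc (D h ^ k), ih, mul_add, ← mul_assoc,
      D_mul_M hh, mul_smul_comm, mul_add, mul_smul_comm, ← pow_succ', ← pow_succ', add_mul, mul_assoc,
      ← pow_succ', add_mul, one_mul, smul_mul_assoc, ← pow_succ', Nat.cast_succ, add_smul, one_smul]
    abel

/-- The Lax equation `[B, L] + h L^s + L^(s-1) = L'[σ]` at `u = 0`, with `s = k + 1`. -/
theorem lie_M_mul_D_pow_D (hh : h ≠ 0) (k : ℕ) :
    ⁅M h * D h ^ k, D h⁆ + h • D h ^ (k + 1) + D h ^ k = 0 := by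
  rw [Ring.lie_def, ← mul_assoc, D_mul_M hh, mul_assoc, ← pow_succ, add_mul, add_mul, one_mul,
    smul_mul_assoc, mul_assoc, ← pow_succ']
  abel

/-- The value at `u = 0` of the bracket with the second flow. The factor is `-1` at `k = 0`, which
serves `ω₂`, and `0` at `k = 1`, which breaks the recursion at `ω₃`. -/
theorem lie_M_mul_D_pow_M_mul_D (hh : h ≠ 0) (k : ℕ) : ⁅M h * D h ^ k, M h * D h ^ 1⁆ =
    ((k : ℝ) - 1) • (h • (M h * D h ^ (k + 1)) + M h * D h ^ k) := by
  rw [Ring.lie_def, pow_one, mul_assoc, ← mul_assoc (D h ^ k), D_pow_mul_M_mul_D hh, mul_assoc,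
    ← mul_assoc (D h), D_mul_M hh, add_mul, add_mul, one_mul, smul_mul_assoc, mul_assoc,
    ← pow_succ']
  simp only [mul_add, mul_smul_comm, sub_smul, one_smul, smul_add]
  abel

variable (h)

/-- `b` is the operator `B_{j+1}` of the non-isospectral Lax triad, and `∂ₓ ω` is its flow. -/
structure IsFlowOp (j : ℕ) (b : Op) (ω : FieldFun) : Prop where
  isDifference : IsDifference b
  asymptotic : b - M h * D h ^ j ∈ vanishing
  zeroCurv_eq_zero : ∀ k, 1 ≤ k → (zeroCurv h b).coeff k = 0
  coeff_zero : b.coeff 0 = Scalar.ofField ω + Scalar.const (h * (-h⁻¹) ^ j) * Scalar.N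

variable {h} {j : ℕ} {b : Op} {ω : FieldFun}

/-- The part of the coefficient at `E^0` outside `𝓕` is a multiple of `n`, which `∂ₓ` kills. -/
theorem IsFlowOp.zeroCurv_eq (H : IsFlowOp h j b ω) :
    zeroCurv h b = C (Scalar.ofField (FieldFun.dx ω)) := by
  rw [zeroCurv_eq_C H.isDifference H.zeroCurv_eq_zero, H.coeff_zero, map_add, Scalar.dx_mul,
    Scalar.dx_const, Scalar.dx_N, zero_mul, mul_zero, add_zero, add_zero, Scalar.dx_ofField]

/-- The order bound need not be assumed: above degree `j + 1` the operator `M D^j` is zero, so `b`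
vanishes there at `u = 0` and the uniqueness principle applies. -/
theorem IsFlowOp.coeff_eq_zero (hh : h ≠ 0) (H : IsFlowOp h j b ω) (k : ℤ) (hk : (j : ℤ) + 1 < k) :
    b.coeff k = 0 := by
  refine coeff_eq_zero_of_zeroCurv hh (j + 2) (fun i hi => ?_)
    (fun i hi => H.zeroCurv_eq_zero i (by omega)) k (by omega)
  have := H.asymptotic i
  rwa [coeff_sub, coeff_M_mul_D_pow_eq_zero h j i (by omega), sub_zero] at this

/-- Both sides have curvature `[σ, L]` and both vanish at `u = 0`, the right-hand side by
`lie_M_mul_D_pow_D`; so they coincide. -/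
theorem IsFlowOp.lax_equation (hh : h ≠ 0) (H : IsFlowOp h j b ω) :
    gateaux (FieldFun.dx ω) (lax h) = ⁅b, lax h⁆ + h • lax h ^ (j + 1) + lax h ^ j := by
  have hL := lax_sub_D_mem h
  rw [← sub_eq_zero]
  refine eq_zero_of_zeroCurv hh ?_ ?_
  · have h1 : ⁅b, lax h⁆ + h • lax h ^ (j + 1) + lax h ^ j =
        (⁅b, lax h⁆ - ⁅M h * D h ^ j, D h⁆) + h • (lax h ^ (j + 1) - D h ^ (j + 1)) +
          (lax h ^ j - D h ^ j) := by
      rw [← sub_zero (_ + _), ← lie_M_mul_D_pow_D hh j, smul_sub]; abel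
    rw [h1]
    exact sub_mem (gateaux_mem_vanishing _ _) (add_mem (add_mem (lie_sub_lie_mem H.asymptotic hL)
      (vanishing.smul_mem h (pow_sub_pow_mem hL _))) (pow_sub_pow_mem hL _))
  · rw [zeroCurv_sub, zeroCurv_add, zeroCurv_add, zeroCurv_smul, zeroCurv_pow h (zeroCurv_lax h hh),
      zeroCurv_pow h (zeroCurv_lax h hh), zeroCurv_gateaux, zeroCurv_lie, zeroCurv_lax h hh,
      H.zeroCurv_eq, map_zero]
    simp [Ring.lie_def]

theorem IsFlowOp.isNonisospectralFlow (hh : h ≠ 0) (H : IsFlowOp h j b ω) :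
    IsNonisospectralFlow h (toPseudoDiff (lax h)) (j + 1) (toPseudoDiff b) (FieldFun.dx ω) ∧
      ∀ B' σ', IsNonisospectralFlow h (toPseudoDiff (lax h)) (j + 1) B' σ' →
        B' = toPseudoDiff b ∧ σ' = FieldFun.dx ω := by
  have hofC : ∀ σ : FieldFun, PseudoDiff.ofCoeff (FieldFun.eval σ) =
      toPseudoDiff (C (Scalar.ofField σ)) := fun σ => (toPseudoDiff_C (Scalar.ofField σ)).symm
  have hzc : ∀ (P : Op) (σ : FieldFun), PseudoDiff.ofCoeff (FieldFun.eval σ) =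
      PseudoDiff.dx (toPseudoDiff P) - PseudoDiff.comm (opA₁ h) (toPseudoDiff P) ↔
        C (Scalar.ofField σ) = zeroCurv h P := fun P σ => by
    rw [hofC, ← toPseudoDiff_A₁, toPseudoDiff_comm, toPseudoDiff_dx, ← toPseudoDiff_sub,
      toPseudoDiff_injective.eq_iff]
    rfl
  refine ⟨⟨fun k hk => ?_, fun k => ?_, ?_, (hzc _ _).2 H.zeroCurv_eq.symm⟩, fun B' σ' H' => ?_⟩
  · rcases hk with hk | hk
    · exact toPseudoDiff_eq_zero_of_neg H.isDifference hk
    · exact toPseudoDiff_eq_zero (p := j + 1) (H.coeff_eq_zero hh) (by push_cast at hk; omega)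
  · obtain ⟨w, hw⟩ := toPseudoDiff_eq_eval H.asymptotic k
    refine ⟨w, ?_⟩
    rw [← hw, toPseudoDiff_sub, toPseudoDiff_M_mul_D_pow, Pi.sub_apply, add_sub_cancel]
  · rw [toPseudoDiff_gateaux, toPseudoDiff_comm, toPseudoDiff_pow, toPseudoDiff_pow,
      ← toPseudoDiff_smul, ← toPseudoDiff_add, ← toPseudoDiff_add, H.lax_equation hh,
      Nat.add_sub_cancel]
  · obtain ⟨h1, h2, -, h4⟩ := H'
    have hasym : ∀ k, k < 0 ∨ ((j + 1 : ℕ) : ℤ) < k → asymptoticB h (j + 1) k = 0 := fun k hk => by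
      rw [asymptoticB, Pi.add_apply, Pi.single_eq_of_ne (by omega), Pi.single_eq_of_ne (by omega),
        add_zero]
    obtain ⟨Q, hQ, hQv, -, hQ0⟩ := exists_toPseudoDiff_eq_of_vanishing
      (P := B' - asymptoticB h (j + 1)) (p := ((j + 1 : ℕ) : ℤ))
      (fun k hk => by rw [Pi.sub_apply, h1 k (Or.inr hk), hasym k (Or.inr hk), sub_zero])
      fun k => by
        obtain ⟨w, hw⟩ := h2 k
        exact ⟨w, by rw [Pi.sub_apply, hw, add_sub_cancel_left]⟩
    replace hQ0 := hQ0 fun k hk => by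
      rw [Pi.sub_apply, h1 k (Or.inl hk), hasym k (Or.inl hk), sub_zero]
    have hB : B' = toPseudoDiff (M h * D h ^ j + Q) := by
      rw [toPseudoDiff_add, hQ, toPseudoDiff_M_mul_D_pow, add_sub_cancel]
    rw [hB, hzc] at h4
    have hd : IsDifference (M h * D h ^ j + Q) :=
      ((isDifference_M h).mul (isDifference_pow (isDifference_D h) j)).add hQ0
    -- The competitor and `b` agree at `u = 0` and are curved in degree zero only, so they agree in
    -- all degrees `≥ 0`; neither has negative degrees. The competitor's Lax equation plays no role.
    have hEq : M h * D h ^ j + Q = b := by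
      rw [← sub_eq_zero]
      ext1 k
      rcases lt_or_ge k 0 with hk | hk
      · exact hd.sub H.isDifference k hk
      · refine coeff_eq_zero_of_zeroCurv hh 0 (fun i _ => ?_) (fun i hi => ?_) k hk
        · have : M h * D h ^ j + Q - b ∈ vanishing := by
            rw [← neg_mem_iff, show -(M h * D h ^ j + Q - b) = b - M h * D h ^ j - Q by abel]
            exact sub_mem H.asymptotic hQv
          exact this i
        · rw [zeroCurv_sub, ← h4, H.zeroCurv_eq, coeff_sub, coeff_C, coeff_C, if_neg hi.ne',
            if_neg hi.ne', sub_zero]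
    refine ⟨by rw [hB, hEq], Scalar.ofField_injective ?_⟩
    rw [hEq, H.zeroCurv_eq] at h4
    have := congrArg (fun Q : Op => Q.coeff 0) h4
    simpa only [coeff_C, if_true] using this

/-! ### The recursion -/

/-- The bracket of the flows of two operators. -/
def flowBracket (b b' : Op) (ω ω' : FieldFun) : Op :=
  gateaux (FieldFun.dx ω') b - gateaux (FieldFun.dx ω) b' + ⁅b, b'⁆

variable {b₂ : Op} {ω₂ : FieldFun}

/-- The commutators produced by differentiating `b` and `b₂` cancel those from the curvature of `[b,
b₂]`, leaving the commutator of the two flows, a multiplication operator. -/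
theorem zeroCurv_flowBracket (H : IsFlowOp h j b ω) (H₂ : IsFlowOp h 1 b₂ ω₂) (k : ℤ)
    (hk : 1 ≤ k) : (zeroCurv h (flowBracket b b₂ ω ω₂)).coeff k = 0 := by
  have : zeroCurv h (flowBracket b b₂ ω ω₂) =
      gateaux (FieldFun.dx ω₂) (C (Scalar.ofField (FieldFun.dx ω))) -
        gateaux (FieldFun.dx ω) (C (Scalar.ofField (FieldFun.dx ω₂))) := by
    rw [flowBracket, zeroCurv_add, zeroCurv_sub, zeroCurv_gateaux, zeroCurv_gateaux, zeroCurv_lie,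
      H.zeroCurv_eq, H₂.zeroCurv_eq]
    simp only [Ring.lie_def]
    abel
  rw [this, coeff_sub, coeff_gateaux, coeff_gateaux, coeff_C, coeff_C, if_neg (by omega),
    if_neg (by omega), map_zero, map_zero, sub_zero]

theorem isDifference_flowBracket (H : IsFlowOp h j b ω) (H₂ : IsFlowOp h 1 b₂ ω₂) :
    IsDifference (flowBracket b b₂ ω ω₂) :=
  ((H.isDifference.gateaux _).sub (H₂.isDifference.gateaux _)).add
    (H.isDifference.lie H₂.isDifference)

/-- `[b, b₂]` contributes nothing at `E^0`, and the multiples of `n` have zero derivative; what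
remains is the bracket of gradients matched by `Sym.isGradient_inner`. -/
theorem coeff_zero_flowBracket (H : IsFlowOp h j b ω) (H₂ : IsFlowOp h 1 b₂ ω₂) :
    (flowBracket b b₂ ω ω₂).coeff 0 = Scalar.ofField
      (FieldFun.gateaux ω (FieldFun.dx ω₂) - FieldFun.gateaux ω₂ (FieldFun.dx ω)) := by
  rw [flowBracket, coeff_add, H.isDifference.coeff_lie_zero H₂.isDifference, coeff_sub,
    coeff_gateaux, coeff_gateaux, H.coeff_zero, H₂.coeff_zero]
  simp only [map_add, map_sub, Scalar.gateaux_mul, Scalar.gateaux_const, Scalar.gateaux_N,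
    zero_mul, mul_zero, add_zero, Scalar.gateaux_ofField]

theorem flowBracket_asymptotic (hh : h ≠ 0) (H : IsFlowOp h j b ω) (H₂ : IsFlowOp h 1 b₂ ω₂) :
    flowBracket b b₂ ω ω₂ - ((j : ℝ) - 1) • (h • (M h * D h ^ (j + 1)) + M h * D h ^ j) ∈
      vanishing := by
  rw [← lie_M_mul_D_pow_M_mul_D hh, flowBracket, add_sub_assoc]
  exact add_mem (sub_mem (gateaux_mem_vanishing _ _) (gateaux_mem_vanishing _ _))
    (lie_sub_lie_mem H.asymptotic H₂.asymptotic)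

/-- At `u = 0` the bracket divided by `j - 1` is `h M D^(j+1) + M D^j`; subtracting `b` and dividing
by `h` leaves `M D^(j+1)`. -/
theorem IsFlowOp.succ (hh : h ≠ 0) (hj : (j : ℝ) - 1 ≠ 0) (H : IsFlowOp h j b ω)
    (H₂ : IsFlowOp h 1 b₂ ω₂) :
    IsFlowOp h (j + 1) (h⁻¹ • (((j : ℝ) - 1)⁻¹ • flowBracket b b₂ ω ω₂ - b))
      (h⁻¹ • (((j : ℝ) - 1)⁻¹ • (FieldFun.gateaux ω (FieldFun.dx ω₂) -
        FieldFun.gateaux ω₂ (FieldFun.dx ω)) - ω)) where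
  isDifference := (((isDifference_flowBracket H H₂).smul _).sub H.isDifference).smul _
  asymptotic := by
    have : h⁻¹ • (((j : ℝ) - 1)⁻¹ • flowBracket b b₂ ω ω₂ - b) - M h * D h ^ (j + 1) =
        h⁻¹ • (((j : ℝ) - 1)⁻¹ • (flowBracket b b₂ ω ω₂ -
          ((j : ℝ) - 1) • (h • (M h * D h ^ (j + 1)) + M h * D h ^ j)) - (b - M h * D h ^ j)) := by
      rw [smul_sub ((j : ℝ) - 1)⁻¹, smul_smul ((j : ℝ) - 1)⁻¹, inv_mul_cancel₀ hj, one_smul]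
      simp only [smul_sub, smul_add, smul_smul h⁻¹ h, inv_mul_cancel₀ hh, one_smul]
      abel
    rw [this]
    exact vanishing.smul_mem _ (sub_mem (vanishing.smul_mem _ (flowBracket_asymptotic hh H H₂))
      H.asymptotic)
  zeroCurv_eq_zero k hk := by
    rw [zeroCurv_smul, zeroCurv_sub, zeroCurv_smul, coeff_smul, coeff_sub, coeff_smul,
      zeroCurv_flowBracket H H₂ k hk, H.zeroCurv_eq_zero k hk, mul_zero, sub_zero, mul_zero]
  coeff_zero := by
    rw [coeff_smul, coeff_sub, coeff_smul, coeff_zero_flowBracket H H₂, H.coeff_zero,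
      pow_succ]
    simp only [map_sub, Scalar.ofField_smul, map_mul, map_neg]
    ring

/-- The relation between the gradients of the first two flows. -/
theorem gateaux_sub_gateaux_eq {b₁ : Op} {ω₁ : FieldFun} (hh : h ≠ 0) (H₁ : IsFlowOp h 0 b₁ ω₁)
    (H₂ : IsFlowOp h 1 b₂ ω₂) :
    FieldFun.gateaux ω₁ (FieldFun.dx ω₂) - FieldFun.gateaux ω₂ (FieldFun.dx ω₁) =
      -(h • ω₂ + ω₁) := by
  -- For `j = 0` the value of the bracket at `u = 0` is `-(h M D + M)`, so this sum vanishes there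
  -- and has no curvature in positive degrees.
  have h0 : (flowBracket b₁ b₂ ω₁ ω₂ + (h • b₂ + b₁)).coeff 0 = 0 := by
    refine coeff_eq_zero_of_zeroCurv hh 0 (fun k _ => ?_) (fun k hk => ?_) 0 le_rfl
    · have h1 := flowBracket_asymptotic hh H₁ H₂
      have : flowBracket b₁ b₂ ω₁ ω₂ + (h • b₂ + b₁) =
          flowBracket b₁ b₂ ω₁ ω₂ -
            (((0 : ℕ) : ℝ) - 1) • (h • (M h * D h ^ (0 + 1)) + M h * D h ^ 0) +
          (h • (b₂ - M h * D h ^ 1) + (b₁ - M h * D h ^ 0)) := by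
        rw [Nat.cast_zero, zero_sub, neg_smul, one_smul, zero_add, smul_sub]
        abel
      rw [this]
      exact add_mem h1 (add_mem (vanishing.smul_mem h H₂.asymptotic) H₁.asymptotic) k
    · rw [zeroCurv_add, zeroCurv_add, zeroCurv_smul, coeff_add, coeff_add, coeff_smul,
        zeroCurv_flowBracket H₁ H₂ k hk, H₂.zeroCurv_eq_zero k hk, H₁.zeroCurv_eq_zero k hk,
        mul_zero, add_zero, add_zero]
  rw [coeff_add, coeff_add, coeff_smul, coeff_zero_flowBracket H₁ H₂, H₁.coeff_zero,
    H₂.coeff_zero] at h0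
  have hc : Scalar.const h * Scalar.const h⁻¹ = 1 := by
    rw [← map_mul, mul_inv_cancel₀ hh, map_one]
  rw [eq_neg_iff_add_eq_zero]
  apply Scalar.ofField_injective
  rw [map_add, map_add, Scalar.ofField_smul, map_zero, ← h0]
  simp only [pow_zero, pow_one, map_mul, map_neg, mul_one]
  linear_combination (Scalar.const h * Scalar.N) * hc

end Op

end DDKP

namespace DDKP

/-! ### The explicit gradients -/

section Gradients

open FieldFun

variable (h : ℝ)

/-- The gradient `γ₂` of the second isospectral flow. -/
def gamma₂ : FieldFun :=
  dx field + (2 : ℝ) • invDiff (dx field) - (2 * h⁻¹) • field + field * field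

/-- The gradient `γ₃` of the third isospectral flow. -/
def gamma₃ : FieldFun :=
  (dx (dx field) + (3 : ℝ) • invDiff (dx (dx field)) + (3 : ℝ) • invDiff (invDiff (dx (dx field))))
    - (3 * h⁻¹) • (dx field + (2 : ℝ) • invDiff (dx field)) + (3 * h⁻¹ ^ 2) • field
    + (3 : ℝ) • (field * dx field + field * invDiff (dx field) + invDiff (field * dx field))
    - (3 * h⁻¹) • (field * field) + field * field * field

/-- The gradient `ω₁`. -/
def omega₁ : FieldFun := h • mulX field

/-- The gradient `ω₂`. -/
def omega₂ : FieldFun :=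
  h • mulX (gamma₂ h) + (mulX field + h • mulN field) + h • invDiff field

/-- The gradient `ω₃`. -/
def omega₃ : FieldFun :=
  h • mulX (gamma₃ h) + (mulX (gamma₂ h) + h • mulN (gamma₂ h))
    + (2 * h) • invDiff (invDiff (dx field)) + h • invDiff (field * field)
    + h • (field * invDiff field) - (2 : ℝ) • invDiff field

end Gradients

namespace Scalar

theorem shift_ofField_invDiff (f : FieldFun) :
    shift (ofField (FieldFun.invDiff f)) = ofField (FieldFun.invDiff f) + ofField f := by
  rw [shift_ofField, FieldFun.shift_invDiff, map_add]

theorem dx_shift (a : Scalar) : dx (shift a) = shift (dx a) := by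
  have := dx_shift_zpow 1 a
  rwa [zpow_one] at this

end Scalar

/-! ### Difference operators of order at most three -/

namespace Op

open SkewLaurent

/-- The difference operator `c₀ + c₁ E + c₂ E² + c₃ E³`. -/
def cubic (c₀ c₁ c₂ c₃ : Scalar) : Op := C c₀ + C c₁ * E + C c₂ * E ^ 2 + C c₃ * E ^ 3

theorem E_pow (j : ℕ) : (E ^ j : Op) = single (j : ℤ) 1 := by
  induction j with
  | zero => rfl
  | succ j ih => rw [pow_succ, ih, E, single_mul_single, map_one, mul_one, Nat.cast_succ]

theorem coeff_cubic (c₀ c₁ c₂ c₃ : Scalar) (k : ℤ) : (cubic c₀ c₁ c₂ c₃).coeff k =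
    if k = 0 then c₀ else if k = 1 then c₁ else if k = 2 then c₂ else if k = 3 then c₃ else 0 := by
  rw [cubic, E_pow, E_pow, E]
  simp only [coeff_add, coeff_C_mul, coeff_C, coeff_single]
  push_cast
  split_ifs <;> first | omega | simp

theorem isDifference_cubic (c₀ c₁ c₂ c₃ : Scalar) : IsDifference (cubic c₀ c₁ c₂ c₃) :=
  fun k hk => by
    rw [coeff_cubic, if_neg (by omega), if_neg (by omega), if_neg (by omega), if_neg (by omega)]

theorem cubic_sub_cubic_mem {c₀ c₁ c₂ c₃ d₀ d₁ d₂ d₃ : Scalar} (h₀ : c₀ - d₀ ∈ Scalar.vanishing)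
    (h₁ : c₁ - d₁ ∈ Scalar.vanishing) (h₂ : c₂ - d₂ ∈ Scalar.vanishing)
    (h₃ : c₃ - d₃ ∈ Scalar.vanishing) : cubic c₀ c₁ c₂ c₃ - cubic d₀ d₁ d₂ d₃ ∈ vanishing := by
  intro k
  rw [coeff_sub, coeff_cubic, coeff_cubic]
  split_ifs
  · exact h₀
  · exact h₁
  · exact h₂
  · exact h₃
  · rw [sub_zero]; exact zero_mem _

variable {h : ℝ}

/-- The four conditions are the vanishing of the curvature at `E^4`, `E^3`, `E^2` and `E`, in this
order. -/
theorem zeroCurv_cubic {c₀ c₁ c₂ c₃ U : Scalar} (hU : U = Scalar.ofField FieldFun.field)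
    (h₃ : Scalar.shift c₃ = c₃)
    (h₂ : Scalar.dx c₃ = Scalar.const h⁻¹ * (Scalar.shift c₂ - c₂) +
      (U - Scalar.shift (Scalar.shift (Scalar.shift U))) * c₃)
    (h₁ : Scalar.dx c₂ = Scalar.const h⁻¹ * (Scalar.shift c₁ - c₁) +
      (U - Scalar.shift (Scalar.shift U)) * c₂)
    (h₀ : Scalar.dx c₁ = Scalar.const h⁻¹ * (Scalar.shift c₀ - c₀) + (U - Scalar.shift U) * c₁)
    (k : ℤ) (hk : 1 ≤ k) : (zeroCurv h (cubic c₀ c₁ c₂ c₃)).coeff k = 0 := by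
  rw [coeff_zeroCurv, ← hU, sub_eq_zero]
  rcases eq_or_ne k 1 with rfl | hk1
  · simpa [coeff_cubic] using h₀
  rcases eq_or_ne k 2 with rfl | hk2
  · have : (Scalar.shift ^ (2 : ℤ)) U = Scalar.shift (Scalar.shift U) := rfl
    rw [this]
    simpa [coeff_cubic] using h₁
  rcases eq_or_ne k 3 with rfl | hk3
  · have : (Scalar.shift ^ (3 : ℤ)) U = Scalar.shift (Scalar.shift (Scalar.shift U)) := rfl
    rw [this]
    simpa [coeff_cubic] using h₂
  rcases eq_or_ne k 4 with rfl | hk4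
  · simp [coeff_cubic, h₃]
  · have h1 : ∀ i : ℤ, i = k ∨ i = k - 1 → (cubic c₀ c₁ c₂ c₃).coeff i = 0 := fun i hi => by
      rw [coeff_cubic, if_neg (by omega), if_neg (by omega), if_neg (by omega), if_neg (by omega)]
    rw [h1 k (Or.inl rfl), h1 (k - 1) (Or.inr rfl)]
    simp

theorem D_pow_two : D h ^ 2 = cubic (Scalar.const h⁻¹ ^ 2) (-(2 * Scalar.const h⁻¹ ^ 2))
    (Scalar.const h⁻¹ ^ 2) 0 := by
  rw [D_pow, smul_def, Δ, cubic]
  simp only [map_pow, map_mul, map_neg, map_ofNat, map_zero]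
  noncomm_ring

theorem D_pow_three : D h ^ 3 = cubic (-Scalar.const h⁻¹ ^ 3) (3 * Scalar.const h⁻¹ ^ 3)
    (-(3 * Scalar.const h⁻¹ ^ 3)) (Scalar.const h⁻¹ ^ 3) := by
  rw [D_pow, smul_def, Δ, cubic]
  simp only [map_pow, map_mul, map_neg, map_ofNat]
  noncomm_ring

theorem M_mul_D_pow_zero :
    M h * D h ^ 0 = cubic (Scalar.const h * Scalar.N) Scalar.X 0 0 := by
  rw [pow_zero, mul_one, M, cubic, map_zero]
  noncomm_ring

theorem M_mul_D_pow_one : M h * D h ^ 1 =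
    cubic (Scalar.const h⁻¹ * -(Scalar.const h * Scalar.N))
      (Scalar.const h⁻¹ * (Scalar.const h * Scalar.N - Scalar.X))
      (Scalar.const h⁻¹ * Scalar.X) 0 := by
  rw [D_pow, mul_smul_comm, smul_def, Δ, M, cubic]
  simp only [map_pow, map_mul, map_neg, map_sub, map_zero]
  noncomm_ring

theorem M_mul_D_pow_two : M h * D h ^ 2 =
    cubic (Scalar.const h⁻¹ ^ 2 * (Scalar.const h * Scalar.N))
      (Scalar.const h⁻¹ ^ 2 * (Scalar.X - 2 * (Scalar.const h * Scalar.N)))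
      (Scalar.const h⁻¹ ^ 2 * (Scalar.const h * Scalar.N - 2 * Scalar.X))
      (Scalar.const h⁻¹ ^ 2 * Scalar.X) := by
  rw [D_pow, mul_smul_comm, smul_def, Δ, M, cubic]
  simp only [map_pow, map_mul, map_sub, map_ofNat]
  noncomm_ring

end Op

end DDKP

/-! ### The explicit operators `A₂`, `A₃`, `B₁`, `B₂`, `B₃` -/

namespace DDKP

namespace Scalar

theorem dx_sq (a : Scalar) : dx (a ^ 2) = 2 * a * dx a := by
  rw [pow_two, dx_mul]; ring

theorem dx_const_pow (r : ℝ) (m : ℕ) : dx (const r ^ m) = 0 := by rw [← map_pow, dx_const]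

theorem dx_two : dx 2 = 0 := by
  rw [← map_ofNat const 2, dx_const]

theorem dx_three : dx 3 = 0 := by
  rw [← map_ofNat const 3, dx_const]

end Scalar

namespace Op

variable (h : ℝ)

open Scalar in
/-- The operator `A₂`. -/
def opTwo : Op :=
  cubic (ofField (gamma₂ h) + const h⁻¹ ^ 2)
    (const h⁻¹ * (ofField .field + shift (ofField .field) - 2 * const h⁻¹)) (const h⁻¹ ^ 2) 0

open Scalar in
/-- The coefficient of `E` in the operator `A₃`. -/
def opThreeCoeff : Scalar :=
  3 * ofField (.invDiff (.dx .field)) + 2 * ofField (.dx .field) +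
    shift (ofField (.dx .field)) + (ofField .field - const h⁻¹) ^ 2 +
    (ofField .field - const h⁻¹) * (shift (ofField .field) - const h⁻¹) +
    (shift (ofField .field) - const h⁻¹) ^ 2

open Scalar in
/-- The operator `A₃`. -/
def opThree : Op :=
  cubic (ofField (gamma₃ h) - const h⁻¹ ^ 3) (const h⁻¹ * opThreeCoeff h)
    (const h⁻¹ ^ 2 * (ofField .field + shift (ofField .field) + shift (shift (ofField .field)) -
      3 * const h⁻¹)) (const h⁻¹ ^ 3)

/-- Collects the terms with a factor `h`, against which the `h⁻¹` of the curvature equation cancels;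
likewise for `ω₃` below. -/
theorem omega₂_eq : omega₂ h = h • (FieldFun.mulX (gamma₂ h) + FieldFun.mulN FieldFun.field +
    FieldFun.invDiff FieldFun.field) + FieldFun.mulX FieldFun.field := by
  rw [omega₂]; module

theorem omega₃_eq : omega₃ h = h • (FieldFun.mulX (gamma₃ h) + FieldFun.mulN (gamma₂ h) +
    (2 : ℝ) • FieldFun.invDiff (FieldFun.invDiff (FieldFun.dx FieldFun.field)) +
    FieldFun.invDiff (FieldFun.field * FieldFun.field) +
    FieldFun.field * FieldFun.invDiff FieldFun.field) +
    (FieldFun.mulX (gamma₂ h) - (2 : ℝ) • FieldFun.invDiff FieldFun.field) := by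
  rw [omega₃]; module

open Scalar in
/-- The operator `B₁`. -/
def flowOne : Op := cubic (ofField (omega₁ h) + const h * N) X 0 0

open Scalar in
/-- The operator `B₂`. -/
def flowTwo : Op :=
  cubic (ofField (omega₂ h) - N)
    (N - const h⁻¹ * X + X * (ofField .field + shift (ofField .field))) (const h⁻¹ * X) 0

open Scalar in
/-- The operator `B₃`. -/
def flowThree : Op :=
  cubic (ofField (omega₃ h) + const h⁻¹ * N)
    (X * opThreeCoeff h + (const h⁻¹ * X + N) *
      (ofField .field + shift (ofField .field) - 2 * const h⁻¹) + ofField (.invDiff .field))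
    (const h⁻¹ * X * (ofField .field + shift (ofField .field) + shift (shift (ofField .field))) -
      2 * const h⁻¹ ^ 2 * X + const h⁻¹ * N)
    (const h⁻¹ ^ 2 * X)

variable {h}

theorem const_mul_const_inv (hh : h ≠ 0) : Scalar.const h * Scalar.const h⁻¹ = 1 := by
  rw [← map_mul, mul_inv_cancel₀ hh, map_one]

/-- Cancels `h⁻¹` against `h` in advance, so that the curvature equations of `B₂` and `B₃` become
polynomial identities provable by `ring`. -/
theorem const_inv_mul_shift_sub_ofField (hh : h ≠ 0) (f : FieldFun) (z : Scalar) :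
    Scalar.const h⁻¹ * (Scalar.shift (Scalar.ofField (h • f) + z) - (Scalar.ofField (h • f) + z)) =
      Scalar.shift (Scalar.ofField f) - Scalar.ofField f +
        Scalar.const h⁻¹ * (Scalar.shift z - z) := by
  rw [Scalar.ofField_smul, map_add, map_mul, Scalar.shift_const]
  linear_combination (Scalar.shift (Scalar.ofField f) - Scalar.ofField f) * const_mul_const_inv hh

set_option linter.unusedSimpArgs false in
theorem zeroCurv_opTwo (k : ℤ) (hk : 1 ≤ k) :
    (zeroCurv h (opTwo h)).coeff k = 0 := by
  refine zeroCurv_cubic rfl rfl ?_ ?_ ?_ k hk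
  all_goals
    simp only [gamma₂, map_add, map_sub, map_mul, map_pow, map_neg, map_zero,
      map_one, map_ofNat,
      Scalar.ofField_smul,
      Scalar.ofField_mul, Scalar.ofField_mulX, Scalar.ofField_mulN, Scalar.shift_ofField_invDiff,
      Scalar.shift_const, Scalar.shift_X, Scalar.shift_N, Scalar.dx_mul, Scalar.dx_const,
      Scalar.dx_sq, Scalar.dx_const_pow, Scalar.dx_two, Scalar.dx_three, Scalar.dx_X, Scalar.dx_N,
      Scalar.dx_shift, FieldFun.dx_invDiff, Scalar.dx_ofField]
    ring

set_option linter.unusedSimpArgs false in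
theorem zeroCurv_opThree (k : ℤ) (hk : 1 ≤ k) :
    (zeroCurv h (opThree h)).coeff k = 0 := by
  refine zeroCurv_cubic rfl rfl ?_ ?_ ?_ k hk
  all_goals
    simp only [gamma₃, opThreeCoeff, map_add, map_sub, map_mul, map_pow, map_neg, map_zero,
      map_one, map_ofNat,
      Scalar.ofField_smul,
      Scalar.ofField_mul, Scalar.ofField_mulX, Scalar.ofField_mulN, Scalar.shift_ofField_invDiff,
      Scalar.shift_const, Scalar.shift_X, Scalar.shift_N, Scalar.dx_mul, Scalar.dx_const,
      Scalar.dx_sq, Scalar.dx_const_pow, Scalar.dx_two, Scalar.dx_three, Scalar.dx_X, Scalar.dx_N,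
      Scalar.dx_shift, FieldFun.dx_invDiff, Scalar.dx_ofField]
    ring

set_option linter.unusedSimpArgs false in
theorem zeroCurv_flowOne (hh : h ≠ 0) (k : ℤ) (hk : 1 ≤ k) :
    (zeroCurv h (flowOne h)).coeff k = 0 := by
  refine zeroCurv_cubic rfl rfl ?_ ?_ ?_ k hk
  all_goals
    simp only [omega₁, map_add, map_sub, map_mul, map_pow, map_neg, map_zero,
      map_one, map_ofNat,
      Scalar.ofField_smul,
      Scalar.ofField_mul, Scalar.ofField_mulX, Scalar.ofField_mulN, Scalar.shift_ofField_invDiff,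
      Scalar.shift_const, Scalar.shift_X, Scalar.shift_N, Scalar.dx_mul, Scalar.dx_const,
      Scalar.dx_sq, Scalar.dx_const_pow, Scalar.dx_two, Scalar.dx_three, Scalar.dx_X, Scalar.dx_N,
      Scalar.dx_shift, FieldFun.dx_invDiff, Scalar.dx_ofField]
    try ring1
  -- Only the coefficient at `E` is left; it needs `h h⁻¹ = 1`, which `ring` does not know for
  -- scalars.
  linear_combination (Scalar.X * (Scalar.ofField .field - Scalar.shift (Scalar.ofField .field)) - 1) *
    const_mul_const_inv hh

set_option linter.unusedSimpArgs false in
theorem zeroCurv_flowTwo (hh : h ≠ 0) (k : ℤ) (hk : 1 ≤ k) :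
    (zeroCurv h (flowTwo h)).coeff k = 0 := by
  refine zeroCurv_cubic rfl rfl ?_ ?_ ?_ k hk
  on_goal 3 => rw [omega₂_eq, map_add Scalar.ofField, add_sub_assoc,
    const_inv_mul_shift_sub_ofField hh]
  all_goals
    simp only [gamma₂, map_add, map_sub, map_mul, map_pow, map_neg, map_zero,
      map_one, map_ofNat,
      Scalar.ofField_smul,
      Scalar.ofField_mul, Scalar.ofField_mulX, Scalar.ofField_mulN, Scalar.shift_ofField_invDiff,
      Scalar.shift_const, Scalar.shift_X, Scalar.shift_N, Scalar.dx_mul, Scalar.dx_const,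
      Scalar.dx_sq, Scalar.dx_const_pow, Scalar.dx_two, Scalar.dx_three, Scalar.dx_X, Scalar.dx_N,
      Scalar.dx_shift, FieldFun.dx_invDiff, Scalar.dx_ofField]
    ring

set_option linter.unusedSimpArgs false in
theorem zeroCurv_flowThree (hh : h ≠ 0) (k : ℤ) (hk : 1 ≤ k) :
    (zeroCurv h (flowThree h)).coeff k = 0 := by
  refine zeroCurv_cubic rfl rfl ?_ ?_ ?_ k hk
  on_goal 3 => rw [omega₃_eq, map_add Scalar.ofField, add_assoc (Scalar.ofField _),
    const_inv_mul_shift_sub_ofField hh]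
  all_goals
    simp only [gamma₃, gamma₂, opThreeCoeff, map_add, map_sub, map_mul, map_pow, map_neg, map_zero,
      map_one, map_ofNat,
      Scalar.ofField_smul,
      Scalar.ofField_mul, Scalar.ofField_mulX, Scalar.ofField_mulN, Scalar.shift_ofField_invDiff,
      Scalar.shift_const, Scalar.shift_X, Scalar.shift_N, Scalar.dx_mul, Scalar.dx_const,
      Scalar.dx_sq, Scalar.dx_const_pow, Scalar.dx_two, Scalar.dx_three, Scalar.dx_X, Scalar.dx_N,
      Scalar.dx_shift, FieldFun.dx_invDiff, Scalar.dx_ofField]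
    ring

/-- Values at `u = 0` are compared in the quotient by `vanishing`: every function of the field
disappears and a polynomial identity in `x`, `n`, `h` and `h⁻¹` remains. -/
theorem mk_ofField (f : FieldFun) :
    Ideal.Quotient.mk Scalar.vanishing (Scalar.ofField f) = 0 :=
  Ideal.Quotient.eq_zero_iff_mem.2 (Scalar.ofField_mem f)

theorem mk_const_mul_const_inv (hh : h ≠ 0) :
    Ideal.Quotient.mk Scalar.vanishing (Scalar.const h) *
      Ideal.Quotient.mk Scalar.vanishing (Scalar.const h⁻¹) = 1 := by
  rw [← map_mul, const_mul_const_inv hh, map_one]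

theorem opTwo_sub_mem : opTwo h - D h ^ 2 ∈ vanishing := by
  rw [opTwo, D_pow_two]
  refine cubic_sub_cubic_mem ?_ ?_ ?_ ?_ <;> rw [← Ideal.Quotient.eq]
  all_goals
    simp only [map_add, map_sub, map_mul, map_pow, map_neg, map_ofNat, Scalar.shift_ofField,
      mk_ofField]
    try ring1

theorem opThree_sub_mem : opThree h - D h ^ 3 ∈ vanishing := by
  rw [opThree, D_pow_three]
  refine cubic_sub_cubic_mem ?_ ?_ ?_ ?_ <;> rw [← Ideal.Quotient.eq]
  all_goals
    simp only [opThreeCoeff, map_add, map_sub, map_mul, map_pow, map_neg, map_ofNat,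
      Scalar.shift_ofField, mk_ofField]
    try ring1

theorem isFlowOp_flowOne (hh : h ≠ 0) : IsFlowOp h 0 (flowOne h) (omega₁ h) where
  isDifference := isDifference_cubic _ _ _ _
  asymptotic := by
    rw [flowOne, M_mul_D_pow_zero]
    refine cubic_sub_cubic_mem ?_ ?_ ?_ ?_ <;> rw [← Ideal.Quotient.eq]
    simp only [map_add, map_mul, mk_ofField, zero_add]
  zeroCurv_eq_zero := zeroCurv_flowOne hh
  coeff_zero := by
    rw [flowOne, coeff_cubic, if_pos rfl, pow_zero, mul_one]

theorem isFlowOp_flowTwo (hh : h ≠ 0) : IsFlowOp h 1 (flowTwo h) (omega₂ h) where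
  isDifference := isDifference_cubic _ _ _ _
  asymptotic := by
    rw [flowTwo, M_mul_D_pow_one]
    refine cubic_sub_cubic_mem ?_ ?_ ?_ ?_ <;> rw [← Ideal.Quotient.eq]
    all_goals simp only [map_add, map_sub, map_mul, map_neg, Scalar.shift_ofField, mk_ofField]
    · linear_combination Ideal.Quotient.mk Scalar.vanishing Scalar.N * mk_const_mul_const_inv hh
    · linear_combination -Ideal.Quotient.mk Scalar.vanishing Scalar.N * mk_const_mul_const_inv hh
  zeroCurv_eq_zero := zeroCurv_flowTwo hh
  coeff_zero := by
    rw [flowTwo, coeff_cubic, if_pos rfl, pow_one, mul_neg, mul_inv_cancel₀ hh, map_neg, map_one]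
    ring

theorem isFlowOp_flowThree (hh : h ≠ 0) : IsFlowOp h 2 (flowThree h) (omega₃ h) where
  isDifference := isDifference_cubic _ _ _ _
  asymptotic := by
    rw [flowThree, M_mul_D_pow_two]
    refine cubic_sub_cubic_mem ?_ ?_ ?_ ?_ <;> rw [← Ideal.Quotient.eq]
    all_goals simp only [opThreeCoeff, map_add, map_sub, map_mul, map_pow, map_ofNat,
      Scalar.shift_ofField, mk_ofField]
    · linear_combination -(Ideal.Quotient.mk Scalar.vanishing (Scalar.const h⁻¹) *
        Ideal.Quotient.mk Scalar.vanishing Scalar.N) * mk_const_mul_const_inv hh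
    · linear_combination 2 * (Ideal.Quotient.mk Scalar.vanishing (Scalar.const h⁻¹) *
        Ideal.Quotient.mk Scalar.vanishing Scalar.N) * mk_const_mul_const_inv hh
    · linear_combination -(Ideal.Quotient.mk Scalar.vanishing (Scalar.const h⁻¹) *
        Ideal.Quotient.mk Scalar.vanishing Scalar.N) * mk_const_mul_const_inv hh
  zeroCurv_eq_zero := zeroCurv_flowThree hh
  coeff_zero := by
    have : h * (-h⁻¹) ^ 2 = h⁻¹ := by field_simp
    rw [flowThree, coeff_cubic, if_pos rfl, this]

theorem isIsospectralFlow_one (hh : h ≠ 0) :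
    IsIsospectralFlow h (toPseudoDiff (lax h)) 1 (FieldFun.dx .field) ∧
      ∀ γ', IsIsospectralFlow h (toPseudoDiff (lax h)) 1 (FieldFun.dx γ') → γ' = .field := by
  have e : A₁ h = cubic (Scalar.ofField .field - Scalar.const h⁻¹) (Scalar.const h⁻¹) 0 0 := by
    rw [A₁, smul_def, Δ, cubic, map_sub, map_zero]
    noncomm_ring
  refine isIsospectralFlow_of_zeroCurv h hh 1 (P := A₁ h) ?_ ?_ ?_ (r := -h⁻¹) ?_
  · rw [e]; exact isDifference_cubic _ _ _ _
  · intro k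
    rw [A₁, pow_one, D, add_sub_cancel_left, coeff_C]
    split_ifs
    exacts [Scalar.ofField_mem _, zero_mem _]
  · intro k hk
    rw [e]
    refine zeroCurv_cubic rfl rfl ?_ ?_ ?_ k hk <;>
      simp [Scalar.shift_const, Scalar.dx_const]
    ring
  · rw [e, coeff_cubic, if_pos rfl, map_neg, sub_eq_add_neg]

theorem isIsospectralFlow_two (hh : h ≠ 0) :
    IsIsospectralFlow h (toPseudoDiff (lax h)) 2 (FieldFun.dx (gamma₂ h)) ∧
      ∀ γ', IsIsospectralFlow h (toPseudoDiff (lax h)) 2 (FieldFun.dx γ') → γ' = gamma₂ h :=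
  isIsospectralFlow_of_zeroCurv h hh 2 (P := opTwo h) (isDifference_cubic _ _ _ _)
    opTwo_sub_mem zeroCurv_opTwo
    (r := h⁻¹ ^ 2) (by rw [opTwo, coeff_cubic, if_pos rfl, map_pow])

theorem isIsospectralFlow_three (hh : h ≠ 0) :
    IsIsospectralFlow h (toPseudoDiff (lax h)) 3 (FieldFun.dx (gamma₃ h)) ∧
      ∀ γ', IsIsospectralFlow h (toPseudoDiff (lax h)) 3 (FieldFun.dx γ') → γ' = gamma₃ h :=
  isIsospectralFlow_of_zeroCurv h hh 3 (P := opThree h) (isDifference_cubic _ _ _ _)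
    opThree_sub_mem zeroCurv_opThree
    (r := -h⁻¹ ^ 3) (by
      rw [opThree, coeff_cubic, if_pos rfl, map_neg, map_pow, sub_eq_add_neg])

end Op
end DDKP

namespace DDKP

open FieldFun

/-! ### The formal calculus of variations -/

theorem mul_mem_density (f g : FieldFun) : f * g ∈ Density := Submodule.subset_span ⟨f, g, rfl⟩

theorem integral_diff {ρ : FieldFun} (hρ : ρ ∈ Density) : integral (diff ρ) = 0 :=
  (Submodule.Quotient.mk_eq_zero _).2 (Submodule.mem_sup_left ⟨ρ, hρ, rfl⟩)

theorem integral_dx {ρ : FieldFun} (hρ : ρ ∈ Density) : integral (dx ρ) = 0 :=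
  (Submodule.Quotient.mk_eq_zero _).2 (Submodule.mem_sup_right ⟨ρ, hρ, rfl⟩)

theorem integral_shift_mul_shift (f g : FieldFun) :
    integral (shift 1 f * shift 1 g) = integral (f * g) := by
  have := integral_diff (mul_mem_density f g)
  rwa [diff_eq, map_sub, shift_mul, sub_eq_zero] at this

theorem integral_dx_mul (f g : FieldFun) : integral (dx f * g) = -integral (f * dx g) := by
  have := integral_dx (mul_mem_density f g)
  rw [dx_mul, map_add] at this
  exact eq_neg_of_add_eq_zero_left this

/-- The adjoint of `Δ⁻¹` is `-E Δ⁻¹ = -(Δ⁻¹ + 1)`: expand the shift-invariance of the integral of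
`Δ⁻¹f · Δ⁻¹g` using `E Δ⁻¹ = Δ⁻¹ + 1`. -/
theorem integral_invDiff_mul (f g : FieldFun) :
    integral (invDiff f * g) = -integral (f * (invDiff g + g)) := by
  have e := integral_shift_mul_shift (invDiff f) (invDiff g)
  simp only [shift_invDiff, add_mul, mul_add, map_add] at e ⊢
  linear_combination (norm := module) e

theorem integral_mulX_mul (f g : FieldFun) : integral (mulX f * g) = integral (f * mulX g) := by
  rw [mul_mulX, ← mulX_mul]

theorem integral_mulN_mul (f g : FieldFun) : integral (mulN f * g) = integral (f * mulN g) := by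
  rw [mul_mulN, ← mulN_mul]

theorem integral_smul_mul (c : ℝ) (f g : FieldFun) :
    integral ((c • f) * g) = integral (f * (c • g)) := by
  rw [smul_mul_assoc, mul_smul_comm]

theorem gateaux_mem_density {ρ : FieldFun} (hρ : ρ ∈ Density) (g : FieldFun) :
    gateaux ρ g ∈ Density := by
  induction hρ using Submodule.span_induction with
  | mem _ h =>
    obtain ⟨a, b, rfl⟩ := h
    rw [gateaux_mul]
    exact add_mem (mul_mem_density _ _) (mul_mem_density _ _)
  | zero => rw [gateaux_zero]; exact zero_mem _
  | add _ _ _ _ h₁ h₂ => rw [gateaux_add]; exact add_mem h₁ h₂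
  | smul c _ _ h => rw [gateaux_smul]; exact Submodule.smul_mem _ _ h

/-- Derivatives of densities are densities and commute with `Δ` and `∂ₓ`, so null densities have
null derivatives and `H'[g]` depends on the functional alone. -/
theorem integral_gateaux_congr {a b : FieldFun} (hab : integral a = integral b) (g : FieldFun) :
    integral (gateaux a g) = integral (gateaux b g) := by
  rw [integral, Submodule.mkQ_apply, Submodule.mkQ_apply, Submodule.Quotient.eq] at hab
  obtain ⟨_, ⟨ρ, hρ, rfl⟩, _, ⟨τ, hτ, rfl⟩, e⟩ := Submodule.mem_sup.1 hab
  rw [← sub_eq_zero, ← map_sub, ← gateaux_sub, ← e, gateaux_add, gateaux_diff, gateaux_dx, map_add,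
    integral_diff (gateaux_mem_density hρ g), integral_dx (gateaux_mem_density hτ g), add_zero]

/-- The Gateaux derivative of `w` is a symmetric operator. -/
def Sym (w : FieldFun) : Prop :=
  ∀ f g : FieldFun, integral (gateaux w f * g) = integral (f * gateaux w g)

theorem IsGradient.add {h : ℝ} {H K : Functional} {f g : FieldFun} (hf : IsGradient h H f)
    (hg : IsGradient h K g) : IsGradient h (H + K) (f + g) := by
  obtain ⟨ρ, hρ, rfl, h₁⟩ := hf
  obtain ⟨τ, hτ, rfl, h₂⟩ := hg
  refine ⟨ρ + τ, add_mem hρ hτ, (map_add _ _ _).symm, fun k => ?_⟩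
  rw [gateaux_add, map_add, h₁, h₂, inner, inner, inner, add_mul, map_add, smul_add]

theorem IsGradient.smul {h : ℝ} {H : Functional} {f : FieldFun} (c : ℝ) (hf : IsGradient h H f) :
    IsGradient h (c • H) (c • f) := by
  obtain ⟨ρ, hρ, rfl, h₁⟩ := hf
  refine ⟨c • ρ, Submodule.smul_mem _ _ hρ, (map_smul _ _ _).symm, fun k => ?_⟩
  rw [gateaux_smul, map_smul, h₁, inner, inner, smul_mul_assoc, map_smul, smul_comm]

theorem IsGradient.sub {h : ℝ} {H K : Functional} {f g : FieldFun} (hf : IsGradient h H f)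
    (hg : IsGradient h K g) : IsGradient h (H - K) (f - g) := by
  simpa only [neg_one_smul, ← sub_eq_add_neg] using hf.add (hg.smul (-1))

/-- Up to the factor `h²/2`, the form `w'[f] · g` integrates to the second derivative `(ρ'[g])'[f] -
ρ'[g'[f]]` of the density, which is symmetric in `f` and `g` by `gateaux_gateaux_sub`. -/
theorem IsGradient.sym {h : ℝ} (hh : h ≠ 0) {H : Functional} {w : FieldFun}
    (hw : IsGradient h H w) : Sym w := by
  obtain ⟨ρ, -, -, hρ⟩ := hw
  have hc : h ^ 2 / 2 ≠ 0 := by positivity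
  have key : ∀ f g, (h ^ 2 / 2) • integral (gateaux w f * g) =
      integral (gateaux (gateaux ρ g) f - gateaux ρ (gateaux g f)) := fun f g => by
    have e : integral (gateaux ρ g) = integral ((h ^ 2 / 2) • (w * g)) := by
      rw [hρ, inner, map_smul]
    rw [map_sub, integral_gateaux_congr e, hρ, inner, gateaux_smul, gateaux_mul, map_smul, map_add,
      smul_add, add_sub_cancel_right]
  intro f g
  have := (key f g).trans (Eq.trans ?_ (key g f).symm)
  · rw [mul_comm f]
    rw [← inv_smul_smul₀ hc (integral (gateaux w f * g)), this, inv_smul_smul₀ hc]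
  · have := gateaux_gateaux_sub f g ρ
    congr 1
    linear_combination (norm := module) this

/-- Differentiate `f g_x` along `k`, integrate by parts in the second term, and move both
derivatives off `k` by symmetry. -/
theorem Sym.isGradient_inner {h : ℝ} {f g : FieldFun} (hf : Sym f) (hg : Sym g) :
    IsGradient h (inner h f (dx g)) (gateaux f (dx g) - gateaux g (dx f)) := by
  refine ⟨(h ^ 2 / 2) • (f * dx g), Submodule.smul_mem _ _ (mul_mem_density _ _),
    by rw [inner, map_smul], fun k => ?_⟩
  have e : integral (f * dx (gateaux g k)) = -integral (dx f * gateaux g k) := by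
    rw [integral_dx_mul, neg_neg]
  rw [gateaux_smul, map_smul, inner, gateaux_mul, gateaux_dx, map_add, sub_mul, map_sub, hf, e, ← hg,
    mul_comm k, mul_comm, sub_eq_add_neg]

/-- `∂ₓ` does not depend on `u`, so each term of the Jacobi identity is zero. -/
theorem isImplectic_dx (h : ℝ) : IsImplectic h dx := by
  have : ∀ k g, operatorDeriv dx k g = 0 := fun k g => by
    rw [operatorDeriv, gateaux_dx, sub_self]
  refine ⟨fun f g => ?_, fun f g k => ?_⟩
  · rw [inner, inner, integral_dx_mul, smul_neg]
  · simp only [this, inner, mul_zero, map_zero, smul_zero, add_zero]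

/-! ### Homogeneous functions of the field -/

/-- `w (t u) = t ^ d w (u)`. -/
def Homogeneous (d : ℕ) (w : FieldFun) : Prop := ∀ (u : Phase) (t : ℝ), w.1 (t • u) = t ^ d • w.1 u

namespace Homogeneous

variable {d e : ℕ} {v w : FieldFun}

theorem field : Homogeneous 1 field := fun u t => by rw [pow_one]; rfl

theorem add (hv : Homogeneous d v) (hw : Homogeneous d w) : Homogeneous d (v + w) := fun u t => by
  change v.1 _ + w.1 _ = _ • (v.1 u + w.1 u)
  rw [hv, hw, smul_add]

theorem smul (c : ℝ) (hv : Homogeneous d v) : Homogeneous d (c • v) := fun u t => by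
  change c • v.1 _ = _ • c • v.1 u
  rw [hv, smul_comm]

theorem sub (hv : Homogeneous d v) (hw : Homogeneous d w) : Homogeneous d (v - w) := by
  simpa only [neg_one_smul, ← sub_eq_add_neg] using hv.add (hw.smul (-1))

theorem mul (hv : Homogeneous d v) (hw : Homogeneous e w) : Homogeneous (d + e) (v * w) :=
  fun u t => by
    change v.1 _ * w.1 _ = _ • (v.1 u * w.1 u)
    rw [hv, hw, smul_mul_smul_comm, pow_add]

theorem mulX (hv : Homogeneous d v) : Homogeneous d (mulX v) := fun u t => by
  change Phase.mulX (v.1 _) = _ • Phase.mulX (v.1 u)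
  rw [hv, map_smul]

theorem mulN (hv : Homogeneous d v) : Homogeneous d (mulN v) := fun u t => by
  change Phase.mulN (v.1 _) = _ • Phase.mulN (v.1 u)
  rw [hv, map_smul]

theorem invDiff (hv : Homogeneous d v) : Homogeneous d (invDiff v) := fun u t => by
  change Phase.invDiff (v.1 _) = _ • Phase.invDiff (v.1 u)
  rw [hv, map_smul]

theorem dx (hv : Homogeneous d v) : Homogeneous d (dx v) := fun u t => by
  change Phase.dx (v.1 _) = _ • Phase.dx (v.1 u)
  rw [hv, map_smul]

theorem eval_smul (hv : Homogeneous d v) (u : Phase) (t : ℝ) (n : ℤ) (x : ℝ) :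
    eval v (t • u) n x = t ^ d * eval v u n x := by
  rw [eval, hv]; rfl

/-- Along its own direction the field is scaled to `(1 + ε) u`, so the function is multiplied by `(1
+ ε)^d`. -/
theorem gateaux_field (hv : Homogeneous d v) : gateaux v FieldFun.field = (d : ℝ) • v := by
  refine FieldFun.ext fun u n x => ?_
  have h₁ := gateaux_spec v FieldFun.field u n x
  have h₂ : ∀ ε : ℝ, eval v (u + ε • FieldFun.field.1 u) n x = (1 + ε) ^ d * eval v u n x :=
    fun ε => by
      rw [← hv.eval_smul, add_smul, one_smul]; rfl
  simp only [h₂] at h₁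
  have h₃ := (((hasDerivAt_id (0 : ℝ)).const_add 1).pow d).mul_const (eval v u n x)
  rw [h₁.unique h₃, FieldFun.eval_smul]
  simp

/-- Euler's formula: a homogeneous function with symmetric derivative is a gradient. -/
theorem isGradient (h : ℝ) (hv : Homogeneous d v) (hs : Sym v) :
    IsGradient h ((h ^ 2 / 2) • integral (((d : ℝ) + 1)⁻¹ • (v * FieldFun.field))) v := by
  have hd : (d : ℝ) + 1 ≠ 0 := by positivity
  refine ⟨(h ^ 2 / 2) • ((d : ℝ) + 1)⁻¹ • (v * FieldFun.field),
    Submodule.smul_mem _ _ (Submodule.smul_mem _ _ (mul_mem_density _ _)), (map_smul _ _ _).symm,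
    fun k => ?_⟩
  rw [gateaux_smul, gateaux_smul, gateaux_mul, FieldFun.gateaux_field, map_smul, map_smul, map_add,
    mul_comm (gateaux v k), mul_comm FieldFun.field, hs, hv.gateaux_field, mul_smul_comm, map_smul,
    mul_comm k, inner]
  congr 1
  rw [inv_smul_eq_iff₀ hd, add_smul, one_smul]

end Homogeneous

end DDKP

/-! ### Symmetry of `ω₁`, `ω₂`, `ω₃` and the Hamiltonians of `ω₁` and `ω₃` -/

namespace DDKP

open FieldFun

theorem FieldFun.invDiff_mulX (f : FieldFun) : invDiff (mulX f) = mulX (invDiff f) := by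
  refine diff_injective ?_
  rw [diff_invDiff, diff_eq, shift_mulX, shift_invDiff, map_add, add_sub_cancel_left]

/-- Apply `Δ` and use `Δ(n g) = n Δg + E g` with `g = Δ⁻¹ f`. -/
theorem FieldFun.invDiff_mulN (f : FieldFun) :
    invDiff (mulN f) = mulN (invDiff f) - invDiff (invDiff f) - invDiff f := by
  refine diff_injective ?_
  simp only [diff_invDiff, map_sub]
  rw [diff_eq, shift_mulN, shift_invDiff, map_add]
  abel

theorem integral_field_mul (f g : FieldFun) :
    integral (field * (f * g)) = integral (f * (field * g)) := by
  rw [mul_left_comm]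

section

variable (h : ℝ)

/-- The linear part of `ω₃`. -/
def omegaThreeLin : FieldFun :=
  h • mulX (dx (dx field) + (3 : ℝ) • invDiff (dx (dx field)) +
      (3 : ℝ) • invDiff (invDiff (dx (dx field)))) -
    (2 : ℝ) • mulX (dx field + (2 : ℝ) • invDiff (dx field)) + h⁻¹ • mulX field +
    h • mulN (dx field + (2 : ℝ) • invDiff (dx field)) - (2 : ℝ) • mulN field +
    (2 * h) • invDiff (invDiff (dx field)) - (2 : ℝ) • invDiff field

/-- The quadratic part of `ω₃`. -/
def omegaThreeQuad : FieldFun :=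
  (3 * h) • mulX (field * dx field + field * invDiff (dx field) + invDiff (field * dx field)) -
    (2 : ℝ) • mulX (field * field) + h • mulN (field * field) + h • invDiff (field * field) +
    h • (field * invDiff field)

/-- The cubic part of `ω₃`. -/
def omegaThreeCubic : FieldFun := h • mulX (field * field * field)

variable {h}

/-- Splits `ω₃` by degree in `u`, so that Euler's formula applies to each part separately. -/
theorem omega₃_eq_add (hh : h ≠ 0) :
    omega₃ h = omegaThreeLin h + omegaThreeQuad h + omegaThreeCubic h := by
  simp only [omega₃, omegaThreeLin, omegaThreeQuad, omegaThreeCubic, gamma₂, gamma₃, map_add,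
    map_sub, map_smul]
  match_scalars <;> field_simp <;> ring

set_option linter.unusedSimpArgs false

theorem sym_omega₁ : Sym (omega₁ h) := fun f g => by
  simp only [omega₁, gateaux_smul, gateaux_mulX, gateaux_field, integral_smul_mul,
    integral_mulX_mul, map_smul]

/-- Differentiate, move every operator off `f` by transposition under the integral, then pull `x`
and `n` outermost on both sides; the results agree as linear combinations. The linear and quadratic
parts of `ω₃` follow the same scheme. -/
theorem sym_omega₂  : Sym (omega₂ h) := fun f g => by
  simp only [omega₂, gamma₂, gateaux_smul, gateaux_add, gateaux_sub, gateaux_mul, gateaux_mulX,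
    gateaux_mulN, gateaux_dx, gateaux_invDiff, gateaux_field, map_add, map_sub, map_smul, smul_add,
    smul_sub, add_mul, sub_mul, smul_mul_assoc, mul_assoc]
  simp only [integral_mulX_mul, integral_mulN_mul, integral_invDiff_mul, integral_dx_mul,
    integral_field_mul, mul_assoc, add_mul, map_add]
  simp only [map_add, map_sub, map_smul, mul_add, mul_sub, mul_smul_comm, dx_mulX, dx_mulN, dx_mul,
    dx_invDiff, invDiff_mulX, invDiff_mulN, mul_mulX field, mul_mulN field, mul_mulX (dx field),
    mul_mulX (invDiff _), mul_comm g, mul_assoc, smul_add, smul_sub]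
  module

theorem sym_omegaThreeLin  : Sym (omegaThreeLin h) := fun f g => by
  simp only [omegaThreeLin, gateaux_smul, gateaux_add, gateaux_sub, gateaux_mul, gateaux_mulX,
    gateaux_mulN, gateaux_dx, gateaux_invDiff, gateaux_field, map_add, map_sub, map_smul, smul_add,
    smul_sub, add_mul, sub_mul, smul_mul_assoc, mul_assoc]
  simp only [integral_mulX_mul, integral_mulN_mul, integral_invDiff_mul, integral_dx_mul,
    integral_field_mul, mul_assoc, add_mul, map_add]
  simp only [map_add, map_sub, map_smul, mul_add, mul_sub, mul_smul_comm, dx_mulX, dx_mulN, dx_mul,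
    dx_invDiff, invDiff_mulX, invDiff_mulN, mul_mulX field, mul_mulN field, mul_mulX (dx field),
    mul_mulX (invDiff _), mul_comm g, mul_assoc, smul_add, smul_sub]
  module

theorem sym_omegaThreeQuad  : Sym (omegaThreeQuad h) := fun f g => by
  simp only [omegaThreeQuad, gateaux_smul, gateaux_add, gateaux_sub, gateaux_mul, gateaux_mulX,
    gateaux_mulN, gateaux_dx, gateaux_invDiff, gateaux_field, map_add, map_sub, map_smul, smul_add,
    smul_sub, add_mul, sub_mul, smul_mul_assoc, mul_assoc]
  simp only [integral_mulX_mul, integral_mulN_mul, integral_invDiff_mul, integral_dx_mul,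
    integral_field_mul, mul_assoc, add_mul, map_add]
  simp only [map_add, map_sub, map_smul, mul_add, mul_sub, mul_smul_comm, dx_mulX, dx_mulN, dx_mul,
    dx_invDiff, invDiff_mulX, invDiff_mulN, mul_mulX field, mul_mulN field, mul_mulX (dx field),
    mul_mulX (invDiff _), mul_comm g, mul_assoc, smul_add, smul_sub]
  module

/-- Its derivative is multiplication by `3 h x u²`. -/
theorem sym_omegaThreeCubic : Sym (omegaThreeCubic h) := by
  have e : ∀ f, gateaux (omegaThreeCubic h) f = (3 * h) • mulX (field * field * f) := fun f => by
    rw [omegaThreeCubic, gateaux_smul, gateaux_mulX, gateaux_mul, gateaux_mul, gateaux_field,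
      mul_comm f field, add_mul, mul_right_comm field f field, map_add, map_add]
    module
  intro f g
  rw [e, e, integral_smul_mul, integral_mulX_mul, mul_comm _ f, mul_assoc, ← mul_mulX, map_smul,
    mul_smul_comm]

theorem homogeneous_omegaThreeLin : Homogeneous 1 (omegaThreeLin h) := by
  unfold omegaThreeLin
  repeat' first
    | exact .field | refine .sub ?_ ?_ | refine .add ?_ ?_ | refine .smul _ ?_ | refine .mulX ?_
    | refine .mulN ?_ | refine .invDiff ?_ | refine .dx ?_

theorem homogeneous_omegaThreeQuad : Homogeneous 2 (omegaThreeQuad h) := by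
  unfold omegaThreeQuad
  repeat' first
    | exact .field | refine .sub ?_ ?_ | refine .add ?_ ?_ | refine .smul _ ?_ | refine .mulX ?_
    | refine .mulN ?_ | refine .invDiff ?_ | refine .dx ?_ | refine .mul (d := 1) (e := 1) ?_ ?_

theorem homogeneous_omegaThreeCubic : Homogeneous 3 (omegaThreeCubic h) :=
  (Homogeneous.mulX ((Homogeneous.field.mul .field).mul .field)).smul h

variable (h)

/-- The density `∫₀¹ ω₃(t u) u dt`. -/
def rhoThree : FieldFun :=
  (((1 : ℕ) : ℝ) + 1)⁻¹ • (omegaThreeLin h * field) +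
    (((2 : ℕ) : ℝ) + 1)⁻¹ • (omegaThreeQuad h * field) +
    (((3 : ℕ) : ℝ) + 1)⁻¹ • (omegaThreeCubic h * field)

variable {h}

theorem isGradient_rhoThree (hh : h ≠ 0) :
    IsGradient h ((h ^ 2 / 2) • integral (rhoThree h)) (omega₃ h) := by
  rw [omega₃_eq_add hh, rhoThree, map_add, map_add, smul_add, smul_add]
  exact ((homogeneous_omegaThreeLin.isGradient h sym_omegaThreeLin).add
    (homogeneous_omegaThreeQuad.isGradient h sym_omegaThreeQuad)).add
    (homogeneous_omegaThreeCubic.isGradient h sym_omegaThreeCubic)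

/-- The weights `1/2`, `1/3`, `1/4` in the density are the integrals of `t`, `t²`, `t³` that
homogeneity produces. -/
theorem eval_rhoThree (hh : h ≠ 0) (u : Phase) (n : ℤ) (x : ℝ) :
    eval (rhoThree h) u n x = ∫ t in (0 : ℝ)..1, eval (omega₃ h) (t • u) n x * u.1 n x := by
  have e : ∀ t : ℝ, eval (omega₃ h) (t • u) n x * u.1 n x =
      t ^ 1 * (eval (omegaThreeLin h) u n x * u.1 n x) +
        t ^ 2 * (eval (omegaThreeQuad h) u n x * u.1 n x) +
        t ^ 3 * (eval (omegaThreeCubic h) u n x * u.1 n x) := fun t => by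
    rw [omega₃_eq_add hh, eval_add, eval_add, homogeneous_omegaThreeLin.eval_smul,
      homogeneous_omegaThreeQuad.eval_smul, homogeneous_omegaThreeCubic.eval_smul]
    ring
  have hi : ∀ (d : ℕ) (c : ℝ), IntervalIntegrable (fun t : ℝ => t ^ d * c) MeasureTheory.volume 0 1 :=
    fun d c => (by fun_prop : Continuous fun t : ℝ => t ^ d * c).intervalIntegrable _ _
  simp only [e]
  rw [intervalIntegral.integral_add ((hi 1 _).add (hi 2 _)) (hi 3 _),
    intervalIntegral.integral_add (hi 1 _) (hi 2 _)]
  simp only [intervalIntegral.integral_mul_const, integral_pow, rhoThree, eval_add, eval_smul,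
    eval_mul, eval_field]
  ring

theorem isGradient_omega₁ :
    IsGradient h ((h / 2) • inner h (mulX field) field) (omega₁ h) := by
  have H := (Homogeneous.field.mulX.smul h).isGradient h sym_omega₁
  have e : (h ^ 2 / 2) • integral ((((1 : ℕ) : ℝ) + 1)⁻¹ • (h • mulX field * field)) =
      (h / 2) • inner h (mulX field) field := by
    rw [inner, smul_mul_assoc, map_smul, map_smul]
    module
  rwa [e] at H

end

/-! ### The hierarchy -/

section

variable (h : ℝ)

/-- The gradient `ω_s`. -/
def omega : ℕ → FieldFun
  | 0 => 0
  | 1 => omega₁ h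
  | 2 => omega₂ h
  | 3 => omega₃ h
  | s + 4 => h⁻¹ • ((((s + 4 : ℕ) : ℝ) - 3)⁻¹ • (gateaux (omega (s + 3)) (dx (omega₂ h)) -
      gateaux (omega₂ h) (dx (omega (s + 3)))) - omega (s + 3))

/-- The Hamiltonian `J_s`. -/
def hamiltonian : ℕ → Functional
  | 0 => 0
  | 1 => (h / 2) • inner h (mulX field) field
  | 2 => h⁻¹ • ((((2 : ℕ) : ℝ) - 3)⁻¹ • inner h (omega₁ h) (dx (omega₂ h)) -
      (h / 2) • inner h (mulX field) field)
  | 3 => (h ^ 2 / 2) • integral (rhoThree h)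
  | s + 4 => h⁻¹ • ((((s + 4 : ℕ) : ℝ) - 3)⁻¹ • inner h (omega h (s + 3)) (dx (omega₂ h)) -
      hamiltonian (s + 3))

variable {h}

/-- At `s = 2` the coefficient `1/(s-3)` is `-1`, and the bracket of the first two gradients is `-(h
ω₂ + ω₁)`; the formula for `J₂` therefore has gradient `ω₂`. -/
theorem isGradient_omega₂ (hh : h ≠ 0) :
    IsGradient h (hamiltonian h 2) (omega₂ h) := by
  have H := ((((sym_omega₁ (h := h)).isGradient_inner (h := h)
    (sym_omega₂ (h := h))).smul
    (((2 : ℕ) : ℝ) - 3)⁻¹).sub (isGradient_omega₁)).smul h⁻¹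
  rw [Op.gateaux_sub_gateaux_eq hh (Op.isFlowOp_flowOne hh) (Op.isFlowOp_flowTwo hh)] at H
  have e : h⁻¹ • ((((2 : ℕ) : ℝ) - 3)⁻¹ • -(h • omega₂ h + omega₁ h) - omega₁ h) = omega₂ h := by
    norm_num
    rw [inv_smul_smul₀ hh]
  rwa [e] at H

theorem isGradient_omega (hh : h ≠ 0) : ∀ s, IsGradient h (hamiltonian h (s + 1)) (omega h (s + 1))
  | 0 => isGradient_omega₁
  | 1 => isGradient_omega₂ hh
  | 2 => isGradient_rhoThree hh
  | s + 3 => by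
    have ih := isGradient_omega hh (s + 2)
    exact ((((ih.sym hh).isGradient_inner sym_omega₂).smul _).sub ih).smul _

theorem exists_isFlowOp (hh : h ≠ 0) : ∀ j, ∃ b, Op.IsFlowOp h j b (omega h (j + 1))
  | 0 => ⟨_, Op.isFlowOp_flowOne hh⟩
  | 1 => ⟨_, Op.isFlowOp_flowTwo hh⟩
  | 2 => ⟨_, Op.isFlowOp_flowThree hh⟩
  | j + 3 => by
    obtain ⟨b, hb⟩ := exists_isFlowOp hh (j + 2)
    have hj : ((j + 2 : ℕ) : ℝ) - 1 ≠ 0 := by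
      push_cast; intro h0; linarith [(Nat.cast_nonneg j : (0 : ℝ) ≤ j)]
    -- The flow operator of index `j + 2` belongs to `ω_(j+3)`, so its factor `(j + 2) - 1` is the
    -- `s - 3` of the next gradient, `s = j + 4`.
    have e : ((j + 4 : ℕ) : ℝ) - 3 = ((j + 2 : ℕ) : ℝ) - 1 := by push_cast; ring
    have := hb.succ hh hj (Op.isFlowOp_flowTwo hh)
    rw [← e] at this
    exact ⟨_, this⟩

end

end DDKP

end

open DDKP DDKP.FieldFun in
/-- The non-isospectral differential-difference KP hierarchy `u_t = σ s`, `s = 1, 2, …`, is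
Hamiltonian with the operator `∂ₓ`, the gradients `ω s = ∂ₓ⁻¹ (σ s)` and the Hamiltonians `J s`. Here
`L` is the Lax operator, `γ s = ∂ₓ⁻¹ K_s` for the isospectral flows `K_s`, and `B s` is the
difference operator of the non-isospectral Lax triad. -/
theorem mainTheorem5 (h : ℝ) (hh : h ≠ 0) :
    ∃ (L : PseudoDiff) (γ : ℕ → FieldFun) (B : ℕ → PseudoDiff) (σ ω : ℕ → FieldFun)
      (J : ℕ → Functional),
      -- the hierarchy: all these objects exist and are unique
      (IsLaxOperator h L ∧ ∀ L', IsLaxOperator h L' → L' = L) ∧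
      (∀ s, 1 ≤ s → s ≤ 3 → IsIsospectralFlow h L s (dx (γ s)) ∧
        ∀ γ', IsIsospectralFlow h L s (dx γ') → γ' = γ s) ∧
      (∀ s, 1 ≤ s → IsNonisospectralFlow h L s (B s) (σ s) ∧
        ∀ B' σ', IsNonisospectralFlow h L s B' σ' → B' = B s ∧ σ' = σ s) ∧
      (∀ s, 1 ≤ s → dx (ω s) = σ s ∧ ∀ ω', dx ω' = σ s → ω' = ω s) ∧
      -- the Hamiltonian structure
      (∀ s, 1 ≤ s → IsHamiltonian h dx (σ s) (ω s) (J s)) ∧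
      -- the gradients
      ω 1 = h • mulX field ∧
      ω 2 = h • mulX (γ 2) + (mulX (γ 1) + h • mulN (γ 1)) + h • invDiff field ∧
      ω 3 = h • mulX (γ 3) + (mulX (γ 2) + h • mulN (γ 2))
        + (2 * h) • invDiff (invDiff (dx field)) + h • invDiff (field * field)
        + h • (field * invDiff field) - (2 : ℝ) • invDiff field ∧
      (∀ s, 4 ≤ s → ∃ G : FieldFun, IsGradient h (inner h (ω (s - 1)) (σ 2)) G ∧
        ω s = h⁻¹ • (((s : ℝ) - 3)⁻¹ • G - ω (s - 1))) ∧
      -- the Hamiltonians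
      J 1 = (h / 2) • inner h (mulX field) field ∧
      (∀ s, 2 ≤ s → s ≠ 3 →
        J s = h⁻¹ • (((s : ℝ) - 3)⁻¹ • inner h (ω (s - 1)) (σ 2) - J (s - 1))) ∧
      (∃ ρ : FieldFun,
        (∀ u n x, eval ρ u n x = ∫ t in (0 : ℝ)..1, eval (ω 3) (t • u) n x * u.1 n x) ∧
        J 3 = (h ^ 2 / 2) • integral ρ) := by
  -- The operators are indexed from zero: `b (s - 1)` is the operator of the flow `s`.
  choose b hb using exists_isFlowOp hh
  have flow : ∀ s, 1 ≤ s →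
      IsNonisospectralFlow h (Op.toPseudoDiff (Op.lax h)) s (Op.toPseudoDiff (b (s - 1)))
        (dx (omega h s)) ∧
      ∀ B' σ', IsNonisospectralFlow h (Op.toPseudoDiff (Op.lax h)) s B' σ' →
        B' = Op.toPseudoDiff (b (s - 1)) ∧ σ' = dx (omega h s) := fun s hs => by
    obtain ⟨j, rfl⟩ := Nat.exists_eq_add_of_le' hs
    exact (hb j).isNonisospectralFlow hh
  refine ⟨Op.toPseudoDiff (Op.lax h),
    -- The values of `γ` outside `1, 2, 3` are arbitrary.
    fun s => if s = 1 then field else if s = 2 then gamma₂ h else gamma₃ h,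
    fun s => Op.toPseudoDiff (b (s - 1)), fun s => dx (omega h s), omega h, hamiltonian h,
    ⟨Op.isLaxOperator_lax h hh, fun L' => Op.eq_of_isLaxOperator h hh⟩, fun s h₁ h₃ => ?_, flow,
    fun s _ => ⟨rfl, fun ω' hω => dx_injective hω⟩, fun s hs => ?_, rfl, ?_, ?_, fun s hs => ?_,
    rfl, fun s hs hs₃ => ?_, rhoThree h, eval_rhoThree hh, rfl⟩
  · interval_cases s
    exacts [Op.isIsospectralFlow_one hh, Op.isIsospectralFlow_two hh, Op.isIsospectralFlow_three hh]
  · obtain ⟨j, rfl⟩ := Nat.exists_eq_add_of_le' hs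
    exact ⟨isImplectic_dx h, isGradient_omega hh j, rfl⟩
  · rfl
  · rfl
  · obtain ⟨j, rfl⟩ := Nat.exists_eq_add_of_le' hs
    -- The required gradient is the bracket `ω'[σ₂] - ω₂'[σ]` occurring in the definition of
    -- `omega`.
    exact ⟨_, ((isGradient_omega hh (j + 2)).sym hh).isGradient_inner sym_omega₂, rfl⟩
  · match s, hs, hs₃ with
    | 2, _, _ => rfl
    | j + 4, _, _ => rfl
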